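/- **Setting.** Fix constants $\delta, c>0$ and $(\mu_p)_{p\in\mathbb N}$. For each $N$ let $(h_{ij}: 1\le i\le j\le N)$ be independent complex random variables with $\mathbb E h_{ij}=0$ and $h_{ii}\in\mathbb R$, put $h_{ij}:=\bar h_{ji}$ for $i>j$, and let $H=H_N=(h_{ij})$. Let $s_{ij}:=\mathbb E|h_{ij}|^2$, $S:=(s_{ij})$ and $M:=1/\max_{i,j}s_{ij}$. Assume that $\sum_j s_{ij}=1$ for all $i$, that $S$ is irreducible, that $N^\delta\le M\le N$, and that $\zeta_{ij}:=s_{ij}^{-1/2}h_{ij}$ satisfies $\mathbb E|\zeta_{ij}|^p\le\mu_p$ for all $p\in\mathbb N$ and all $N,i,j$ with $s_{ij}\neq 0$. For $z=E+\mathrm i\eta$ with $\eta>0$ let $m(z):=\frac1{2\pi}\int_{-2}^2\frac{\sqrt{4-x^2}}{x-z}\,dx$, $G=G(z):=(H-z)^{-1}$, $v_i:=G_{ii}-m$, and $$\Lambda:=\max\Big\{\max_{i\ne j}|G_{ij}|,\ \max_i|G_{ii}-m|\Big\},\qquad \Gamma:=\big\|(1-m^2S)^{-1}\big\|_{\ell^\infty\to\ell^\infty},\qquad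 \widetilde\Gamma:=\big\|(1-m^2S)^{-1}|_{\mathbf e^\perp}\big\|_{\ell^\infty\to\ell^\infty},$$ where $\mathbf e^\perp\subset\mathbb C^N$ is the space of vectors orthogonal to the constants. Let $[a]:=\frac1N\sum_i a_i$. Let $H^{(k)}$ be $H$ with its $k$-th row and column replaced by zero, and $Q_kX:=X-\mathbb E(X\mid H^{(k)})$. For families of nonnegative random variables $X=X^{(N)}(u)$, $Y=Y^{(N)}(u)$ with $u\in U^{(N)}$, write $X\prec Y$ if for all $\epsilon,D>0$ there is $N_0(\epsilon,D)$ with $\sup_{u}\mathbb P[X^{(N)}(u)>N^\epsilon Y^{(N)}(u)]\le N^{-D}$ for all $N\ge N_0(\epsilon,D)$; write $X=O_\prec(Y)$ if $|X|\prec Y$. All relations $\prec$ below are uniform in $z\in\mathbf D$, in the matrix indices, and in all other parameters except the fixed constants $\delta,c,(\mu_p)$ (thus the thresholds $N_0(\epsilon,D)$ in the conclusions depend only on these constants and on the thresholds in the hypothesis $\Lambda\prec\Psi$). **Theorem (Fluctuation averaging).** Let $\mathbf D=\mathbf D^{(N)}\subset\{E+\mathrm i\eta: |E|\le10,\ M^{-1}\le\eta\le10\}$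 and let $\Psi=\Psi^{(N)}(z)$ be deterministic with $M^{-1/2}\le\Psi\le M^{-c}$ on $\mathbf D$. Suppose that $\Lambda\prec\Psi$, and let $T=T^{(N)}=(t_{ik})_{i,k=1}^N$ be deterministic complex weights with $|t_{ik}|\le M^{-1}$ and $\sum_k|t_{ik}|\le1$ for all $i,k$. Then $$\sum_k t_{ik}\,Q_k\frac1{G_{kk}}=O_\prec(\Psi^2),\qquad \sum_k t_{ik}\,Q_kG_{kk}=O_\prec(\Psi^2).$$ If $T$ commutes with $S$, then $$\sum_k t_{ik}v_k=O_\prec(\Gamma\Psi^2).$$ If $T$ commutes with $S$ and $\sum_k t_{ik}=1$ for all $i$, then $$\sum_k t_{ik}(v_k-[v])=O_\prec(\widetilde\Gamma\Psi^2).$$ -/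

import Mathlib

open MeasureTheory ProbabilityTheory

namespace FluctAvg

noncomputable section

/-- Stochastic domination `X ≺ Y`. For each size `N` there is a set `A N` of model parameters, each
with its own probability space `Ω N a`, and a set `U N a` of further indices (spectral parameter,
matrix indices). The threshold `N₀` depends on `ε` and `D` only: it is uniform in `a` and `u`. -/
def StochDom {A : ℕ → Type*} {Ω : ∀ N, A N → Type*} [∀ N a, MeasurableSpace (Ω N a)]
    (P : ∀ N a, Measure (Ω N a)) {U : ∀ N, A N → Type*}
    (X Y : ∀ N a, U N a → Ω N a → ℝ) : Prop :=
  ∀ ε : ℝ, 0 < ε → ∀ D : ℝ, 0 < D → ∃ N₀ : ℕ, ∀ N : ℕ, N₀ ≤ N → ∀ (a : A N) (u : U N a),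
    (P N a).real {ω | (N : ℝ) ^ ε * Y N a u ω < X N a u ω} ≤ (N : ℝ) ^ (-D)

/-- The Stieltjes transform of the semicircle law. -/
def mSC (z : ℂ) : ℂ :=
  (1 / (2 * Real.pi) : ℂ) * ∫ x in (-2 : ℝ)..2, ((Real.sqrt (4 - x ^ 2) : ℝ) : ℂ) / ((x : ℂ) - z)

section OneSize

variable {N : ℕ}

/-- The resolvent `G(z) = (H - z)⁻¹`. -/
def green (H : Matrix (Fin N) (Fin N) ℂ) (z : ℂ) : Matrix (Fin N) (Fin N) ℂ :=
  (H - z • (1 : Matrix (Fin N) (Fin N) ℂ))⁻¹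

/-- `v_i = G_ii - m`. -/
def diagErr (H : Matrix (Fin N) (Fin N) ℂ) (z : ℂ) (i : Fin N) : ℂ :=
  green H z i i - mSC z

/-- The average `[a]` of a vector. -/
def avg (a : Fin N → ℂ) : ℂ := (1 / (N : ℂ)) * ∑ i, a i

/-- `Λ_o = max_{i ≠ j} |G_ij|`, which is `0` if there is no such pair. -/
def lambdaOff (H : Matrix (Fin N) (Fin N) ℂ) (z : ℂ) : ℝ :=
  ⨆ p : {p : Fin N × Fin N // p.1 ≠ p.2}, ‖green H z p.1.1 p.1.2‖

/-- `Λ_d = max_i |G_ii - m|`. -/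
def lambdaDiag (H : Matrix (Fin N) (Fin N) ℂ) (z : ℂ) : ℝ :=
  ⨆ i : Fin N, ‖green H z i i - mSC z‖

/-- `Λ = max {Λ_o, Λ_d}`. -/
def lambda (H : Matrix (Fin N) (Fin N) ℂ) (z : ℂ) : ℝ :=
  max (lambdaOff H z) (lambdaDiag H z)

/-- The minor `H^{(k)}`: the `k`-th row and column are replaced by zero. -/
def minor (H : Matrix (Fin N) (Fin N) ℂ) (k : Fin N) : Matrix (Fin N) (Fin N) ℂ :=
  Matrix.of fun i j => if i = k ∨ j = k then 0 else H i j

/-- A real matrix regarded as a complex one. -/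
def toC (S : Matrix (Fin N) (Fin N) ℝ) : Matrix (Fin N) (Fin N) ℂ :=
  S.map (fun x : ℝ => (x : ℂ))

/-- `(1 - m(z)² S)⁻¹`. -/
def stabInv (S : Matrix (Fin N) (Fin N) ℝ) (z : ℂ) : Matrix (Fin N) (Fin N) ℂ :=
  (1 - (mSC z) ^ 2 • toC S)⁻¹

/-- `Γ(z)`, the `ℓ^∞ → ℓ^∞` norm of `(1 - m(z)² S)⁻¹`, that is, its maximal absolute row sum. -/
def Gam (S : Matrix (Fin N) (Fin N) ℝ) (z : ℂ) : ℝ :=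
  ⨆ i : Fin N, ∑ j, ‖stabInv S z i j‖

/-- The subspace of `ℂ^N` orthogonal to the constant vectors. -/
def ePerp (N : ℕ) : Submodule ℂ (Fin N → ℂ) :=
  LinearMap.ker (∑ i : Fin N, (LinearMap.proj i : (Fin N → ℂ) →ₗ[ℂ] ℂ))

/-- `Γ̃(z)`, the `ℓ^∞ → ℓ^∞` operator norm of the restriction of `(1 - m(z)² S)⁻¹` to the subspace
orthogonal to the constant vectors (`Fin N → ℂ` carries the supremum norm). -/
def GamTilde (S : Matrix (Fin N) (Fin N) ℝ) (z : ℂ) : ℝ :=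
  ‖(LinearMap.toContinuousLinearMap (Matrix.mulVecLin (stabInv S z))).comp (ePerp N).subtypeL‖

variable {Ω : Type*} [MeasurableSpace Ω]

/-- The matrix of variances `s_ij = E |h_ij|²`. -/
def variances (P : Measure Ω) (H : Ω → Matrix (Fin N) (Fin N) ℂ) : Matrix (Fin N) (Fin N) ℝ :=
  Matrix.of fun i j => ∫ ω, ‖H ω i j‖ ^ 2 ∂P

/-- `M = 1 / max_{i,j} s_ij`. -/
def bigM (P : Measure Ω) (H : Ω → Matrix (Fin N) (Fin N) ℂ) : ℝ :=
  1 / ⨆ p : Fin N × Fin N, variances P H p.1 p.2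

/-- The normalized entries `ζ_ij = s_ij^{-1/2} h_ij`. If `s_ij = 0`, then `h_ij = 0` almost surely,
and `ζ_ij` is `0` here; its law is immaterial in that case. -/
def zeta (P : Measure Ω) (H : Ω → Matrix (Fin N) (Fin N) ℂ) (i j : Fin N) (ω : Ω) : ℂ :=
  (((Real.sqrt (variances P H i j))⁻¹ : ℝ) : ℂ) * H ω i j

/-- The standing assumptions on the random matrix `H`, with constants `δ` and `μ_p`. -/
structure IsRandomMatrixModel (δ : ℝ) (μ : ℕ → ℝ) (P : Measure Ω)
    (H : Ω → Matrix (Fin N) (Fin N) ℂ) : Prop where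
  measurable : ∀ i j, Measurable fun ω => H ω i j
  hermitian : ∀ ω, (H ω).IsHermitian
  indep : iIndepFun
    (fun (p : {p : Fin N × Fin N // p.1 ≤ p.2}) (ω : Ω) => H ω p.1.1 p.1.2) P
  memLp : ∀ i j, ∀ p : ℕ, MemLp (fun ω => H ω i j) p P
  mean_zero : ∀ i j, ∫ ω, H ω i j ∂P = 0
  stochastic : ∀ i, ∑ j, variances P H i j = 1
  irreducible : (variances P H).IsIrreducible
  lower_M : (N : ℝ) ^ δ ≤ bigM P H
  upper_M : bigM P H ≤ (N : ℝ)
  moments : ∀ p : ℕ, ∀ i j, ∫ ω, ‖zeta P H i j ω‖ ^ p ∂P ≤ μ p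

/-- A spectral domain: a subset of `{E + iη : |E| ≤ 10, M⁻¹ ≤ η ≤ 10}`. -/
def IsSpectralDomain (M : ℝ) (D : Set ℂ) : Prop :=
  ∀ z ∈ D, |z.re| ≤ 10 ∧ M⁻¹ ≤ z.im ∧ z.im ≤ 10

/-- The partial expectation `P_k X = E(X | H^{(k)})`. -/
def partialExp (P : Measure Ω) (H : Ω → Matrix (Fin N) (Fin N) ℂ) (k : Fin N) (X : Ω → ℂ) :
    Ω → ℂ :=
  P[X | MeasurableSpace.comap
    (fun (ω : Ω) (p : Fin N × Fin N) => minor (H ω) k p.1 p.2) inferInstance]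

/-- `Q_k X = X - P_k X`. -/
def fluct (P : Measure Ω) (H : Ω → Matrix (Fin N) (Fin N) ℂ) (k : Fin N) (X : Ω → ℂ) (ω : Ω) : ℂ :=
  X ω - partialExp P H k X ω

end OneSize

end

end FluctAvg

/-! The gain from `Ψ` to `Ψ²` comes from weak dependence of the fluctuations `Q_k X_k`, where `X_k`
is `G_kk - m` or `1/G_kk - 1/m`. (`Q_k` kills constants, so the centring is free.) Expand the moment
`E |∑ t_k Q_k X_k|^(2q)` over label tuples. If a label `l` occurs only once and every other factor
is a function of `H^{(l)}`, the expectation vanishes, because `Q_l` projects onto the complement of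
such functions.

The other factors do depend on row `l`, but only slightly. For a set `L` of lone labels,
`eq_sum_setDiff` writes a functional of the minors as a sum over `A ⊆ L` of its iterated differences
in the directions `A`, evaluated with the rows `L \ A` removed. Such a term is `H^{(l)}`-measurable
for `l ∈ L \ A`. It also carries a factor `ψ` for each element of `A`: removing row `a` changes
`G_ij` by `G_ia G_aj / G_aa`, and a discrete Leibniz rule propagates this to all orders
(`ResolventFamily.diffBound`). In a surviving product every lone label lies in some `A`, so the
product has order at least `2q + |L|`. This is at least twice the number of distinct labels
(`two_mul_card_image_le`). Each coincidence of labels is paid for by a weight `|t_k| ≤ ψ²`, so the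
sum over tuples is `O(ψ^(4q))` (`sum_prod_mul_pow_card_image_le`), and Markov's inequality
concludes. These estimates take `ψ = N^ε' Ψ` and need `Λ ≤ ψ`; on the rare complement, polynomial
bounds on all moments suffice.

For the statements about `v`, the partial expectation of Schur's formula gives `v - m² S v = -m²
Q(1/G) + O(ψ²)` componentwise (`inv_green_eq_fluct`, `norm_residual_add_le`). If `T` commutes with
`S`, then `(1 - m² S) T v` is `T` applied to this residual, which is `O_≺(Ψ²)` by the first part,
and inverting `1 - m² S` costs `Γ`. In the centred version the right-hand side is orthogonal to the
constants, so the restricted inverse is enough. That orthogonality needs the column sums of `T` to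
be one, which irreducibility of `S` forces (`col_sum_eq_one`). -/

namespace FluctAvg

/-! ### The Stieltjes transform of the semicircle law -/

/-- A quadratic `w² + z w + 1` with `Im z > 0` has a root inside the unit disc. -/
theorem exists_root_norm_lt_one {z : ℂ} (hz : 0 < z.im) :
    ∃ w : ℂ, w ^ 2 + z * w + 1 = 0 ∧ ‖w‖ < 1 := by
  obtain ⟨s, hs⟩ := IsAlgClosed.exists_pow_nat_eq (z ^ 2 - 4) (n := 2) two_pos
  -- On the unit circle `w⁻¹` is the conjugate of `w`, so a root there would make `z` real. As the
  -- two roots have product one, exactly one of them lies inside.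
  have key : ∀ w : ℂ, w ^ 2 + z * w + 1 = 0 → ‖w‖ ≠ 1 := by
    intro w hw h1
    have h2 : w * (starRingEnd ℂ) w = 1 := by rw [Complex.mul_conj']; simp [h1]
    have h3 : z = -(w + (starRingEnd ℂ) w) := by
      linear_combination (starRingEnd ℂ) w * hw - (w + z) * h2
    have h4 : z.im = 0 := by rw [h3]; simp
    exact hz.ne' h4
  have e1 : ((-z + s) / 2) ^ 2 + z * ((-z + s) / 2) + 1 = 0 := by linear_combination hs / 4
  have e2 : ((-z - s) / 2) ^ 2 + z * ((-z - s) / 2) + 1 = 0 := by linear_combination hs / 4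
  have hprod : ‖(-z + s) / 2‖ * ‖(-z - s) / 2‖ = 1 := by
    rw [← norm_mul, show (-z + s) / 2 * ((-z - s) / 2) = 1 by linear_combination -hs / 4]
    simp
  rcases lt_or_gt_of_ne (key _ e1) with h | h
  · exact ⟨_, e1, h⟩
  · refine ⟨_, e2, ?_⟩
    nlinarith [norm_nonneg ((-z - s) / 2)]

/-- Mean value property over `[-π, π]`. -/
theorem integral_exp_of_diffContOnCl {A : ℂ → ℂ} (hA : DiffContOnCl ℂ A (Metric.ball 0 1)) :
    ∫ θ in (-Real.pi)..Real.pi, A (Complex.exp (θ * Complex.I)) = 2 * Real.pi * A 0 := by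
  have h : DiffContOnCl ℂ A (Metric.ball 0 |(1:ℝ)|) := by simpa using hA
  have h1 := h.circleAverage
  simp only [Real.circleAverage, circleMap, Complex.ofReal_one, one_mul, zero_add] at h1
  have hper : Function.Periodic (fun θ : ℝ => A (Complex.exp (θ * Complex.I)))
      (2 * Real.pi) := by
    intro θ
    simp only
    congr 1
    push_cast
    rw [add_mul, Complex.exp_add, Complex.exp_two_pi_mul_I, mul_one]
  have h2 := hper.intervalIntegral_add_eq (-Real.pi) 0
  rw [show -Real.pi + 2 * Real.pi = Real.pi by ring, zero_add] at h2
  rw [h2, ← h1]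
  rw [Complex.real_smul]
  push_cast
  rw [← mul_assoc, mul_inv_cancel₀ (by simp), one_mul]

theorem one_add_mul_ne_zero {w x : ℂ} (hw : ‖w‖ < 1) (hx : ‖x‖ ≤ 1) : 1 + w * x ≠ 0 := by
  intro h
  have : ‖w * x‖ = 1 := by
    rw [show w * x = -1 by linear_combination h]; simp
  rw [norm_mul] at this
  nlinarith [norm_nonneg w, norm_nonneg x]

/-- Partial fractions split the integrand into `A(e^{iθ}) + A(e^{-iθ})`, up to the factor `(1 -
w²)⁻¹`, with `A` holomorphic on the closed disc. Unfolding to `[-π, π]`, the mean value property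
leaves `2π A(0)`, where `A(0) = (1 - w²)/4`. -/
theorem integral_sin_sq_div {w : ℂ} (hw : ‖w‖ < 1) :
    ∫ θ in (0 : ℝ)..Real.pi, (Complex.sin θ) ^ 2 /
      ((1 + w * Complex.exp (θ * Complex.I)) * (1 + w * Complex.exp (-(θ * Complex.I))))
      = (Real.pi : ℂ) / 2 := by
  set A : ℂ → ℂ := fun x => 1 / 4 * ((2 - x ^ 2 - w ^ 2) * (1 + w * x)⁻¹ + w * x - 1) with hA
  have hd : DiffContOnCl ℂ A (Metric.ball 0 1) := by
    apply DifferentiableOn.diffContOnCl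
    rw [closure_ball _ one_ne_zero]
    intro x hx
    apply DifferentiableAt.differentiableWithinAt
    have := one_add_mul_ne_zero hw (by simpa using hx : ‖x‖ ≤ 1)
    fun_prop (disch := assumption)
  have hw2 : 1 - w ^ 2 ≠ 0 := by
    intro h
    have : ‖w ^ 2‖ = 1 := by rw [show w ^ 2 = 1 by linear_combination -h]; simp
    rw [norm_pow] at this
    nlinarith [norm_nonneg w]
  have hmean := integral_exp_of_diffContOnCl hd
  have hnorm : ∀ θ : ℝ, ‖Complex.exp (θ * Complex.I)‖ ≤ 1 := fun θ => by
    rw [Complex.norm_exp_ofReal_mul_I]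
  have hcont : Continuous fun θ : ℝ => A (Complex.exp (θ * Complex.I)) := by
    have : ∀ θ : ℝ, 1 + w * Complex.exp (θ * Complex.I) ≠ 0 :=
      fun θ => one_add_mul_ne_zero hw (hnorm θ)
    simp only [hA]
    fun_prop (disch := assumption)
  have hpt : ∀ θ : ℝ, (Complex.sin θ) ^ 2 /
      ((1 + w * Complex.exp (θ * Complex.I)) * (1 + w * Complex.exp (-(θ * Complex.I))))
      = (1 - w ^ 2)⁻¹ * (A (Complex.exp (θ * Complex.I)) +
        A (Complex.exp (((-θ : ℝ) : ℂ) * Complex.I))) := by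
    intro θ
    have n1 := one_add_mul_ne_zero hw (hnorm θ)
    have n2 := one_add_mul_ne_zero hw (hnorm (-θ))
    have e0 : ((-θ : ℝ) : ℂ) * Complex.I = -(θ * Complex.I) := by push_cast; ring
    rw [e0] at n2 ⊢
    have hmul : Complex.exp (θ * Complex.I) * Complex.exp (-(θ * Complex.I)) = 1 := by
      rw [← Complex.exp_add]; simp
    rw [Complex.sin, neg_mul]
    simp only [hA]
    generalize Complex.exp (θ * Complex.I) = a at *
    generalize Complex.exp (-(θ * Complex.I)) = b at *
    have ea : (1 + w * a)⁻¹ * (1 + w * a) = 1 := inv_mul_cancel₀ n1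
    have eb : (1 + w * b)⁻¹ * (1 + w * b) = 1 := inv_mul_cancel₀ n2
    have ew : (1 - w ^ 2)⁻¹ * (1 - w ^ 2) = 1 := inv_mul_cancel₀ hw2
    rw [div_eq_iff (mul_ne_zero n1 n2)]
    generalize (1 + w * a)⁻¹ = p at *
    generalize (1 + w * b)⁻¹ = q at *
    generalize (1 - w ^ 2)⁻¹ = r at *
    have hI : Complex.I ^ 2 = -1 := Complex.I_sq
    have e3 : (2 - a ^ 2 - w ^ 2 + (w * a - 1) * (1 + w * a)) * (1 + w * b) +
        (2 - b ^ 2 - w ^ 2 + (w * b - 1) * (1 + w * b)) * (1 + w * a)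
        = (1 - w ^ 2) * (2 - a ^ 2 - b ^ 2) := by
      linear_combination (w ^ 3 * a + w ^ 3 * b + 2 * w ^ 2 - w * a - w * b - 2 * w ^ 2) * hmul
    have e4 : ((b - a) * Complex.I / 2) ^ 2 = (2 - a ^ 2 - b ^ 2) / 4 := by
      linear_combination (b - a) ^ 2 / 4 * hI + hmul / 2
    rw [e4]
    linear_combination (-r / 4) * (2 - a ^ 2 - w ^ 2) * (1 + w * b) * ea +
      (-r / 4) * (2 - b ^ 2 - w ^ 2) * (1 + w * a) * eb - r / 4 * e3 -
      (2 - a ^ 2 - b ^ 2) / 4 * ew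
  have hcont' : Continuous fun θ : ℝ => A (Complex.exp (((-θ : ℝ) : ℂ) * Complex.I)) :=
    hcont.comp continuous_neg
  rw [intervalIntegral.integral_congr (fun θ _ => hpt θ), intervalIntegral.integral_const_mul,
    intervalIntegral.integral_add (hcont.intervalIntegrable _ _)
      (hcont'.intervalIntegrable _ _),
    intervalIntegral.integral_comp_neg (fun θ : ℝ => A (Complex.exp (θ * Complex.I))),
    neg_zero, add_comm, intervalIntegral.integral_add_adjacent_intervals
      (hcont.intervalIntegrable _ _) (hcont.intervalIntegrable _ _), hmean]
  simp only [hA]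
  field_simp
  ring

/-- Substitute `x = 2 cos θ`. Since `z = -(w + w⁻¹)`, the denominator `x - z` factors as `w⁻¹ (1 + w
e^{iθ}) (1 + w e^{-iθ})`. -/
theorem mSC_eq_root {z w : ℂ} (hz : 0 < z.im) (hw : w ^ 2 + z * w + 1 = 0) (hw1 : ‖w‖ < 1) :
    mSC z = w := by
  have hw0 : w ≠ 0 := by rintro rfl; simp at hw
  have hzw : z = -(w + w⁻¹) := by field_simp; linear_combination hw
  have hne : ∀ x : ℝ, (x : ℂ) - z ≠ 0 := by
    intro x h
    have : ((x : ℂ) - z).im = 0 := by rw [h]; simp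
    simp at this
    exact hz.ne' this
  set g : ℝ → ℂ := fun x => ((Real.sqrt (4 - x ^ 2) : ℝ) : ℂ) / ((x : ℂ) - z) with hg
  have hgc : Continuous g := by
    simp only [hg]
    fun_prop (disch := exact hne _)
  have hsub := intervalIntegral.integral_deriv_smul_comp (a := Real.pi) (b := 0) (g := g)
    (f := fun θ => 2 * Real.cos θ) (f' := fun θ => 2 * -Real.sin θ)
    (fun θ _ => (Real.hasDerivAt_cos θ).const_mul 2) (by fun_prop) hgc
  simp only [Real.cos_pi, Real.cos_zero, mul_neg, mul_one, Function.comp] at hsub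
  rw [mSC, ← hsub]
  have hcongr : ∀ θ ∈ Set.uIcc Real.pi 0, -(2 * Real.sin θ) • g (2 * Real.cos θ) =
      (-(4 * w)) * ((Complex.sin θ) ^ 2 /
      ((1 + w * Complex.exp (θ * Complex.I)) * (1 + w * Complex.exp (-(θ * Complex.I))))) := by
    intro θ hθ
    rw [Set.uIcc_of_ge Real.pi_pos.le] at hθ
    have hs : 0 ≤ Real.sin θ := Real.sin_nonneg_of_mem_Icc hθ
    have hsq : Real.sqrt (4 - (2 * Real.cos θ) ^ 2) = 2 * Real.sin θ := by
      rw [show 4 - (2 * Real.cos θ) ^ 2 = (2 * Real.sin θ) ^ 2 by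
        nlinarith [Real.sin_sq_add_cos_sq θ]]
      exact Real.sqrt_sq (by positivity)
    have hmul : Complex.exp (θ * Complex.I) * Complex.exp (-(θ * Complex.I)) = 1 := by
      rw [← Complex.exp_add]; simp
    have hden : (1 + w * Complex.exp (θ * Complex.I)) * (1 + w * Complex.exp (-(θ * Complex.I)))
        = w * (((2 * Real.cos θ : ℝ) : ℂ) - z) := by
      rw [hzw]
      push_cast
      rw [Complex.cos, neg_mul]
      generalize Complex.exp (θ * Complex.I) = a at *
      generalize Complex.exp (-(θ * Complex.I)) = b at *
      field_simp
      linear_combination w ^ 2 * hmul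
    rw [hden]
    simp only [hg]
    rw [hsq, Complex.real_smul]
    have := hne (2 * Real.cos θ)
    push_cast at this ⊢
    field_simp
    ring
  rw [intervalIntegral.integral_congr hcongr, intervalIntegral.integral_const_mul,
    intervalIntegral.integral_symm, integral_sin_sq_div hw1]
  have : (Real.pi : ℂ) ≠ 0 := by exact_mod_cast Real.pi_ne_zero
  field_simp
  norm_num

theorem mSC_eq {z : ℂ} (hz : 0 < z.im) : mSC z ^ 2 + z * mSC z + 1 = 0 := by
  obtain ⟨w, hw, hw1⟩ := exists_root_norm_lt_one hz
  rw [mSC_eq_root hz hw hw1, hw]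

theorem norm_mSC_lt_one {z : ℂ} (hz : 0 < z.im) : ‖mSC z‖ < 1 := by
  obtain ⟨w, hw, hw1⟩ := exists_root_norm_lt_one hz
  rwa [mSC_eq_root hz hw hw1]

theorem mSC_ne_zero {z : ℂ} (hz : 0 < z.im) : mSC z ≠ 0 := by
  intro h
  simpa [h] using mSC_eq hz

theorem norm_le_of_re_im {z : ℂ} (hre : |z.re| ≤ 10) (hz : 0 < z.im) (him : z.im ≤ 10) :
    ‖z‖ ≤ 20 :=
  (Complex.norm_le_abs_re_add_abs_im z).trans (by rw [abs_of_pos hz]; linarith)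

/-- The quadratic equation reads `m (m + z) = -1`, and `|m + z| ≤ 1 + 20`. This lower bound keeps
`1/m`, and hence `1/G_kk` when `Λ` is small, bounded on the spectral domain. -/
theorem le_norm_mSC {z : ℂ} (hre : |z.re| ≤ 10) (hz : 0 < z.im) (him : z.im ≤ 10) :
    1 / 21 ≤ ‖mSC z‖ := by
  have h1 : ‖mSC z‖ * ‖mSC z + z‖ = 1 := by
    rw [← norm_mul, show mSC z * (mSC z + z) = -1 by linear_combination mSC_eq hz]
    simp
  have h2 : ‖mSC z + z‖ ≤ 21 := (norm_add_le _ _).trans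
    (by linarith [norm_mSC_lt_one hz, norm_le_of_re_im hre hz him])
  nlinarith [norm_nonneg (mSC z)]

/-! ### Resolvents of Hermitian matrices and of their minors -/

section Resolvent

variable {N : ℕ} {A : Matrix (Fin N) (Fin N) ℂ} {z : ℂ}

/-- `Im ⟨v, (A - z) v⟩ = - Im z ‖v‖²` for Hermitian `A`. -/
theorem im_star_dotProduct_sub_smul (hA : A.IsHermitian) (v : Fin N → ℂ) :
    (star v ⬝ᵥ ((A - z • (1 : Matrix (Fin N) (Fin N) ℂ)).mulVec v)).im
      = -(z.im * ∑ i, ‖v i‖ ^ 2) := by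
  have h1 : (star v ⬝ᵥ A.mulVec v).im = 0 := by
    have := hA.im_star_dotProduct_mulVec_self v
    simpa using this
  rw [Matrix.sub_mulVec, dotProduct_sub, Complex.sub_im, h1, Matrix.smul_mulVec,
    Matrix.one_mulVec, dotProduct_smul]
  have h2 : star v ⬝ᵥ v = ((∑ i, ‖v i‖ ^ 2 : ℝ) : ℂ) := by
    simp [dotProduct, Complex.conj_mul']
  rw [h2, smul_eq_mul, Complex.mul_im, Complex.ofReal_re, Complex.ofReal_im]
  ring

theorem isUnit_det_sub_smul (hA : A.IsHermitian) (hz : 0 < z.im) :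
    IsUnit (A - z • (1 : Matrix (Fin N) (Fin N) ℂ)).det := by
  rw [isUnit_iff_ne_zero]
  intro hdet
  obtain ⟨v, hv, hv0⟩ := Matrix.exists_mulVec_eq_zero_iff.mpr hdet
  have h := im_star_dotProduct_sub_smul (z := z) hA v
  rw [hv0, dotProduct_zero] at h
  have hs : ∑ i, ‖v i‖ ^ 2 = 0 := by
    simp at h
    rcases h with h | h
    · exact absurd h hz.ne'
    · exact h
  apply hv
  funext i
  have := (Finset.sum_eq_zero_iff_of_nonneg (fun i _ => by positivity)).mp hs i (Finset.mem_univ i)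
  simpa using this

theorem sub_mul_green (hA : A.IsHermitian) (hz : 0 < z.im) :
    (A - z • (1 : Matrix (Fin N) (Fin N) ℂ)) * green A z = 1 :=
  Matrix.mul_nonsing_inv _ (isUnit_det_sub_smul hA hz)

theorem green_mul_sub (hA : A.IsHermitian) (hz : 0 < z.im) :
    green A z * (A - z • (1 : Matrix (Fin N) (Fin N) ℂ)) = 1 :=
  Matrix.nonsing_inv_mul _ (isUnit_det_sub_smul hA hz)

/-- Ward identity. -/
theorem im_green_diag (hA : A.IsHermitian) (hz : 0 < z.im) (j : Fin N) :
    (green A z j j).im = z.im * ∑ i, ‖green A z i j‖ ^ 2 := by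
  have h := im_star_dotProduct_sub_smul (z := z) hA ((green A z).col j)
  have h2 : (A - z • (1 : Matrix (Fin N) (Fin N) ℂ)).mulVec ((green A z).col j)
      = Pi.single j 1 := by
    have := congrArg (fun B => Matrix.col B j) (sub_mul_green hA hz)
    funext i
    have := congrFun this i
    simp only [Matrix.col, Matrix.transpose_apply, Matrix.mul_apply] at this
    simp only [Matrix.mulVec, dotProduct, Matrix.col, Matrix.transpose_apply]
    rw [this, Matrix.one_apply, Pi.single_apply]
  rw [h2, dotProduct_single] at h
  simp [Matrix.col] at h
  linarith

/-- The Ward identity gives `η |G_ij|² ≤ |G_jj|`. The case `i = j` bounds the diagonal by `η⁻¹`, and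
this bound then yields the other entries. -/
theorem norm_green_le (hA : A.IsHermitian) (hz : 0 < z.im) (i j : Fin N) :
    ‖green A z i j‖ ≤ z.im⁻¹ := by
  have key : ∀ i, z.im * ‖green A z i j‖ ^ 2 ≤ ‖green A z j j‖ := by
    intro i
    have h1 := im_green_diag hA hz j
    have h2 : ‖green A z i j‖ ^ 2 ≤ ∑ i, ‖green A z i j‖ ^ 2 :=
      Finset.single_le_sum (f := fun i => ‖green A z i j‖ ^ 2) (fun _ _ => by positivity)
        (Finset.mem_univ i)
    have h3 := (le_abs_self _).trans (Complex.abs_im_le_norm (green A z j j))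
    nlinarith
  have hd : ‖green A z j j‖ ≤ z.im⁻¹ := by
    rw [← one_div, le_div_iff₀ hz]
    by_contra hlt
    have := key j
    have h0 : 0 < ‖green A z j j‖ := by
      by_contra h0
      have : ‖green A z j j‖ = 0 := le_antisymm (not_lt.mp h0) (norm_nonneg _)
      rw [this] at hlt; simp at hlt
    nlinarith
  have h1 := (key i).trans hd
  have h2 : ‖green A z i j‖ ^ 2 ≤ z.im⁻¹ ^ 2 := by
    have h3 : z.im⁻¹ * z.im = 1 := inv_mul_cancel₀ hz.ne'
    have h4 := mul_le_mul_of_nonneg_left h1 (inv_pos.mpr hz).le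
    rw [← mul_assoc, h3, one_mul] at h4
    rwa [sq z.im⁻¹]
  exact (pow_le_pow_iff_left₀ (norm_nonneg _) (inv_pos.mpr hz).le two_ne_zero).mp h2

/-- By the Ward identity a vanishing diagonal entry forces its whole column to vanish, contradicting
invertibility. -/
theorem green_diag_ne_zero (hA : A.IsHermitian) (hz : 0 < z.im) (k : Fin N) :
    green A z k k ≠ 0 := by
  intro h0
  have h := im_green_diag hA hz k
  rw [h0] at h
  have hs : ∑ i, ‖green A z i k‖ ^ 2 = 0 := by
    simp at h
    rcases h with h | h
    · exact absurd h hz.ne'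
    · exact h
  have hcol : ∀ i, green A z i k = 0 := fun i => by
    simpa using (Finset.sum_eq_zero_iff_of_nonneg (fun i _ => by positivity)).mp hs i
      (Finset.mem_univ i)
  have := congrFun (congrFun (sub_mul_green hA hz) k) k
  simp [Matrix.mul_apply, hcol] at this

theorem minor_isHermitian (hA : A.IsHermitian) (k : Fin N) : (minor A k).IsHermitian := by
  ext i j
  simp only [minor, Matrix.conjTranspose_apply, Matrix.of_apply]
  by_cases hi : i = k <;> by_cases hj : j = k <;> simp [hi, hj]
  have := congrFun (congrFun hA i) j
  simpa using this

/-- The resolvent of the minor, expressed through the full resolvent. -/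
theorem green_minor (hA : A.IsHermitian) (hz : 0 < z.im) {i j k : Fin N} (hi : i ≠ k)
    (hj : j ≠ k) :
    green (minor A k) z i j = green A z i j - green A z i k * green A z k j / green A z k k := by
  -- The candidate for the whole inverse. The formula vanishes by itself when exactly one index is
  -- `k`, and the zeroed row and column contribute the block `-z⁻¹`.
  set B : Matrix (Fin N) (Fin N) ℂ := Matrix.of fun a b =>
    if a = k ∧ b = k then -z⁻¹ else
      green A z a b - green A z a k * green A z k b / green A z k k with hB
  have hkk := green_diag_ne_zero hA hz k
  have hz0 : z ≠ 0 := by rintro rfl; simp at hz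
  suffices h : (minor A k - z • (1 : Matrix (Fin N) (Fin N) ℂ)) * B = 1 by
    have : green (minor A k) z = B := by
      rw [green]; exact Matrix.inv_eq_right_inv h
    rw [this, hB]
    simp [hi]
  ext a b
  have hG : ∀ a b, ∑ c, (A - z • (1 : Matrix (Fin N) (Fin N) ℂ)) a c * green A z c b
      = (1 : Matrix (Fin N) (Fin N) ℂ) a b := fun a b => by
    rw [← Matrix.mul_apply, sub_mul_green hA hz]
  rw [Matrix.mul_apply]
  by_cases ha : a = k
  · subst ha
    rw [Finset.sum_eq_single a]
    · by_cases hb : b = a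
      · subst hb; simp [hB, minor, hz0]
      · simp [hB, minor, hb, Matrix.one_apply_ne (Ne.symm hb), hkk]
    · intro c _ hc
      simp [minor, Matrix.one_apply_ne (Ne.symm hc)]
    · simp
  · have hterm : ∀ c, (minor A k - z • (1 : Matrix (Fin N) (Fin N) ℂ)) a c * B c b =
        (A - z • (1 : Matrix (Fin N) (Fin N) ℂ)) a c * green A z c b -
        (A - z • (1 : Matrix (Fin N) (Fin N) ℂ)) a c * green A z c k *
          (green A z k b / green A z k k) := by
      intro c
      by_cases hc : c = k
      · subst hc
        simp [minor, Matrix.one_apply_ne ha]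
        field_simp
        simp
      · simp [minor, hB, hc, ha]
        ring
    rw [Finset.sum_congr rfl fun c _ => hterm c, Finset.sum_sub_distrib, ← Finset.sum_mul, hG, hG,
      Matrix.one_apply_ne ha]
    simp

/-- Schur's formula. -/
theorem one_div_green_diag (hA : A.IsHermitian) (hz : 0 < z.im) (k : Fin N) :
    1 / green A z k k = A k k - z -
      ∑ a ∈ Finset.univ.erase k, ∑ b ∈ Finset.univ.erase k,
        A k a * green (minor A k) z a b * A b k := by
  have hkk := green_diag_ne_zero hA hz k
  have hR : ∀ a b, ∑ c ∈ Finset.univ.erase b, green A z a c * A c b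
      = (1 : Matrix (Fin N) (Fin N) ℂ) a b - green A z a b * (A b b - z) := fun a b => by
    have h := congrFun (congrFun (green_mul_sub hA hz) a) b
    rw [Matrix.mul_apply, ← Finset.add_sum_erase _ _ (Finset.mem_univ b)] at h
    rw [← h]
    simp only [Matrix.sub_apply, Matrix.smul_apply, Matrix.one_apply_eq, smul_eq_mul, mul_one]
    rw [add_sub_cancel_left]
    refine Finset.sum_congr rfl fun c hc => ?_
    rw [Matrix.one_apply_ne (Finset.ne_of_mem_erase hc)]
    simp
  have hL : ∑ c ∈ Finset.univ.erase k, A k c * green A z c k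
      = 1 - (A k k - z) * green A z k k := by
    have h := congrFun (congrFun (sub_mul_green hA hz) k) k
    rw [Matrix.mul_apply, ← Finset.add_sum_erase _ _ (Finset.mem_univ k),
      Matrix.one_apply_eq] at h
    rw [← h]
    simp only [Matrix.sub_apply, Matrix.smul_apply, Matrix.one_apply_eq, smul_eq_mul, mul_one]
    rw [add_sub_cancel_left]
    refine Finset.sum_congr rfl fun c hc => ?_
    rw [Matrix.one_apply_ne (Finset.ne_of_mem_erase hc).symm]
    simp
  -- Insert the formula for the minor and sum over `b` by `G (A - z) = 1`. The two contributions of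
  -- `A k k - z` cancel.
  have hin : ∀ a ∈ Finset.univ.erase k, ∑ b ∈ Finset.univ.erase k,
      A k a * green (minor A k) z a b * A b k = A k a * (-(green A z a k / green A z k k)) := by
    intro a ha
    have hak := Finset.ne_of_mem_erase ha
    have : ∀ b ∈ Finset.univ.erase k, A k a * green (minor A k) z a b * A b k =
        A k a * (green A z a b * A b k - green A z a k / green A z k k *
          (green A z k b * A b k)) := by
      intro b hb
      rw [green_minor hA hz hak (Finset.ne_of_mem_erase hb)]
      ring
    rw [Finset.sum_congr rfl this, ← Finset.mul_sum, Finset.sum_sub_distrib, ← Finset.mul_sum,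
      hR, hR, Matrix.one_apply_ne hak, Matrix.one_apply_eq]
    congr 1
    field_simp
    ring
  rw [Finset.sum_congr rfl hin]
  have : ∑ x ∈ Finset.univ.erase k, A k x * -(green A z x k / green A z k k) =
      -(∑ x ∈ Finset.univ.erase k, A k x * green A z x k) / green A z k k := by
    rw [← Finset.sum_neg_distrib, Finset.sum_div]
    refine Finset.sum_congr rfl fun x _ => ?_
    ring
  rw [this, hL]
  field_simp
  ring

/-- The minor with the rows and columns in `C` replaced by zero. -/
def minorSet (A : Matrix (Fin N) (Fin N) ℂ) (C : Finset (Fin N)) : Matrix (Fin N) (Fin N) ℂ :=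
  Matrix.of fun i j => if i ∈ C ∨ j ∈ C then 0 else A i j

theorem minorSet_empty : minorSet A ∅ = A := by
  ext i j; simp [minorSet]

theorem minorSet_insert (C : Finset (Fin N)) (k : Fin N) :
    minorSet A (insert k C) = minor (minorSet A C) k := by
  ext i j
  simp only [minorSet, minor, Matrix.of_apply, Finset.mem_insert]
  split_ifs <;> tauto

/-- This exhibits `minorSet A C` as a function of `minor A k` for each `k ∈ C`, the source of all
measurability with respect to `H^{(k)}`. -/
theorem minorSet_minor {C : Finset (Fin N)} {k : Fin N} (hk : k ∈ C) :
    minorSet (minor A k) C = minorSet A C := by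
  ext i j
  simp only [minorSet, minor, Matrix.of_apply]
  split_ifs <;> first | rfl | (exfalso; aesop)

theorem minorSet_isHermitian (hA : A.IsHermitian) (C : Finset (Fin N)) :
    (minorSet A C).IsHermitian := by
  induction C using Finset.induction_on with
  | empty => rwa [minorSet_empty]
  | insert k C _ ih => rw [minorSet_insert]; exact minor_isHermitian ih k

theorem norm_minorSet_le (C : Finset (Fin N)) (i j : Fin N) : ‖minorSet A C i j‖ ≤ ‖A i j‖ := by
  simp only [minorSet, Matrix.of_apply]
  split_ifs <;> simp

theorem norm_green_le_lambda {ψ : ℝ} (h : lambda A z ≤ ψ) {i j : Fin N} (hij : i ≠ j) :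
    ‖green A z i j‖ ≤ ψ :=
  (le_ciSup (f := fun p : {p : Fin N × Fin N // p.1 ≠ p.2} => ‖green A z p.1.1 p.1.2‖)
    (Set.finite_range _).bddAbove ⟨(i, j), hij⟩).trans ((le_max_left _ _).trans h)

theorem norm_green_sub_le_lambda {ψ : ℝ} (h : lambda A z ≤ ψ) (i : Fin N) :
    ‖green A z i i - mSC z‖ ≤ ψ :=
  (le_ciSup (f := fun i : Fin N => ‖green A z i i - mSC z‖)
    (Set.finite_range _).bddAbove i).trans ((le_max_right _ _).trans h)

end Resolvent

/-! ### Finite differences of set functions under removal of indices -/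

section FiniteDifference

variable {α : Type*} [DecidableEq α]

/-- The iterated finite difference of a set function in the directions `B`, based at `C`. -/
def setDiff (B : Finset α) (F : Finset α → ℂ) (C : Finset α) : ℂ :=
  ∑ D ∈ B.powerset, (-1) ^ D.card * F (C ∪ D)

/-- The finite difference in one direction. -/
def delta (a : α) (F : Finset α → ℂ) (C : Finset α) : ℂ := F C - F (insert a C)

theorem setDiff_empty (F : Finset α → ℂ) (C : Finset α) : setDiff ∅ F C = F C := by
  simp [setDiff]

theorem setDiff_insert {a : α} {B : Finset α} (ha : a ∉ B) (F : Finset α → ℂ) (C : Finset α) :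
    setDiff (insert a B) F C = setDiff B F C - setDiff B F (insert a C) := by
  rw [setDiff, Finset.sum_powerset_insert ha, setDiff, setDiff, sub_eq_add_neg,
    ← Finset.sum_neg_distrib]
  congr 1
  refine Finset.sum_congr rfl fun D hD => ?_
  have : a ∉ D := fun h => ha (Finset.mem_powerset.mp hD h)
  rw [Finset.card_insert_of_notMem this, Finset.union_insert, Finset.insert_union, pow_succ]
  ring

/-- Iterated differences can be taken one direction at a time; inductions on the number of
directions peel off `a` in this way. -/
theorem setDiff_insert_eq_delta {a : α} {B : Finset α} (ha : a ∉ B) (F : Finset α → ℂ)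
    (C : Finset α) : setDiff (insert a B) F C = setDiff B (delta a F) C := by
  rw [setDiff_insert ha, setDiff, setDiff, setDiff, ← Finset.sum_sub_distrib]
  refine Finset.sum_congr rfl fun D _ => ?_
  rw [delta, Finset.insert_union]
  ring

theorem setDiff_congr {B C S : Finset α} {F G : Finset α → ℂ} (hB : B ⊆ S) (hC : C ⊆ S)
    (h : ∀ D ⊆ S, F D = G D) : setDiff B F C = setDiff B G C :=
  Finset.sum_congr rfl fun D hD => by
    rw [h _ (Finset.union_subset hC ((Finset.mem_powerset.mp hD).trans hB))]

theorem setDiff_shift (a : α) (B : Finset α) (F : Finset α → ℂ) (C : Finset α) :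
    setDiff B (fun D => F (insert a D)) C = setDiff B F (insert a C) :=
  Finset.sum_congr rfl fun D _ => by rw [Finset.insert_union]

theorem norm_setDiff_le {B C : Finset α} {F : Finset α → ℂ} {R : ℝ}
    (h : ∀ D ⊆ B, ‖F (C ∪ D)‖ ≤ R) : ‖setDiff B F C‖ ≤ 2 ^ B.card * R := by
  refine (norm_sum_le _ _).trans ?_
  have : ∀ D ∈ B.powerset, ‖(-1) ^ D.card * F (C ∪ D)‖ ≤ R := fun D hD => by
    rw [norm_mul, norm_pow, norm_neg, norm_one, one_pow, one_mul]
    exact h D (Finset.mem_powerset.mp hD)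
  refine (Finset.sum_le_card_nsmul _ _ _ this).trans ?_
  rw [Finset.card_powerset, nsmul_eq_mul]
  push_cast
  rfl

/-- A set function is the sum of its finite differences in the directions `A ⊆ L`, each taken at
the complement of `A` in `L`. -/
theorem eq_sum_setDiff (L : Finset α) (F : Finset α → ℂ) (C : Finset α) :
    F C = ∑ A ∈ L.powerset, setDiff A F (C ∪ (L \ A)) := by
  induction L using Finset.induction_on generalizing F C with
  | empty => simp [setDiff_empty]
  -- A subset `A` of `L` yields two terms, for `A` and for `insert a A`. The former is taken with
  -- `a` removed, the latter is a difference in `a`, and their sum telescopes to the term of `A`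
  -- with `a` present.
  | insert a L ha ih =>
    rw [Finset.sum_powerset_insert ha, ← Finset.sum_add_distrib, ih F C]
    refine Finset.sum_congr rfl fun A hA => ?_
    have hAL := Finset.mem_powerset.mp hA
    have haA : a ∉ A := fun h => ha (hAL h)
    have hsd : insert a L \ insert a A = L \ A := by
      rw [Finset.insert_sdiff_of_mem _ (Finset.mem_insert_self _ _), Finset.sdiff_insert,
        Finset.erase_eq_of_notMem fun h => ha (Finset.mem_sdiff.mp h).1]
    rw [setDiff_insert haA, Finset.insert_sdiff_of_notMem _ haA, hsd, Finset.union_insert]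
    ring

/-- The finite differences of `F` in at most `b` directions within `S` are small: each direction
gains a factor `ψ`. -/
def DiffBound (ψ K : ℝ) (S : Finset α) (b n : ℕ) (F : Finset α → ℂ) : Prop :=
  ∀ B C : Finset α, B ⊆ S → C ⊆ S → Disjoint B C → B.card ≤ b →
    ‖setDiff B F C‖ ≤ K * ψ ^ (n + B.card)

namespace DiffBound

variable {ψ K K' : ℝ} {S : Finset α} {b n n' : ℕ} {F G : Finset α → ℂ}

theorem congr (hF : DiffBound ψ K S b n F) (h : ∀ D ⊆ S, F D = G D) : DiffBound ψ K S b n G :=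
  fun B C hB hC hd hb => by
    rw [← setDiff_congr hB hC h]; exact hF B C hB hC hd hb

theorem mono_const (hF : DiffBound ψ K S b n F) (hψ : 0 ≤ ψ) (h : K ≤ K') :
    DiffBound ψ K' S b n F :=
  fun B C hB hC hd hb => (hF B C hB hC hd hb).trans (by gcongr)

theorem mono_order (hF : DiffBound ψ K S b n F) (hK : 0 ≤ K) (hψ : 0 ≤ ψ) (hψ1 : ψ ≤ 1)
    (h : n' ≤ n) : DiffBound ψ K S b n' F :=
  fun B C hB hC hd hb => (hF B C hB hC hd hb).trans
    (mul_le_mul_of_nonneg_left (pow_le_pow_of_le_one hψ hψ1 (by omega)) hK)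

theorem mono_depth {b' : ℕ} (hF : DiffBound ψ K S b n F) (h : b' ≤ b) :
    DiffBound ψ K S b' n F :=
  fun B C hB hC hd hb => hF B C hB hC hd (hb.trans h)

theorem norm_le (hF : DiffBound ψ K S b n F) {C : Finset α} (hC : C ⊆ S) :
    ‖F C‖ ≤ K * ψ ^ n := by
  simpa [setDiff_empty] using hF ∅ C (by simp) hC (by simp) (by simp)

theorem shift (hF : DiffBound ψ K S b n F) {a : α} (ha : a ∈ S) :
    DiffBound ψ K (S.erase a) b n (fun D => F (insert a D)) := by
  intro B C hB hC hd hb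
  rw [setDiff_shift]
  have haB : a ∉ B := fun h => (Finset.mem_erase.mp (hB h)).1 rfl
  exact hF B _ (hB.trans (Finset.erase_subset _ _))
    (Finset.insert_subset ha (hC.trans (Finset.erase_subset _ _)))
    (Finset.disjoint_insert_right.mpr ⟨haB, hd⟩) hb

theorem erase (hF : DiffBound ψ K S b n F) (a : α) : DiffBound ψ K (S.erase a) b n F :=
  fun B C hB hC hd hb => hF B C (hB.trans (Finset.erase_subset _ _))
    (hC.trans (Finset.erase_subset _ _)) hd hb

theorem delta (hF : DiffBound ψ K S (b + 1) n F) {a : α} (ha : a ∈ S) :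
    DiffBound ψ K (S.erase a) b (n + 1) (delta a F) := by
  intro B C hB hC hd hb
  have haB : a ∉ B := fun h => (Finset.mem_erase.mp (hB h)).1 rfl
  have haC : a ∉ C := fun h => (Finset.mem_erase.mp (hC h)).1 rfl
  rw [← setDiff_insert_eq_delta haB]
  have hcard := Finset.card_insert_of_notMem haB
  have := hF (insert a B) C (Finset.insert_subset ha (hB.trans (Finset.erase_subset _ _)))
    (hC.trans (Finset.erase_subset _ _)) (Finset.disjoint_insert_left.mpr ⟨haC, hd⟩)
    (by omega)
  rwa [hcard, show n + (B.card + 1) = n + 1 + B.card by ring] at this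

theorem of_delta (h0 : ∀ C ⊆ S, ‖F C‖ ≤ K * ψ ^ n)
    (h : ∀ a ∈ S, DiffBound ψ K (S.erase a) b (n + 1) (FluctAvg.delta a F)) :
    DiffBound ψ K S (b + 1) n F := by
  intro B C hB hC hd hb
  rcases B.eq_empty_or_nonempty with rfl | ⟨a, haB⟩
  · simpa [setDiff_empty] using h0 C hC
  · have haC : a ∉ C := Finset.disjoint_left.mp hd haB
    have hcard : (B.erase a).card + 1 = B.card := Finset.card_erase_add_one haB
    have h1 := h a (hB haB) (B.erase a) C (Finset.erase_subset_erase _ hB)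
      (fun x hx => Finset.mem_erase.mpr ⟨fun hxa => haC (hxa ▸ hx), hC hx⟩)
      (hd.mono_left (Finset.erase_subset _ _)) (by omega)
    rw [← setDiff_insert_eq_delta (Finset.notMem_erase _ _), Finset.insert_erase haB] at h1
    rwa [show n + 1 + (B.erase a).card = n + B.card by omega] at h1

theorem of_norm_le (h0 : ∀ C ⊆ S, ‖F C‖ ≤ K * ψ ^ n) : DiffBound ψ K S 0 n F := by
  intro B C hB hC hd hb
  obtain rfl : B = ∅ := Finset.card_eq_zero.mp (Nat.le_zero.mp hb)
  simpa [setDiff_empty] using h0 C hC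

theorem add (hF : DiffBound ψ K S b n F) (hG : DiffBound ψ K' S b n G) :
    DiffBound ψ (K + K') S b n (fun C => F C + G C) := by
  intro B C hB hC hd hb
  have : setDiff B (fun C => F C + G C) C = setDiff B F C + setDiff B G C := by
    simp only [setDiff, mul_add, Finset.sum_add_distrib]
  rw [this, add_mul]
  exact (norm_add_le _ _).trans (add_le_add (hF B C hB hC hd hb) (hG B C hB hC hd hb))

theorem neg (hF : DiffBound ψ K S b n F) : DiffBound ψ K S b n (fun C => -F C) := by
  intro B C hB hC hd hb
  have : setDiff B (fun C => -F C) C = -setDiff B F C := by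
    simp only [setDiff, mul_neg, Finset.sum_neg_distrib]
  rw [this, norm_neg]
  exact hF B C hB hC hd hb

/-- The discrete Leibniz rule `δ_a(F G) = δ_a F · G(insert a ·) + F · δ_a G`. Its two terms double
the constant at each depth, whence `2 ^ b`. -/
theorem mul (hK : 0 ≤ K) (hψ : 0 ≤ ψ) (hF : DiffBound ψ K S b n F)
    (hG : DiffBound ψ K' S b n' G) :
    DiffBound ψ (2 ^ b * (K * K')) S b (n + n') (fun C => F C * G C) := by
  induction b generalizing S F G n n' with
  | zero =>
    refine of_norm_le fun C hC => ?_
    rw [norm_mul]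
    calc ‖F C‖ * ‖G C‖ ≤ (K * ψ ^ n) * (K' * ψ ^ n') :=
          mul_le_mul (hF.norm_le hC) (hG.norm_le hC) (norm_nonneg _) (by positivity)
      _ = _ := by ring
  | succ b ih =>
    refine of_delta (fun C hC => ?_) fun a ha => ?_
    · rw [norm_mul]
      have hK' : 0 ≤ K' * ψ ^ n' := (norm_nonneg _).trans (hG.norm_le hC)
      calc ‖F C‖ * ‖G C‖ ≤ (K * ψ ^ n) * (K' * ψ ^ n') :=
            mul_le_mul (hF.norm_le hC) (hG.norm_le hC) (norm_nonneg _) (by positivity)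
        _ ≤ 2 ^ (b + 1) * ((K * ψ ^ n) * (K' * ψ ^ n')) :=
            le_mul_of_one_le_left (by positivity) (one_le_pow₀ (by norm_num))
        _ = _ := by ring
    · have h1 := ih (hF.delta ha) ((hG.mono_depth (Nat.le_succ b)).shift ha)
      have h2 := ih ((hF.mono_depth (Nat.le_succ b)).erase a) (hG.delta ha)
      rw [show n + 1 + n' = n + n' + 1 by ring] at h1
      have h3 := h1.add h2
      rw [show 2 ^ b * (K * K') + 2 ^ b * (K * K') = 2 ^ (b + 1) * (K * K') by ring] at h3
      refine h3.congr fun D _ => ?_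
      simp only [FluctAvg.delta]
      ring

/-- Differences do not see constants, so centring matters only at depth zero. -/
theorem of_delta_const {c : ℂ}
    (h0 : ∀ C ⊆ S, ‖F C - c‖ ≤ K * ψ ^ n)
    (h : ∀ a ∈ S, DiffBound ψ K (S.erase a) b (n + 1) (FluctAvg.delta a F)) :
    DiffBound ψ K S (b + 1) n (fun C => F C - c) := by
  refine of_delta h0 fun a ha => (h a ha).congr fun D _ => ?_
  simp only [FluctAvg.delta]
  ring

end DiffBound

/-- A family of set functions `g i j C`, which behaves like the entries of the resolvents of the
minors of a matrix. -/
structure ResolventFamily (g : α → α → Finset α → ℂ) : Prop where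
  ne_zero : ∀ i C, g i i C ≠ 0
  removal : ∀ a i j C, a ≠ i → a ≠ j →
    g i j C - g i j (insert a C) = g i a C * g a j C * (g a a C)⁻¹

/-- The constants in `ResolventFamily.diffBound`. -/
def diffConst (K : ℝ) : ℕ → ℝ
  | 0 => K
  | b + 1 => diffConst K b + 2 ^ b * (2 ^ b * (2 ^ b * (2 ^ b *
      (diffConst K b * diffConst K b) * diffConst K b) * diffConst K b) * diffConst K b) + 2 ^ b *
      (2 ^ b * (diffConst K b * diffConst K b) * diffConst K b)

theorem le_diffConst {K : ℝ} (hK : 0 ≤ K) (b : ℕ) : K ≤ diffConst K b := by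
  induction b with
  | zero => exact le_rfl
  | succ b ih =>
    have : 0 ≤ diffConst K b := hK.trans ih
    rw [diffConst]
    refine ih.trans ?_
    rw [add_assoc]
    exact le_add_of_nonneg_right (by positivity)

theorem ResolventFamily.delta_inv {g : α → α → Finset α → ℂ} (hg : ResolventFamily g) {a i : α}
    (hai : a ≠ i) (C : Finset α) :
    delta a (fun C => (g i i C)⁻¹) C =
      -(g i a C * g a i C * (g a a C)⁻¹ * (g i i C)⁻¹ * (g i i (insert a C))⁻¹) := by
  rw [← hg.removal a i i C hai hai, delta]
  have := hg.ne_zero i C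
  have := hg.ne_zero i (insert a C)
  field_simp
  ring

/-- Induction on the depth. Peeling off `a ∈ S` leaves `S.erase a`, where `a` may serve as a matrix
index. The difference of an off-diagonal entry is then a product of two off-diagonal entries and an
inverse diagonal one, so its order rises from `1` to `2`, and the Leibniz rule applies to the
product. All subsets `S` of `S₀` are treated together because `S` shrinks. -/
theorem ResolventFamily.diffBound {g : α → α → Finset α → ℂ} (hg : ResolventFamily g)
    {ψ K : ℝ} (hψ : 0 ≤ ψ) (hψ1 : ψ ≤ 1) (hK : 0 ≤ K) (S₀ : Finset α)
    (hoff : ∀ i j, i ≠ j → ∀ C ⊆ S₀, i ∉ C → j ∉ C → ‖g i j C‖ ≤ K * ψ)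
    (hinv : ∀ i, ∀ C ⊆ S₀, i ∉ C → ‖(g i i C)⁻¹‖ ≤ K) (b : ℕ) :
    ∀ S ⊆ S₀, (∀ i j, i ≠ j → i ∉ S → j ∉ S → DiffBound ψ (diffConst K b) S b 1 (g i j)) ∧
      (∀ i, i ∉ S → DiffBound ψ (diffConst K b) S b 0 (fun C => (g i i C)⁻¹)) := by
  induction b with
  | zero =>
    intro S hS
    refine ⟨fun i j hij hi hj => DiffBound.of_norm_le fun C hC => ?_,
      fun i hi => DiffBound.of_norm_le fun C hC => ?_⟩
    · simpa [diffConst] using hoff i j hij C (hC.trans hS) (fun h => hi (hC h)) (fun h => hj (hC h))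
    · simpa [diffConst] using hinv i C (hC.trans hS) (fun h => hi (hC h))
  | succ b ih =>
    intro S hS
    have hKb := le_diffConst hK b
    have hKb0 : 0 ≤ diffConst K b := hK.trans hKb
    have hle1 : 2 ^ b * (2 ^ b * (diffConst K b * diffConst K b) * diffConst K b) ≤
        diffConst K (b + 1) := by
      rw [diffConst]
      exact le_add_of_nonneg_left (by positivity)
    have hle2 : 2 ^ b * (2 ^ b * (2 ^ b * (2 ^ b *
      (diffConst K b * diffConst K b) * diffConst K b) * diffConst K b) * diffConst K b) ≤
        diffConst K (b + 1) := by
      rw [diffConst, add_right_comm]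
      exact le_add_of_nonneg_left (by positivity)
    have hK1 : 0 ≤ diffConst K (b + 1) := hK.trans (le_diffConst hK (b + 1))
    refine ⟨fun i j hij hi hj => DiffBound.of_delta (fun C hC => ?_) fun a ha => ?_,
      fun i hi => DiffBound.of_delta (fun C hC => ?_) fun a ha => ?_⟩
    · rw [pow_one]
      exact (hoff i j hij C (hC.trans hS) (fun h => hi (hC h)) (fun h => hj (hC h))).trans
        (mul_le_mul_of_nonneg_right (le_diffConst hK _) hψ)
    · have hai : a ≠ i := fun h => hi (h ▸ ha)
      have haj : a ≠ j := fun h => hj (h ▸ ha)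
      obtain ⟨h1, h2⟩ := ih (S.erase a) ((Finset.erase_subset _ _).trans hS)
      have hia := h1 i a hai.symm (fun h => hi (Finset.mem_of_mem_erase h))
        (Finset.notMem_erase _ _)
      have haj' := h1 a j haj (Finset.notMem_erase _ _) (fun h => hj (Finset.mem_of_mem_erase h))
      have haa := h2 a (Finset.notMem_erase _ _)
      have := ((DiffBound.mul hKb0 hψ hia haj').mul (by positivity) hψ haa).mono_const hψ hle1
      exact this.congr fun D _ => (hg.removal a i j D hai haj).symm
    · rw [pow_zero, mul_one]
      exact (hinv i C (hC.trans hS) (fun h => hi (hC h))).trans (le_diffConst hK _)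
    · have hai : a ≠ i := fun h => hi (h ▸ ha)
      have hi' : i ∉ S.erase a := fun h => hi (Finset.mem_of_mem_erase h)
      obtain ⟨h1, h2⟩ := ih (S.erase a) ((Finset.erase_subset _ _).trans hS)
      have hia := h1 i a hai.symm hi' (Finset.notMem_erase _ _)
      have hai' := h1 a i hai (Finset.notMem_erase _ _) hi'
      have haa := h2 a (Finset.notMem_erase _ _)
      have hii := h2 i hi'
      have hii' := ((ih S hS).2 i hi).shift ha
      have := (((((DiffBound.mul hKb0 hψ hia hai').mul (by positivity) hψ haa).mul
        (by positivity) hψ hii).mul (by positivity) hψ hii').mono_const hψ hle2).neg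
      -- The product contains two off-diagonal factors and so has order `2`; only order `1` is
      -- needed.
      refine (this.mono_order hK1 hψ hψ1 (n' := 0 + 1) (by norm_num)).congr fun D _ => ?_
      exact (hg.delta_inv hai D).symm

/-- Diagonal entries and their inverses, centred at constants, gain one more factor `ψ`. -/
theorem ResolventFamily.diffBound_diag {g : α → α → Finset α → ℂ} (hg : ResolventFamily g)
    {ψ K : ℝ} (hψ : 0 ≤ ψ) (hψ1 : ψ ≤ 1) (hK : 0 ≤ K) (S : Finset α)
    (hoff : ∀ i j, i ≠ j → ∀ C ⊆ S, i ∉ C → j ∉ C → ‖g i j C‖ ≤ K * ψ)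
    (hinv : ∀ i, ∀ C ⊆ S, i ∉ C → ‖(g i i C)⁻¹‖ ≤ K) {m : ℂ} {k : α} (hk : k ∉ S)
    (hm : ∀ C ⊆ S, ‖g k k C - m‖ ≤ K * ψ) (hm' : ∀ C ⊆ S, ‖(g k k C)⁻¹ - m⁻¹‖ ≤ K * ψ) (b : ℕ) :
    DiffBound ψ (diffConst K (b + 1)) S (b + 1) 1 (fun C => g k k C - m) ∧
      DiffBound ψ (diffConst K (b + 1)) S (b + 1) 1 (fun C => (g k k C)⁻¹ - m⁻¹) := by
  have hKb := le_diffConst hK b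
  have hKb0 : 0 ≤ diffConst K b := hK.trans hKb
  have hle1 : 2 ^ b * (2 ^ b * (diffConst K b * diffConst K b) * diffConst K b) ≤
      diffConst K (b + 1) := by
    rw [diffConst]
    exact le_add_of_nonneg_left (by positivity)
  have hle2 : 2 ^ b * (2 ^ b * (2 ^ b * (2 ^ b *
    (diffConst K b * diffConst K b) * diffConst K b) * diffConst K b) * diffConst K b) ≤
      diffConst K (b + 1) := by
    rw [diffConst, add_right_comm]
    exact le_add_of_nonneg_left (by positivity)
  have hK1 : 0 ≤ diffConst K (b + 1) := hK.trans (le_diffConst hK (b + 1))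
  refine ⟨DiffBound.of_delta_const (fun C hC => ?_) fun a ha => ?_,
    DiffBound.of_delta_const (fun C hC => ?_) fun a ha => ?_⟩
  · rw [pow_one]
    exact (hm C hC).trans (mul_le_mul_of_nonneg_right (le_diffConst hK _) hψ)
  · have hak : a ≠ k := fun h => hk (h ▸ ha)
    have hk' : k ∉ S.erase a := fun h => hk (Finset.mem_of_mem_erase h)
    obtain ⟨h1, h2⟩ := hg.diffBound hψ hψ1 hK S hoff hinv b (S.erase a) (Finset.erase_subset _ _)
    have := (((h1 k a hak.symm hk' (Finset.notMem_erase _ _)).mul hKb0 hψ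
      (h1 a k hak (Finset.notMem_erase _ _) hk')).mul (by positivity) hψ
      (h2 a (Finset.notMem_erase _ _))).mono_const hψ hle1
    exact this.congr fun D _ => (hg.removal a k k D hak hak).symm
  · rw [pow_one]
    exact (hm' C hC).trans (mul_le_mul_of_nonneg_right (le_diffConst hK _) hψ)
  · have hak : a ≠ k := fun h => hk (h ▸ ha)
    have hk' : k ∉ S.erase a := fun h => hk (Finset.mem_of_mem_erase h)
    obtain ⟨h1, h2⟩ := hg.diffBound hψ hψ1 hK S hoff hinv b (S.erase a) (Finset.erase_subset _ _)
    have hS := hg.diffBound hψ hψ1 hK S hoff hinv b S subset_rfl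
    have := (((((h1 k a hak.symm hk' (Finset.notMem_erase _ _)).mul hKb0 hψ
      (h1 a k hak (Finset.notMem_erase _ _) hk')).mul (by positivity) hψ
      (h2 a (Finset.notMem_erase _ _))).mul (by positivity) hψ (h2 k hk')).mul
      (by positivity) hψ ((hS.2 k hk).shift ha)).mono_const hψ hle2 |>.neg
    exact this.congr fun D _ => (hg.delta_inv hak D).symm

end FiniteDifference

/-! ### Deterministic bounds on resolvents of minors -/

section Deterministic

variable {N : ℕ} {A : Matrix (Fin N) (Fin N) ℂ} {z : ℂ}

theorem resolventFamily_green (hA : A.IsHermitian) (hz : 0 < z.im) :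
    ResolventFamily fun i j C => green (minorSet A C) z i j where
  ne_zero i C := green_diag_ne_zero (minorSet_isHermitian hA C) hz i
  removal a i j C hai haj := by
    rw [minorSet_insert, green_minor (minorSet_isHermitian hA C) hz hai.symm haj.symm]
    ring

/-- Each removal at most doubles the error. If the current error `x` is at most `1/42`, then `|G_aa|
≥ 1/21 - 1/42 = 1/42`, so the correction `G_ia G_aj / G_aa` is at most `42 x² ≤ x`. The hypothesis
on `2 ^ p * ψ` keeps `x` in this range for `p` removals. -/
theorem norm_green_minorSet_sub_le (hA : A.IsHermitian) (hz : 0 < z.im)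
    (hm : 1 / 21 ≤ ‖mSC z‖) {ψ : ℝ} {p : ℕ} (hψ : 2 ^ p * ψ ≤ 1 / 42) (hψ0 : 0 ≤ ψ)
    (hΛ : lambda A z ≤ ψ) (C : Finset (Fin N)) (hC : C.card ≤ p) :
    (∀ i j, i ≠ j → i ∉ C → j ∉ C → ‖green (minorSet A C) z i j‖ ≤ 2 ^ C.card * ψ) ∧
      ∀ i, i ∉ C → ‖green (minorSet A C) z i i - mSC z‖ ≤ 2 ^ C.card * ψ := by
  induction C using Finset.induction_on with
  | empty =>
    simp only [minorSet_empty, Finset.card_empty, pow_zero, one_mul]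
    exact ⟨fun i j hij _ _ => norm_green_le_lambda hΛ hij,
      fun i _ => norm_green_sub_le_lambda hΛ i⟩
  | insert a C ha ih =>
    rw [Finset.card_insert_of_notMem ha] at hC ⊢
    obtain ⟨ih1, ih2⟩ := ih (by omega)
    set x := 2 ^ C.card * ψ with hx
    have hx0 : 0 ≤ x := by positivity
    have hx1 : x ≤ 1 / 42 := le_trans
      (mul_le_mul_of_nonneg_right (pow_le_pow_right₀ (by norm_num) (by omega)) hψ0) hψ
    have haa : 1 / 42 ≤ ‖green (minorSet A C) z a a‖ := by
      have h1 := ih2 a ha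
      have h2 := norm_sub_norm_le (mSC z) (mSC z - green (minorSet A C) z a a)
      rw [sub_sub_cancel, norm_sub_rev] at h2
      linarith
    have hprod : ∀ i j, i ∉ insert a C → j ∉ insert a C →
        ‖green (minorSet A C) z i a * green (minorSet A C) z a j /
          green (minorSet A C) z a a‖ ≤ x := by
      intro i j hi hj
      simp only [Finset.mem_insert, not_or] at hi hj
      rw [norm_div, norm_mul, div_le_iff₀ (by linarith)]
      have h1 := ih1 i a hi.1 hi.2 ha
      have h2 := ih1 a j (Ne.symm hj.1) ha hj.2
      calc _ ≤ x * x := mul_le_mul h1 h2 (norm_nonneg _) hx0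
        _ ≤ _ := mul_le_mul_of_nonneg_left (by linarith) hx0
    have hherm := minorSet_isHermitian hA C
    have h2x : 2 ^ (C.card + 1) * ψ = x + x := by rw [hx]; ring
    rw [h2x]
    refine ⟨fun i j hij hi hj => ?_, fun i hi => ?_⟩
    · have hp := hprod i j hi hj
      simp only [Finset.mem_insert, not_or] at hi hj
      rw [minorSet_insert, green_minor hherm hz hi.1 hj.1]
      exact (norm_sub_le _ _).trans (add_le_add (ih1 i j hij hi.2 hj.2) hp)
    · have hp := hprod i i hi hi
      simp only [Finset.mem_insert, not_or] at hi
      rw [minorSet_insert, green_minor hherm hz hi.1 hi.1, sub_right_comm]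
      exact (norm_sub_le _ _).trans (add_le_add (ih2 i hi.2) hp)

/-- If `Λ ≤ ψ`, then the finite differences of `G_kk - m` and `1/G_kk - 1/m` under removal of rows
and columns are small. -/
theorem diffBound_green (hA : A.IsHermitian) (hz : 0 < z.im)
    (hm : 1 / 21 ≤ ‖mSC z‖) {ψ : ℝ} {p : ℕ} (hψ : 2 ^ p * ψ ≤ 1 / 42) (hψ0 : 0 ≤ ψ)
    (hΛ : lambda A z ≤ ψ) {S : Finset (Fin N)} (hS : S.card ≤ p) {k : Fin N} (hk : k ∉ S) :
    DiffBound ψ (diffConst (882 * 2 ^ p) (p + 1)) S (p + 1) 1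
      (fun C => green (minorSet A C) z k k - mSC z) ∧
    DiffBound ψ (diffConst (882 * 2 ^ p) (p + 1)) S (p + 1) 1
      (fun C => (green (minorSet A C) z k k)⁻¹ - (mSC z)⁻¹) := by
  have h2p : (1 : ℝ) ≤ 2 ^ p := one_le_pow₀ (by norm_num)
  have hψ1 : ψ ≤ 1 := by nlinarith
  have hbase : ∀ C ⊆ S, _ := fun C hC =>
    norm_green_minorSet_sub_le hA hz hm hψ hψ0 hΛ C ((Finset.card_le_card hC).trans hS)
  have hpow : ∀ C ⊆ S, (2 : ℝ) ^ C.card * ψ ≤ 2 ^ p * ψ := fun C hC =>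
    mul_le_mul_of_nonneg_right
      (pow_le_pow_right₀ (by norm_num) ((Finset.card_le_card hC).trans hS)) hψ0
  have hlow : ∀ i, ∀ C ⊆ S, i ∉ C → 1 / 42 ≤ ‖green (minorSet A C) z i i‖ := by
    intro i C hC hi
    have h1 := (hbase C hC).2 i hi
    have h2 := norm_sub_norm_le (mSC z) (mSC z - green (minorSet A C) z i i)
    rw [sub_sub_cancel, norm_sub_rev] at h2
    have := hpow C hC
    linarith
  have hkC : ∀ C ⊆ S, k ∉ C := fun C hC h => hk (hC h)
  have h0 : 0 ≤ 2 ^ p * ψ := by positivity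
  refine (resolventFamily_green hA hz).diffBound_diag hψ0 hψ1 (by positivity) S
    (fun i j hij C hC hi hj => ?_) (fun i C hC hi => ?_) hk (fun C hC => ?_) (fun C hC => ?_) p
  · have := (hbase C hC).1 i j hij hi hj
    have := hpow C hC
    nlinarith
  · rw [norm_inv]
    refine (inv_anti₀ (by norm_num) (hlow i C hC hi)).trans ?_
    rw [one_div, inv_inv]
    linarith
  · have := (hbase C hC).2 k (hkC C hC)
    have := hpow C hC
    nlinarith
  · have hl := hlow k C hC (hkC C hC)
    have hg0 : green (minorSet A C) z k k ≠ 0 := norm_pos_iff.mp (by linarith)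
    have hm0 : mSC z ≠ 0 := norm_pos_iff.mp (by linarith)
    rw [inv_sub_inv hg0 hm0, norm_div, norm_mul, norm_sub_rev, div_le_iff₀ (by positivity)]
    have h1 := (hbase C hC).2 k (hkC C hC)
    have h2 := hpow C hC
    -- The origin of `882 = 42 * 21`: the lower bounds on `|G_kk|` and `|m|`.
    have h3 : 1 / 882 ≤ ‖green (minorSet A C) z k k‖ * ‖mSC z‖ := by nlinarith
    nlinarith

/-- The size of all entries of a matrix. -/
noncomputable def entrySum (A : Matrix (Fin N) (Fin N) ℂ) : ℝ := 1 + ∑ p : Fin N × Fin N, ‖A p.1 p.2‖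

theorem one_le_entrySum : 1 ≤ entrySum A :=
  le_add_of_nonneg_right (Finset.sum_nonneg fun _ _ => norm_nonneg _)

theorem norm_le_entrySum (i j : Fin N) : ‖A i j‖ ≤ entrySum A := by
  have := Finset.single_le_sum (f := fun p : Fin N × Fin N => ‖A p.1 p.2‖)
    (fun _ _ => norm_nonneg _) (Finset.mem_univ (i, j))
  simp only at this
  rw [entrySum]; linarith

theorem sum_norm_row_le_entrySum (i : Fin N) (s : Finset (Fin N)) :
    ∑ j ∈ s, ‖A i j‖ ≤ entrySum A := by
  have h1 : ∑ j ∈ s, ‖A i j‖ ≤ ∑ j, ‖A i j‖ :=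
    Finset.sum_le_sum_of_subset_of_nonneg (Finset.subset_univ _) fun _ _ _ => norm_nonneg _
  have h2 : ∑ j, ‖A i j‖ ≤ ∑ p : Fin N × Fin N, ‖A p.1 p.2‖ := by
    rw [Fintype.sum_prod_type]
    exact Finset.single_le_sum (f := fun i => ∑ j, ‖A i j‖)
      (fun _ _ => Finset.sum_nonneg fun _ _ => norm_nonneg _) (Finset.mem_univ i)
  rw [entrySum]; linarith

theorem sum_norm_col_le_entrySum (j : Fin N) (s : Finset (Fin N)) :
    ∑ i ∈ s, ‖A i j‖ ≤ entrySum A := by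
  have h1 : ∑ i ∈ s, ‖A i j‖ ≤ ∑ i, ‖A i j‖ :=
    Finset.sum_le_sum_of_subset_of_nonneg (Finset.subset_univ _) fun _ _ _ => norm_nonneg _
  have h2 : ∑ i, ‖A i j‖ ≤ ∑ p : Fin N × Fin N, ‖A p.1 p.2‖ := by
    rw [Fintype.sum_prod_type_right]
    exact Finset.single_le_sum (f := fun j => ∑ i, ‖A i j‖)
      (fun _ _ => Finset.sum_nonneg fun _ _ => norm_nonneg _) (Finset.mem_univ j)
  rw [entrySum]; linarith

theorem entrySum_minorSet_le (C : Finset (Fin N)) : entrySum (minorSet A C) ≤ entrySum A :=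
  add_le_add_right (Finset.sum_le_sum fun p _ => norm_minorSet_le C p.1 p.2) _

/-- Schur's formula expresses `1/G_kk` through entries of `A` and a resolvent bounded by `η⁻¹`.
Hence no smallness of `Λ` is needed, and the bound serves on the exceptional event. -/
theorem norm_inv_green_diag_le (hA : A.IsHermitian) (hz : 0 < z.im) (hz20 : ‖z‖ ≤ 20) (k : Fin N) :
    ‖(green A z k k)⁻¹‖ ≤ entrySum A + 20 + z.im⁻¹ * entrySum A ^ 2 := by
  rw [← one_div, one_div_green_diag hA hz]
  refine (norm_sub_le _ _).trans (add_le_add ((norm_sub_le _ _).trans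
    (add_le_add (norm_le_entrySum k k) hz20)) ?_)
  calc _ ≤ ∑ a ∈ Finset.univ.erase k, ∑ b ∈ Finset.univ.erase k,
        ‖A k a‖ * z.im⁻¹ * ‖A b k‖ := by
        refine (norm_sum_le _ _).trans (Finset.sum_le_sum fun a _ =>
          (norm_sum_le _ _).trans (Finset.sum_le_sum fun b _ => ?_))
        rw [norm_mul, norm_mul]
        have := norm_green_le (minor_isHermitian hA k) hz a b
        gcongr
    _ = z.im⁻¹ * ((∑ a ∈ Finset.univ.erase k, ‖A k a‖) *
          ∑ b ∈ Finset.univ.erase k, ‖A b k‖) := by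
        rw [Finset.sum_mul_sum, Finset.mul_sum]
        refine Finset.sum_congr rfl fun a _ => ?_
        rw [Finset.mul_sum]
        refine Finset.sum_congr rfl fun b _ => ?_
        ring
    _ ≤ z.im⁻¹ * (entrySum A * entrySum A) := by
        refine mul_le_mul_of_nonneg_left (mul_le_mul (sum_norm_row_le_entrySum _ _)
          (sum_norm_col_le_entrySum _ _) (Finset.sum_nonneg fun _ _ => norm_nonneg _)
          (zero_le_one.trans one_le_entrySum)) (inv_pos.mpr hz).le
    _ = _ := by ring

/-- A crude bound on the centred diagonal entries of the resolvent and their inverses. -/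
theorem norm_green_diag_crude (hA : A.IsHermitian) (hz : 0 < z.im) (hz20 : ‖z‖ ≤ 20)
    (hm : 1 / 21 ≤ ‖mSC z‖) (hN : (1 : ℝ) ≤ N) (hzN : z.im⁻¹ ≤ N) (C : Finset (Fin N)) (k : Fin N) :
    ‖green (minorSet A C) z k k - mSC z‖ ≤ 43 * N * entrySum A ^ 2 ∧
      ‖(green (minorSet A C) z k k)⁻¹ - (mSC z)⁻¹‖ ≤ 43 * N * entrySum A ^ 2 := by
  have hR := one_le_entrySum (A := A)
  have hherm := minorSet_isHermitian hA C
  have hR2 : entrySum A ≤ entrySum A ^ 2 := by nlinarith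
  have hNR : entrySum A ^ 2 ≤ N * entrySum A ^ 2 := le_mul_of_one_le_left (by positivity) hN
  have hNR' : (N : ℝ) ≤ N * entrySum A ^ 2 :=
    le_mul_of_one_le_right (by positivity) (by nlinarith)
  constructor
  · have h1 := (norm_green_le hherm hz k k).trans hzN
    have h2 := (norm_mSC_lt_one hz).le
    have := norm_sub_le (green (minorSet A C) z k k) (mSC z)
    linarith
  · have h1 := norm_inv_green_diag_le hherm hz hz20 k
    have h0 := entrySum_minorSet_le (A := A) C
    have h00 := one_le_entrySum (A := minorSet A C)
    have h2 : ‖(mSC z)⁻¹‖ ≤ 21 := by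
      rw [norm_inv]
      exact (inv_anti₀ (by norm_num) hm).trans (by norm_num)
    have h3 : z.im⁻¹ * entrySum (minorSet A C) ^ 2 ≤ N * entrySum A ^ 2 := by gcongr
    have := norm_sub_le (green (minorSet A C) z k k)⁻¹ (mSC z)⁻¹
    linarith

end Deterministic

/-! ### Conditional expectation and independence -/

section ConditionalExpectation

variable {Ω : Type*} {mΩ : MeasurableSpace Ω} {μ : Measure Ω}

/-- Conditioned on `m₂`, the variable `1_s f` has a constant expectation; integrate this constant
over `t`. -/
theorem setIntegral_inter_of_indep {m₁ m₂ : MeasurableSpace Ω} [IsProbabilityMeasure μ]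
    (h₁ : m₁ ≤ mΩ) (h₂ : m₂ ≤ mΩ) (hind : Indep m₁ m₂ μ) {f : Ω → ℂ}
    (hf : StronglyMeasurable[m₁] f) (hfi : Integrable f μ) {s t : Set Ω}
    (hs : MeasurableSet[m₁] s) (ht : MeasurableSet[m₂] t) :
    ∫ ω in s ∩ t, f ω ∂μ = μ.real t • ∫ ω in s, f ω ∂μ := by
  have hsm : StronglyMeasurable[m₁] (s.indicator f) := hf.indicator hs
  have hsi : Integrable (s.indicator f) μ := hfi.indicator (h₁ _ hs)
  have h := condExp_indep_eq h₁ h₂ hsm hind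
  have h3 := setIntegral_condExp h₂ hsi ht
  rw [setIntegral_congr_ae (h₂ _ ht) (h.mono fun ω hω _ => hω), setIntegral_const,
    integral_indicator (h₁ _ hs), setIntegral_indicator (h₁ _ hs), Set.inter_comm t s] at h3
  exact h3.symm

/-- Conditioning on additional independent information does not change the conditional
expectation. -/
theorem condExp_sup_of_indep {m₀ m₁ m₂ : MeasurableSpace Ω} [IsProbabilityMeasure μ]
    (h₀₁ : m₀ ≤ m₁) (h₁ : m₁ ≤ mΩ) (h₂ : m₂ ≤ mΩ) (hind : Indep m₁ m₂ μ) {f : Ω → ℂ}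
    (hf : StronglyMeasurable[m₁] f) (hfi : Integrable f μ) :
    μ[f | m₀ ⊔ m₂] =ᵐ[μ] μ[f | m₀] := by
  have h₀ : m₀ ≤ mΩ := h₀₁.trans h₁
  have hsup : m₀ ⊔ m₂ ≤ mΩ := sup_le h₀ h₂
  set g := μ[f | m₀] with hg
  have hgi : Integrable g μ := integrable_condExp
  have hgm : StronglyMeasurable[m₀] g := stronglyMeasurable_condExp
  refine (ae_eq_condExp_of_forall_setIntegral_eq hsup hfi (fun s _ _ => hgi.integrableOn)
    (fun s hs _ => ?_) (hgm.mono le_sup_left).aestronglyMeasurable).symm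
  -- It suffices to compare integrals over the sets `s ∩ t`, which form a π-system generating `m₀ ⊔
  -- m₂`. There independence extracts the factor `μ t` on both sides.
  set π : Set (Set Ω) := {u | ∃ s t, MeasurableSet[m₀] s ∧ MeasurableSet[m₂] t ∧ u = s ∩ t} with hπ
  have hgen : m₀ ⊔ m₂ = MeasurableSpace.generateFrom π := by
    apply le_antisymm
    · refine sup_le (fun s hs => ?_) (fun t ht => ?_)
      · exact MeasurableSpace.measurableSet_generateFrom
          ⟨s, Set.univ, hs, MeasurableSet.univ, by simp⟩
      · exact MeasurableSpace.measurableSet_generateFrom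
          ⟨Set.univ, t, MeasurableSet.univ, ht, by simp⟩
    · refine MeasurableSpace.generateFrom_le ?_
      rintro u ⟨s, t, hs, ht, rfl⟩
      exact MeasurableSet.inter ((le_sup_left : m₀ ≤ m₀ ⊔ m₂) _ hs)
        ((le_sup_right : m₂ ≤ m₀ ⊔ m₂) _ ht)
  have hpi : IsPiSystem π := by
    rintro u ⟨s, t, hs, ht, rfl⟩ v ⟨s', t', hs', ht', rfl⟩ _
    exact ⟨s ∩ s', t ∩ t', hs.inter hs', ht.inter ht', Set.inter_inter_inter_comm _ _ _ _⟩
  have huniv : ∫ ω, g ω ∂μ = ∫ ω, f ω ∂μ := integral_condExp h₀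
  induction s, hs using MeasurableSpace.induction_on_inter hgen hpi with
  | empty => simp
  | basic u hu =>
    obtain ⟨s, t, hs, ht, rfl⟩ := hu
    rw [setIntegral_inter_of_indep h₁ h₂ hind (hgm.mono h₀₁) hgi (h₀₁ _ hs) ht,
      setIntegral_inter_of_indep h₁ h₂ hind hf hfi (h₀₁ _ hs) ht, setIntegral_condExp h₀ hfi hs]
  | compl u hu ih =>
    have e1 := integral_add_compl (hsup _ hu) hgi
    have e2 := integral_add_compl (hsup _ hu) hfi
    have := ih (measure_lt_top _ _)
    rw [huniv, ← e2, this] at e1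
    exact add_left_cancel e1
  | iUnion u hdisj hu ih =>
    rw [integral_iUnion (fun i => hsup _ (hu i)) hdisj hgi.integrableOn,
      integral_iUnion (fun i => hsup _ (hu i)) hdisj hfi.integrableOn]
    exact tsum_congr fun i => ih i (measure_lt_top _ _)

end ConditionalExpectation

/-! ### The σ-algebras generated by minors -/

section Model

variable {N : ℕ} {Ω : Type*} {mΩ : MeasurableSpace Ω} {P : Measure Ω}
  {H : Ω → Matrix (Fin N) (Fin N) ℂ}

/-- The σ-algebra generated by the minor `H^{(k)}`. -/
@[reducible]
noncomputable def minorAlg (H : Ω → Matrix (Fin N) (Fin N) ℂ) (k : Fin N) : MeasurableSpace Ω :=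
  MeasurableSpace.comap (fun (ω : Ω) (p : Fin N × Fin N) => minor (H ω) k p.1 p.2) inferInstance

theorem partialExp_def (k : Fin N) (X : Ω → ℂ) : partialExp P H k X = P[X | minorAlg H k] := rfl

/-- The σ-algebra generated by the entry `p` with `p.1 ≤ p.2`. -/
@[reducible]
noncomputable def entryAlg (H : Ω → Matrix (Fin N) (Fin N) ℂ) (p : {p : Fin N × Fin N // p.1 ≤ p.2}) :
    MeasurableSpace Ω :=
  MeasurableSpace.comap (fun ω => H ω p.1.1 p.1.2) inferInstance

/-- Hermitian symmetry recovers the lower triangle by conjugation. In this form independence of two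
σ-algebras reduces to disjointness of index sets of independent entries. -/
theorem minorAlg_eq (hherm : ∀ ω, (H ω).IsHermitian) (k : Fin N) :
    minorAlg H k = ⨆ p ∈ {p : {p : Fin N × Fin N // p.1 ≤ p.2} | p.1.1 ≠ k ∧ p.1.2 ≠ k},
      entryAlg H p := by
  set m' := ⨆ p ∈ {p : {p : Fin N × Fin N // p.1 ≤ p.2} | p.1.1 ≠ k ∧ p.1.2 ≠ k},
      entryAlg H p with hm'
  apply le_antisymm
  · rw [minorAlg, ← measurable_iff_comap_le, measurable_pi_iff]
    rintro ⟨i, j⟩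
    simp only [minor, Matrix.of_apply]
    by_cases hij : i = k ∨ j = k
    · simp only [hij, if_true]
      exact measurable_const
    · simp only [hij, if_false]
      push Not at hij
      have key : ∀ i j, i ≤ j → i ≠ k → j ≠ k → Measurable[m'] fun ω => H ω i j := by
        intro i j hle hi hj
        have hle' : entryAlg H ⟨(i, j), hle⟩ ≤ m' :=
          le_iSup₂_of_le (f := fun p _ => entryAlg H p) ⟨(i, j), hle⟩ ⟨hi, hj⟩ le_rfl
        exact (comap_measurable fun ω => H ω i j).mono hle' le_rfl
      rcases le_total i j with hle | hle
      · exact key i j hle hij.1 hij.2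
      · have := (key j i hle hij.2 hij.1)
        have h2 : (fun ω => H ω i j) = fun ω => star (H ω j i) := by
          funext ω
          have := congrFun (congrFun (hherm ω) i) j
          simpa using this.symm
        rw [h2]
        exact continuous_star.measurable.comp this
  · refine iSup₂_le fun p hp => ?_
    rw [entryAlg, ← measurable_iff_comap_le]
    have h1 : Measurable[minorAlg H k] fun ω => minor (H ω) k p.1.1 p.1.2 :=
      (measurable_pi_apply (p.1 : Fin N × Fin N)).comp
        (comap_measurable fun (ω : Ω) (p : Fin N × Fin N) => minor (H ω) k p.1 p.2)
    have h2 : (fun ω => H ω p.1.1 p.1.2) = fun ω => minor (H ω) k p.1.1 p.1.2 := by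
      funext ω
      simp [minor, hp.1, hp.2]
    rw [h2]
    exact h1

namespace IsRandomMatrixModel

variable {δ : ℝ} {ν : ℕ → ℝ}

theorem entryAlg_le (hM : IsRandomMatrixModel δ ν P H) (p) : entryAlg H p ≤ mΩ :=
  (hM.measurable p.1.1 p.1.2).comap_le

theorem minorAlg_le (hM : IsRandomMatrixModel δ ν P H) (k : Fin N) : minorAlg H k ≤ mΩ := by
  rw [minorAlg_eq hM.hermitian]
  exact iSup₂_le fun p _ => hM.entryAlg_le p

theorem iIndep_entryAlg (hM : IsRandomMatrixModel δ ν P H) : iIndep (entryAlg H) P := hM.indep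

/-- Partial expectation in `l` preserves measurability with respect to `H^{(k)}`. -/
theorem aestronglyMeasurable_partialExp [IsProbabilityMeasure P]
    (hM : IsRandomMatrixModel δ ν P H) (k l : Fin N) {f : Ω → ℂ}
    (hf : StronglyMeasurable[minorAlg H k] f) (hfi : Integrable f P) :
    AEStronglyMeasurable[minorAlg H k] (partialExp P H l f) P := by
  have hk := minorAlg_eq hM.hermitian k
  have hl := minorAlg_eq hM.hermitian l
  set I := {p : {p : Fin N × Fin N // p.1 ≤ p.2} | p.1.1 ≠ k ∧ p.1.2 ≠ k} with hI
  set J := {p : {p : Fin N × Fin N // p.1 ≤ p.2} | p.1.1 ≠ l ∧ p.1.2 ≠ l} with hJ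
  -- Split the entries of `H^{(l)}` into those shared with `H^{(k)}` and the rest. The rest is
  -- independent of `H^{(k)}`, so conditioning on it has no effect on `f`.
  set m₀ := ⨆ p ∈ J ∩ I, entryAlg H p with hm₀
  set m₂ := ⨆ p ∈ J \ I, entryAlg H p with hm₂
  have hl' : minorAlg H l = m₀ ⊔ m₂ := by
    rw [hl, ← Set.inter_union_sdiff J I, iSup_union, hm₀, hm₂]
  have h₀₁ : m₀ ≤ minorAlg H k := by
    rw [hk]
    exact biSup_mono fun p hp => hp.2
  have hind : Indep (minorAlg H k) m₂ P := by
    rw [hk]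
    exact indep_iSup_of_disjoint hM.entryAlg_le hM.iIndep_entryAlg Set.disjoint_sdiff_right
  have h₂ : m₂ ≤ mΩ := iSup₂_le fun p _ => hM.entryAlg_le p
  rw [partialExp_def, hl']
  refine (AEStronglyMeasurable.congr ?_
    (condExp_sup_of_indep h₀₁ (hM.minorAlg_le k) h₂ hind hf hfi).symm)
  exact (stronglyMeasurable_condExp.mono h₀₁).aestronglyMeasurable

end IsRandomMatrixModel

end Model

/-! ### Random variables with all moments finite -/

section Moments

variable {Ω : Type*} {mΩ : MeasurableSpace Ω} {P : Measure Ω}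

/-- All moments of `f` are finite. -/
def AllMemLp (P : Measure Ω) (f : Ω → ℂ) : Prop := ∀ q : ℕ, MemLp f q P

namespace AllMemLp

variable {f g : Ω → ℂ}

theorem integrable (hf : AllMemLp P f) : Integrable f P :=
  memLp_one_iff_integrable.mp (by simpa using hf 1)

theorem integrable_norm_pow (hf : AllMemLp P f) {q : ℕ} (hq : q ≠ 0) :
    Integrable (fun ω => ‖f ω‖ ^ q) P :=
  (hf q).integrable_norm_pow hq

theorem add (hf : AllMemLp P f) (hg : AllMemLp P g) : AllMemLp P fun ω => f ω + g ω :=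
  fun q => (hf q).add (hg q)

theorem sub (hf : AllMemLp P f) (hg : AllMemLp P g) : AllMemLp P fun ω => f ω - g ω :=
  fun q => (hf q).sub (hg q)

theorem const_mul (hf : AllMemLp P f) (c : ℂ) : AllMemLp P fun ω => c * f ω :=
  fun q => (hf q).const_mul c

theorem const [IsProbabilityMeasure P] (c : ℂ) : AllMemLp P fun _ => c :=
  fun _ => memLp_const c

theorem sum {ι : Type*} {s : Finset ι} {f : ι → Ω → ℂ} (hf : ∀ i ∈ s, AllMemLp P (f i)) :
    AllMemLp P fun ω => ∑ i ∈ s, f i ω :=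
  fun q => memLp_finsetSum s fun i hi => hf i hi q

theorem of_norm_le (hf : AllMemLp P f) (hg : AEStronglyMeasurable g P)
    (h : ∀ ω, ‖g ω‖ ≤ ‖f ω‖) : AllMemLp P g :=
  fun q => (hf q).of_le hg (Filter.Eventually.of_forall h)

theorem mul (hf : AllMemLp P f) (hg : AllMemLp P g) : AllMemLp P fun ω => f ω * g ω := by
  intro q
  have : ENNReal.HolderTriple ((2 * q : ℕ) : ENNReal) ((2 * q : ℕ) : ENNReal) (q : ENNReal) := by
    constructor
    push_cast
    rw [ENNReal.mul_inv (by simp) (by simp), ← add_mul, ENNReal.inv_two_add_inv_two, one_mul]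
  exact MemLp.mul' (hg (2 * q)) (hf (2 * q))

theorem prod [IsProbabilityMeasure P] {ι : Type*} {s : Finset ι} {f : ι → Ω → ℂ}
    (hf : ∀ i ∈ s, AllMemLp P (f i)) : AllMemLp P fun ω => ∏ i ∈ s, f i ω := by
  classical
  induction s using Finset.induction_on with
  | empty => simpa using const 1
  | insert a s ha ih =>
    simp only [Finset.prod_insert ha]
    exact (hf a (by simp)).mul (ih fun i hi => hf i (by simp [hi]))

theorem condExp [IsProbabilityMeasure P] (hf : AllMemLp P f) (m : MeasurableSpace Ω) :
    AllMemLp P (P[f | m]) := by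
  intro q
  rcases Nat.eq_zero_or_pos q with rfl | hq
  · exact (MemLp.condExp le_rfl (by simpa using hf 1)).mono_exponent (by simp)
  · exact MemLp.condExp (by exact_mod_cast hq) (hf q)

end AllMemLp

/-- The product is at most the `p`-th power of its largest factor. This costs a factor `p` against
Hölder's inequality, which is harmless. -/
theorem prod_le_sum_pow {p : ℕ} (hp : p ≠ 0) {x : Fin p → ℝ} (hx : ∀ i, 0 ≤ x i) :
    ∏ i, x i ≤ ∑ i, x i ^ p := by
  have : Nonempty (Fin p) := ⟨⟨0, Nat.pos_of_ne_zero hp⟩⟩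
  obtain ⟨j, -, hj⟩ := Finset.exists_max_image Finset.univ x Finset.univ_nonempty
  calc ∏ i, x i ≤ ∏ _i : Fin p, x j := Finset.prod_le_prod (fun i _ => hx i) fun i hi => hj i hi
    _ = x j ^ p := by simp
    _ ≤ _ := Finset.single_le_sum (f := fun i => x i ^ p)
      (fun i _ => pow_nonneg (hx i) _) (Finset.mem_univ j)

/-- A crude form of Hölder's inequality for finitely many factors. -/
theorem norm_integral_prod_le [IsProbabilityMeasure P] {p : ℕ} (hp : p ≠ 0) {F : Fin p → Ω → ℂ}
    (hF : ∀ s, AllMemLp P (F s)) {c : Fin p → ℝ} (hc : ∀ s, 0 < c s)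
    (h : ∀ s, ∫ ω, ‖F s ω‖ ^ p ∂P ≤ c s ^ p) :
    ‖∫ ω, ∏ s, F s ω ∂P‖ ≤ p * ∏ s, c s := by
  have hcp : 0 < ∏ s, c s := Finset.prod_pos fun s _ => hc s
  have hint : ∀ s, Integrable (fun ω => (‖F s ω‖ / c s) ^ p) P := fun s => by
    simp only [div_pow]
    exact ((hF s).integrable_norm_pow hp).div_const _
  calc ‖∫ ω, ∏ s, F s ω ∂P‖ ≤ ∫ ω, ‖∏ s, F s ω‖ ∂P := norm_integral_le_integral_norm _
    _ ≤ ∫ ω, (∏ s, c s) * ∑ s, (‖F s ω‖ / c s) ^ p ∂P := by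
        refine integral_mono (AllMemLp.prod fun s _ => hF s).integrable.norm
          ((integrable_finsetSum _ fun s _ => hint s).const_mul _) fun ω => ?_
        simp only
        have := prod_le_sum_pow hp (x := fun s => ‖F s ω‖ / c s)
          fun s => div_nonneg (norm_nonneg _) (hc s).le
        rw [Finset.prod_div_distrib, div_le_iff₀ hcp] at this
        rw [norm_prod]
        linarith
    _ = (∏ s, c s) * ∑ s, ∫ ω, (‖F s ω‖ / c s) ^ p ∂P := by
        rw [integral_const_mul, integral_finsetSum _ fun s _ => hint s]
    _ ≤ (∏ s, c s) * ∑ _s : Fin p, 1 := by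
        refine mul_le_mul_of_nonneg_left (Finset.sum_le_sum fun s _ => ?_) hcp.le
        simp only [div_pow]
        rw [integral_div, div_le_one (pow_pos (hc s) _)]
        exact h s
    _ = _ := by simp [mul_comm]

end Moments

/-! ### The fluctuation operators `Q_k` -/

section Fluctuation

variable {N : ℕ} {Ω : Type*} {mΩ : MeasurableSpace Ω} {P : Measure Ω}
  {H : Ω → Matrix (Fin N) (Fin N) ℂ}

theorem AllMemLp.fluct [IsProbabilityMeasure P] {f : Ω → ℂ} (hf : AllMemLp P f) (k : Fin N) :
    AllMemLp P (fluct P H k f) :=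
  hf.sub (hf.condExp _)

/-- Conditional expectation contracts the `p`-th norm, and `(x + y)^p ≤ 2^(p-1) (x^p + y^p)`. -/
theorem integral_norm_fluct_pow_le [IsProbabilityMeasure P] {f : Ω → ℂ} (hf : AllMemLp P f)
    (k : Fin N) {p : ℕ} (hp : p ≠ 0) :
    ∫ ω, ‖FluctAvg.fluct P H k f ω‖ ^ p ∂P ≤ 2 ^ p * ∫ ω, ‖f ω‖ ^ p ∂P := by
  have hc : ∫ ω, ‖partialExp P H k f ω‖ ^ p ∂P ≤ ∫ ω, ‖f ω‖ ^ p ∂P := by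
    have := integral_norm_condExp_rpow_le (m := minorAlg H k) (μ := P) (p := p) (f := f)
      (by exact_mod_cast Nat.one_le_iff_ne_zero.mpr hp)
      (by simpa using hf.integrable_norm_pow hp)
    simpa [partialExp_def] using this
  have hi1 := hf.integrable_norm_pow hp
  have hi2 : Integrable (fun ω => ‖partialExp P H k f ω‖ ^ p) P :=
    (hf.condExp _).integrable_norm_pow hp
  calc _ ≤ ∫ ω, 2 ^ (p - 1) * (‖f ω‖ ^ p + ‖partialExp P H k f ω‖ ^ p) ∂P := by
        refine integral_mono ((hf.fluct k).integrable_norm_pow hp)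
          ((hi1.add hi2).const_mul _) fun ω => ?_
        exact (pow_le_pow_left₀ (norm_nonneg _) (norm_sub_le _ _) p).trans
          (add_pow_le (norm_nonneg _) (norm_nonneg _) p)
    _ = 2 ^ (p - 1) * (∫ ω, ‖f ω‖ ^ p ∂P + ∫ ω, ‖partialExp P H k f ω‖ ^ p ∂P) := by
        rw [integral_const_mul, integral_add hi1 hi2]
    _ ≤ 2 ^ (p - 1) * (∫ ω, ‖f ω‖ ^ p ∂P + ∫ ω, ‖f ω‖ ^ p ∂P) := by gcongr
    _ = _ := by
        obtain ⟨q, rfl⟩ := Nat.exists_eq_succ_of_ne_zero hp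
        simp only [Nat.succ_eq_add_one, Nat.add_sub_cancel]
        ring

theorem fluct_sum [IsProbabilityMeasure P] {ι : Type*} {s : Finset ι} {f : ι → Ω → ℂ}
    (hf : ∀ i ∈ s, Integrable (f i) P) (k : Fin N) :
    FluctAvg.fluct P H k (fun ω => ∑ i ∈ s, f i ω) =ᵐ[P]
      fun ω => ∑ i ∈ s, FluctAvg.fluct P H k (f i) ω := by
  have h := condExp_finsetSum hf (minorAlg H k)
  have e : (∑ i ∈ s, f i) = fun ω => ∑ i ∈ s, f i ω := by funext ω; simp
  rw [e] at h
  filter_upwards [h] with ω hω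
  simp only [FluctAvg.fluct, partialExp_def, hω, Finset.sum_apply, Finset.sum_sub_distrib]

/-- `Q_k Y` is orthogonal to functions of `H^{(k)}`. -/
theorem integral_fluct_mul_eq_zero [IsProbabilityMeasure P] {k : Fin N}
    (hm : minorAlg H k ≤ mΩ) {Y W : Ω → ℂ} (hY : AllMemLp P Y) (hW : AllMemLp P W)
    (hWm : AEStronglyMeasurable[minorAlg H k] W P) :
    ∫ ω, FluctAvg.fluct P H k Y ω * W ω ∂P = 0 := by
  have h1 := condExp_bilin_of_aestronglyMeasurable_right (ContinuousLinearMap.mul ℝ ℂ) hWm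
    (f := Y) (hY.mul hW).integrable hY.integrable
  have h2 : ∫ ω, Y ω * W ω ∂P = ∫ ω, partialExp P H k Y ω * W ω ∂P := by
    rw [← integral_condExp hm, partialExp_def]
    exact integral_congr_ae h1
  have hPW : AllMemLp P fun ω => partialExp P H k Y ω * W ω := (hY.condExp _).mul hW
  simp only [FluctAvg.fluct, sub_mul]
  rw [integral_sub (hY.mul hW).integrable hPW.integrable, h2, sub_self]

end Fluctuation

/-! ### Counting labels -/

section Combinatorics

variable {ι : Type*} [Fintype ι] [DecidableEq ι]

/-- The labels that are attained exactly once. -/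
def loneLabels {p : ℕ} (k : Fin p → ι) : Finset ι :=
  Finset.univ.filter fun l => (Finset.univ.filter fun s => k s = l).card = 1

theorem mem_loneLabels {p : ℕ} {k : Fin p → ι} {l : ι} (hl : l ∈ loneLabels k) :
    ∃ s, k s = l ∧ ∀ r, k r = l → r = s := by
  obtain ⟨s, hs⟩ := Finset.card_eq_one.mp (Finset.mem_filter.mp hl).2
  have h : ∀ r, k r = l ↔ r = s := fun r => by
    have := Finset.ext_iff.mp hs r
    simpa using this
  exact ⟨s, (h s).mpr rfl, fun r hr => (h r).mp hr⟩

theorem loneLabels_subset_image {p : ℕ} (k : Fin p → ι) :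
    loneLabels k ⊆ Finset.univ.image k := fun l hl => by
  obtain ⟨s, hs, -⟩ := mem_loneLabels hl
  exact Finset.mem_image.mpr ⟨s, Finset.mem_univ _, hs⟩

theorem card_loneLabels_le {p : ℕ} (k : Fin p → ι) : (loneLabels k).card ≤ p :=
  (Finset.card_le_card (loneLabels_subset_image k)).trans (Finset.card_image_le.trans (by simp))

/-- Every attained label that is not lone is attained at least twice. Hence each label accounts for
at least two units of the right-hand side. -/
theorem two_mul_card_image_le {p : ℕ} (k : Fin p → ι) :
    2 * (Finset.univ.image k).card ≤ p + (loneLabels k).card := by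
  have h1 : p = ∑ l ∈ Finset.univ.image k, (Finset.univ.filter fun s => k s = l).card := by
    have := Finset.card_eq_sum_card_image k (Finset.univ : Finset (Fin p))
    simpa using this
  have h2 : (loneLabels k).card =
      ∑ l ∈ Finset.univ.image k, if l ∈ loneLabels k then 1 else 0 := by
    rw [Finset.sum_ite_mem, Finset.inter_eq_right.mpr (loneLabels_subset_image k)]
    simp
  have h3 : ∑ l ∈ Finset.univ.image k, 2 ≤ ∑ l ∈ Finset.univ.image k,
      ((Finset.univ.filter fun s => k s = l).card + if l ∈ loneLabels k then 1 else 0) := by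
    refine Finset.sum_le_sum fun l hl => ?_
    obtain ⟨s, -, hs⟩ := Finset.mem_image.mp hl
    have hpos : 0 < (Finset.univ.filter fun s => k s = l).card :=
      Finset.card_pos.mpr ⟨s, by simpa using hs⟩
    split_ifs with h
    · omega
    · have : (Finset.univ.filter fun s => k s = l).card ≠ 1 := fun hc =>
        h (Finset.mem_filter.mpr ⟨Finset.mem_univ _, hc⟩)
      omega
  rw [Finset.sum_add_distrib, ← h1, ← h2, Finset.sum_const, smul_eq_mul] at h3
  omega

/-- Summation over label functions with a factor `x` for each distinct label. -/
theorem sum_prod_mul_pow_card_image_le {τ : ι → ℝ} {x : ℝ} (hτ : ∀ i, 0 ≤ τ i)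
    (hτx : ∀ i, τ i ≤ x) (hsum : ∑ i, τ i ≤ 1) (hx : 0 ≤ x) (p : ℕ) :
    ∑ k : Fin p → ι, (∏ s, τ (k s)) * x ^ (Finset.univ.image k).card ≤ p.factorial * x ^ p := by
  induction p with
  | zero => simp
  | succ p ih =>
    rw [← (Fin.consEquiv fun _ : Fin (p + 1) => ι).sum_comp, Fintype.sum_prod_type_right]
    have himg : ∀ (a : ι) (k : Fin p → ι),
        Finset.univ.image (Fin.cons a k : Fin (p + 1) → ι) = insert a (Finset.univ.image k) := by
      intro a k
      ext l
      simp [Fin.exists_fin_succ, eq_comm]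
    have hstep : ∀ k : Fin p → ι, ∑ a, (∏ s, τ ((Fin.cons a k : Fin (p + 1) → ι) s)) *
        x ^ (Finset.univ.image (Fin.cons a k : Fin (p + 1) → ι)).card ≤
        (p + 1) * x * ((∏ s, τ (k s)) * x ^ (Finset.univ.image k).card) := by
      intro k
      set I := Finset.univ.image k with hI
      have hprod : 0 ≤ ∏ s, τ (k s) := Finset.prod_nonneg fun s _ => hτ _
      -- Prepend one label. If it repeats one of the at most `p` present labels, its weight is at
      -- most `x`. If it is new, the image grows and yields `x`, while the weights sum to at most
      -- one. Together this gives the factor `(p + 1) x`.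
      have hterm : ∀ a, (∏ s, τ ((Fin.cons a k : Fin (p + 1) → ι) s)) *
          x ^ (Finset.univ.image (Fin.cons a k : Fin (p + 1) → ι)).card ≤
          ((if a ∈ I then x else 0) + x * τ a) * ((∏ s, τ (k s)) * x ^ I.card) := by
        intro a
        rw [himg, Fin.prod_univ_succ]
        simp only [Fin.cons_zero, Fin.cons_succ]
        by_cases ha : a ∈ I
        · rw [Finset.insert_eq_of_mem ha, if_pos ha]
          have : τ a ≤ x + x * τ a := (hτx a).trans (le_add_of_nonneg_right (mul_nonneg hx (hτ a)))
          calc _ = τ a * ((∏ s, τ (k s)) * x ^ I.card) := by ring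
            _ ≤ _ := mul_le_mul_of_nonneg_right this (by positivity)
        · rw [Finset.card_insert_of_notMem ha, if_neg ha, zero_add, pow_succ]
          exact le_of_eq (by ring)
      refine (Finset.sum_le_sum fun a _ => hterm a).trans ?_
      rw [← Finset.sum_mul]
      refine mul_le_mul_of_nonneg_right ?_ (by positivity)
      rw [Finset.sum_add_distrib, ← Finset.mul_sum, Finset.sum_ite_mem, Finset.univ_inter,
        Finset.sum_const, nsmul_eq_mul]
      have hcard : (I.card : ℝ) ≤ p := by
        exact_mod_cast Finset.card_image_le.trans (by simp)
      nlinarith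
    refine (Finset.sum_le_sum fun k _ => hstep k).trans ?_
    rw [← Finset.mul_sum]
    refine (mul_le_mul_of_nonneg_left ih (by positivity)).trans (le_of_eq ?_)
    rw [Nat.factorial_succ]
    push_cast
    ring

end Combinatorics

/-! ### Expectations of products of fluctuations -/

section ProductExpectation

variable {N : ℕ} {Ω : Type*} {mΩ : MeasurableSpace Ω} {P : Measure Ω}
  {H : Ω → Matrix (Fin N) (Fin N) ℂ} {δ : ℝ} {ν : ℕ → ℝ}

theorem measurable_setDiff {m : MeasurableSpace Ω} {X : Finset (Fin N) → Ω → ℂ}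
    {A C : Finset (Fin N)} (h : ∀ D, D ⊆ A → Measurable[m] (X (C ∪ D))) :
    Measurable[m] fun ω => setDiff A (fun D => X D ω) C := by
  simp only [setDiff]
  exact Finset.measurable_fun_sum _ fun _ hD =>
    (h _ (Finset.mem_powerset.mp hD)).const_mul _

theorem AllMemLp.setDiff {X : Finset (Fin N) → Ω → ℂ} (h : ∀ C, AllMemLp P (X C))
    (A C : Finset (Fin N)) : AllMemLp P fun ω => setDiff A (fun D => X D ω) C :=
  AllMemLp.sum fun _ _ => (h _).const_mul _

theorem aestronglyMeasurable_finset_prod {m : MeasurableSpace Ω} {ι : Type*} {f : ι → Ω → ℂ}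
    (s : Finset ι) (hf : ∀ i ∈ s, AEStronglyMeasurable[m] (f i) P) :
    AEStronglyMeasurable[m] (fun ω => ∏ i ∈ s, f i ω) P := by
  classical
  induction s using Finset.induction_on with
  | empty => simpa using stronglyMeasurable_const.aestronglyMeasurable
  | insert a s ha ih =>
    simp only [Finset.prod_insert ha]
    exact (hf a (by simp)).mul (ih fun i hi => hf i (by simp [hi]))

/-- The expectation of a product of fluctuations vanishes if the label of one factor is unaffected
by all the others. -/
theorem integral_prod_fluct_eq_zero [IsProbabilityMeasure P]
    (hM : IsRandomMatrixModel δ ν P H) {p : ℕ} {k : Fin p → Fin N} {Y : Fin p → Ω → ℂ}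
    (hY : ∀ s, AllMemLp P (Y s)) (s : Fin p)
    (hYm : ∀ r, r ≠ s → Measurable[minorAlg H (k s)] (Y r)) :
    ∫ ω, ∏ r, fluct P H (k r) (Y r) ω ∂P = 0 := by
  have hW : AllMemLp P fun ω => ∏ r ∈ Finset.univ.erase s, fluct P H (k r) (Y r) ω :=
    AllMemLp.prod fun r _ => (hY r).fluct (k r)
  -- Each other factor remains measurable with respect to `H^{(k s)}` after applying its own `Q`,
  -- since partial expectations preserve this measurability.
  have hWm : AEStronglyMeasurable[minorAlg H (k s)]
      (fun ω => ∏ r ∈ Finset.univ.erase s, fluct P H (k r) (Y r) ω) P := by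
    refine aestronglyMeasurable_finset_prod _ fun r hr => ?_
    have hr' := (hYm r (Finset.ne_of_mem_erase hr)).stronglyMeasurable
    exact hr'.aestronglyMeasurable.sub
      (hM.aestronglyMeasurable_partialExp (k s) (k r) hr' (hY r).integrable)
  rw [← integral_fluct_mul_eq_zero (hM.minorAlg_le (k s)) (hY s) hW hWm]
  refine integral_congr_ae (Filter.Eventually.of_forall fun ω => ?_)
  exact (Finset.mul_prod_erase Finset.univ (fun r => fluct P H (k r) (Y r) ω)
    (Finset.mem_univ s)).symm

/-- The expectation of a product of fluctuations gains a factor `ψ` for each lone label. -/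
theorem norm_integral_prod_fluct_le [IsProbabilityMeasure P]
    (hM : IsRandomMatrixModel δ ν P H) {p : ℕ} (hp : p ≠ 0) (k : Fin p → Fin N)
    {X : Fin p → Finset (Fin N) → Ω → ℂ}
    (hmeas : ∀ s C, ∀ a ∈ C, Measurable[minorAlg H a] (X s C))
    (hLp : ∀ s C, AllMemLp P (X s C)) {K ψ : ℝ} (hK : 1 ≤ K) (hψ0 : 0 < ψ) (hψ1 : ψ ≤ 1)
    (hb : ∀ s A C, Disjoint A C → k s ∉ A → k s ∉ C → A.card + C.card ≤ p →
      ∫ ω, ‖setDiff A (fun D => X s D ω) C‖ ^ p ∂P ≤ (K * ψ ^ (1 + A.card)) ^ p) :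
    ‖∫ ω, ∏ s, fluct P H (k s) (X s ∅) ω ∂P‖ ≤
      (2 ^ p) ^ p * (p * (2 * K) ^ p) * (ψ ^ 2) ^ (Finset.univ.image k).card := by
  set L := loneLabels k with hL
  -- The term of the expansion of `X s ∅` that is differenced in the directions `A`; all other lone
  -- labels except its own are removed.
  set Y : Fin p → Finset (Fin N) → Ω → ℂ := fun s A ω =>
    setDiff A (fun D => X s D ω) (L.erase (k s) \ A) with hY
  have hYLp : ∀ s A, AllMemLp P (Y s A) := fun s A => AllMemLp.setDiff (hLp s) _ _
  have hexp : ∀ s, (fun ω => ∑ A ∈ (L.erase (k s)).powerset, Y s A ω) = X s ∅ := by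
    intro s
    funext ω
    have := eq_sum_setDiff (L.erase (k s)) (fun D => X s D ω) ∅
    simp only [Finset.empty_union] at this
    exact this.symm
  have hae : ∀ᵐ ω ∂P, ∀ s, fluct P H (k s) (X s ∅) ω =
      ∑ A ∈ (L.erase (k s)).powerset, fluct P H (k s) (Y s A) ω := by
    rw [ae_all_iff]
    intro s
    have := fluct_sum (P := P) (H := H) (s := (L.erase (k s)).powerset) (f := Y s)
      (fun A _ => (hYLp s A).integrable) (k s)
    rwa [hexp s] at this
  have hint : ∫ ω, ∏ s, fluct P H (k s) (X s ∅) ω ∂P =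
      ∑ A ∈ Fintype.piFinset fun s => (L.erase (k s)).powerset,
        ∫ ω, ∏ s, fluct P H (k s) (Y s (A s)) ω ∂P := by
    rw [← integral_finsetSum _ fun A _ =>
      (AllMemLp.prod fun s _ => (hYLp s (A s)).fluct (k s)).integrable]
    refine integral_congr_ae (hae.mono fun ω hω => ?_)
    simp only [hω]
    exact Finset.prod_univ_sum _ _
  have hLcard : L.card ≤ p := card_loneLabels_le k
  have hterm : ∀ A ∈ Fintype.piFinset fun s => (L.erase (k s)).powerset,
      ‖∫ ω, ∏ s, fluct P H (k s) (Y s (A s)) ω ∂P‖ ≤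
        p * (2 * K) ^ p * (ψ ^ 2) ^ (Finset.univ.image k).card := by
    intro A hA
    have hAs : ∀ s, A s ⊆ L.erase (k s) := fun s =>
      Finset.mem_powerset.mp (Fintype.mem_piFinset.mp hA s)
    -- If the lone label `l` is in no `A s`, then row `l` has been removed from every factor but its
    -- own, and the expectation vanishes.
    by_cases hcov : ∃ l ∈ L, ∀ s, l ∉ A s
    · obtain ⟨l, hl, hlA⟩ := hcov
      obtain ⟨s, hs, hs'⟩ := mem_loneLabels hl
      rw [integral_prod_fluct_eq_zero hM (fun r => hYLp r (A r)) s, norm_zero]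
      · positivity
      · intro r hr
        refine measurable_setDiff fun _ _ => hmeas r _ _ ?_
        refine Finset.mem_union_left _ (Finset.mem_sdiff.mpr ⟨Finset.mem_erase.mpr ⟨?_, ?_⟩, ?_⟩)
        · exact fun h => hr (hs' r (h.symm.trans hs))
        · rwa [hs]
        · rw [hs]; exact hlA r
    · push Not at hcov
      have hpow : ∀ s, ∫ ω, ‖fluct P H (k s) (Y s (A s)) ω‖ ^ p ∂P ≤
          (2 * K * ψ ^ (1 + (A s).card)) ^ p := by
        intro s
        refine (integral_norm_fluct_pow_le (hYLp s (A s)) (k s) hp).trans ?_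
        rw [mul_assoc, mul_pow]
        refine mul_le_mul_of_nonneg_left (hb s (A s) _ Finset.disjoint_sdiff ?_ ?_ ?_)
          (by positivity)
        · exact fun h => (Finset.mem_erase.mp (hAs s h)).1 rfl
        · exact fun h => (Finset.mem_erase.mp (Finset.mem_sdiff.mp h).1).1 rfl
        · rw [add_comm, Finset.card_sdiff_add_card_eq_card (hAs s)]
          exact (Finset.card_le_card (Finset.erase_subset _ _)).trans hLcard
      refine (norm_integral_prod_le hp (fun s => (hYLp s (A s)).fluct (k s))
        (fun s => by positivity) hpow).trans ?_
      rw [Finset.prod_mul_distrib, Finset.prod_const, Finset.card_univ, Fintype.card_fin,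
        Finset.prod_pow_eq_pow_sum, ← mul_assoc, ← pow_mul]
      -- Here the sets `A s` cover `L`, so the total exponent `∑ (1 + |A s|)` is at least `p + |L|`,
      -- and this dominates twice the number of distinct labels.
      refine mul_le_mul_of_nonneg_left (pow_le_pow_of_le_one hψ0.le hψ1 ?_) (by positivity)
      refine (two_mul_card_image_le k).trans ?_
      rw [Finset.sum_add_distrib, Finset.sum_const, Finset.card_univ, Fintype.card_fin,
        smul_eq_mul, mul_one]
      refine Nat.add_le_add_left ?_ p
      refine (Finset.card_le_card (t := Finset.univ.biUnion A) fun l hl => ?_).trans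
        Finset.card_biUnion_le
      obtain ⟨s, hs⟩ := hcov l hl
      exact Finset.mem_biUnion.mpr ⟨s, Finset.mem_univ _, hs⟩
  rw [hint]
  refine (norm_sum_le _ _).trans ((Finset.sum_le_card_nsmul _ _ _ hterm).trans ?_)
  rw [nsmul_eq_mul, mul_assoc ((2 ^ p) ^ p : ℝ)]
  refine mul_le_mul_of_nonneg_right ?_ (by positivity)
  rw [Fintype.card_piFinset]
  -- The number of terms in the expansion: `p` factors with at most `2 ^ p` subsets each.
  have : ∏ s : Fin p, ((L.erase (k s)).powerset).card ≤ ∏ _s : Fin p, 2 ^ p := by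
    refine Finset.prod_le_prod' fun s _ => ?_
    rw [Finset.card_powerset]
    exact Nat.pow_le_pow_right (by norm_num)
      ((Finset.card_le_card (Finset.erase_subset _ _)).trans hLcard)
  rw [Finset.prod_const, Finset.card_univ, Fintype.card_fin] at this
  exact_mod_cast this

end ProductExpectation

/-! ### High moments of weighted sums of fluctuations -/

section WeightedSum

variable {N : ℕ} {Ω : Type*} {mΩ : MeasurableSpace Ω} {P : Measure Ω}
  {H : Ω → Matrix (Fin N) (Fin N) ℂ} {δ : ℝ} {ν : ℕ → ℝ}

theorem AllMemLp.conj {f : Ω → ℂ} (hf : AllMemLp P f) : AllMemLp P fun ω => starRingEnd ℂ (f ω) :=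
  hf.of_norm_le (Complex.continuous_conj.comp_aestronglyMeasurable
    hf.integrable.aestronglyMeasurable) fun ω => by simp

theorem fluct_conj {f : Ω → ℂ} (hf : Integrable f P) (k : Fin N) :
    fluct P H k (fun ω => starRingEnd ℂ (f ω)) =ᵐ[P] fun ω => starRingEnd ℂ (fluct P H k f ω) := by
  have h := (Complex.conjCLE : ℂ →L[ℝ] ℂ).comp_condExp_comm hf (m := minorAlg H k)
  filter_upwards [h] with ω hω
  simp only [fluct, partialExp_def, map_sub]
  congr 1
  exact hω.symm

theorem setDiff_conj {α : Type*} [DecidableEq α] (A C : Finset α) (F : Finset α → ℂ) :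
    setDiff A (fun D => starRingEnd ℂ (F D)) C = starRingEnd ℂ (setDiff A F C) := by
  simp [setDiff]

theorem prod_ite_lt_eq (q : ℕ) (w : ℂ) :
    ∏ s : Fin (2 * q), (if s.1 < q then w else starRingEnd ℂ w) = ((‖w‖ ^ (2 * q) : ℝ) : ℂ) := by
  rw [Fin.prod_univ_eq_prod_range (fun s => if s < q then w else starRingEnd ℂ w) (2 * q), two_mul,
    Finset.prod_range_add, Finset.prod_congr rfl (g := fun _ => w) fun s hs => by
      rw [if_pos (Finset.mem_range.mp hs)],
    Finset.prod_congr rfl (s₁ := Finset.range q) (f := fun s => if q + s < q then w else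
      starRingEnd ℂ w) (g := fun _ => starRingEnd ℂ w) fun s hs => by
      rw [if_neg (by omega)]]
  rw [Finset.prod_const, Finset.prod_const, Finset.card_range, ← mul_pow, Complex.mul_conj']
  push_cast
  ring

/-- The moments of a weighted sum of fluctuations. -/
theorem integral_norm_sum_fluct_pow_le [IsProbabilityMeasure P]
    (hM : IsRandomMatrixModel δ ν P H) {q : ℕ} (hq : q ≠ 0)
    {X : Fin N → Finset (Fin N) → Ω → ℂ}
    (hmeas : ∀ k C, ∀ a ∈ C, Measurable[minorAlg H a] (X k C))
    (hLp : ∀ k C, AllMemLp P (X k C)) {K ψ : ℝ} (hK : 1 ≤ K) (hψ0 : 0 < ψ) (hψ1 : ψ ≤ 1)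
    (hb : ∀ k A C, Disjoint A C → k ∉ A → k ∉ C → A.card + C.card ≤ 2 * q →
      ∫ ω, ‖setDiff A (fun D => X k D ω) C‖ ^ (2 * q) ∂P ≤ (K * ψ ^ (1 + A.card)) ^ (2 * q))
    {t : Fin N → ℂ} (ht : ∀ k, ‖t k‖ ≤ ψ ^ 2) (ht' : ∑ k, ‖t k‖ ≤ 1) :
    ∫ ω, ‖∑ k, t k * fluct P H k (X k ∅) ω‖ ^ (2 * q) ∂P ≤
      (2 ^ (2 * q)) ^ (2 * q) * ((2 * q : ℕ) * (2 * K) ^ (2 * q)) * (2 * q).factorial *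
        (ψ ^ 2) ^ (2 * q) := by
  -- Write `‖w‖^(2q)` as `w^q` times its conjugate; the slots `s ≥ q` carry the conjugation, which
  -- commutes with `Q_k` and with differences.
  set c : Fin (2 * q) → ℂ → ℂ := fun s w => if s.1 < q then w else starRingEnd ℂ w with hc
  have hcn : ∀ s w, ‖c s w‖ = ‖w‖ := fun s w => by
    simp only [hc]; split_ifs <;> simp
  have hcm : ∀ s a b, c s (a * b) = c s a * c s b := fun s a b => by
    simp only [hc]; split_ifs <;> simp
  have hcs : ∀ s (f : Fin N → ℂ), c s (∑ k, f k) = ∑ k, c s (f k) := fun s f => by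
    simp only [hc]; split_ifs <;> simp
  have hcmeas : ∀ s, Measurable (c s) := fun s => by
    simp only [hc]
    split_ifs
    · exact measurable_id
    · exact Complex.continuous_conj.measurable
  have hcLp : ∀ s (f : Ω → ℂ), AllMemLp P f → AllMemLp P fun ω => c s (f ω) := fun s f hf => by
    simp only [hc]
    split_ifs
    · exact hf
    · exact hf.conj
  have hcfl : ∀ s k (f : Ω → ℂ), AllMemLp P f →
      fluct P H k (fun ω => c s (f ω)) =ᵐ[P] fun ω => c s (fluct P H k f ω) := fun s k f hf => by
    simp only [hc]
    split_ifs
    · exact Filter.EventuallyEq.rfl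
    · exact fluct_conj hf.integrable k
  set X' : Fin (2 * q) → Fin N → Finset (Fin N) → Ω → ℂ := fun s k C ω => c s (X k C ω) with hX'
  have hX'Lp : ∀ s k C, AllMemLp P (X' s k C) := fun s k C => hcLp s _ (hLp k C)
  have hae : ∀ᵐ ω ∂P, ∀ s k, fluct P H k (X' s k ∅) ω = c s (fluct P H k (X k ∅) ω) := by
    rw [ae_all_iff]; intro s
    rw [ae_all_iff]; intro k
    exact hcfl s k _ (hLp k ∅)
  have hprodint : ∀ k : Fin (2 * q) → Fin N,
      Integrable (fun ω => ∏ s, fluct P H (k s) (X' s (k s) ∅) ω) P := fun k =>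
    (AllMemLp.prod fun s _ => (hX'Lp s (k s) ∅).fluct (k s)).integrable
  have hexp : ((∫ ω, ‖∑ k, t k * fluct P H k (X k ∅) ω‖ ^ (2 * q) ∂P : ℝ) : ℂ) =
      ∑ k : Fin (2 * q) → Fin N, (∏ s, c s (t (k s))) *
        ∫ ω, ∏ s, fluct P H (k s) (X' s (k s) ∅) ω ∂P := by
    rw [← integral_complex_ofReal]
    simp_rw [← integral_const_mul]
    rw [← integral_finsetSum _ fun k _ => (hprodint k).const_mul _]
    refine integral_congr_ae (hae.mono fun ω hω => ?_)
    simp only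
    rw [← prod_ite_lt_eq]
    change ∏ s, c s (∑ k, t k * fluct P H k (X k ∅) ω) = _
    simp_rw [hcs, hcm, ← hω]
    rw [Finset.prod_univ_sum, Fintype.piFinset_univ]
    refine Finset.sum_congr rfl fun k _ => ?_
    rw [Finset.prod_mul_distrib]
  have hnn : 0 ≤ ∫ ω, ‖∑ k, t k * fluct P H k (X k ∅) ω‖ ^ (2 * q) ∂P :=
    integral_nonneg fun ω => by positivity
  rw [← Complex.norm_of_nonneg hnn, hexp]
  set Kc : ℝ := (2 ^ (2 * q)) ^ (2 * q) * ((2 * q : ℕ) * (2 * K) ^ (2 * q)) with hKc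
  have hKc0 : 0 ≤ Kc := by positivity
  have hterm : ∀ k : Fin (2 * q) → Fin N, ‖(∏ s, c s (t (k s))) *
        ∫ ω, ∏ s, fluct P H (k s) (X' s (k s) ∅) ω ∂P‖ ≤
      Kc * ((∏ s, ‖t (k s)‖) * (ψ ^ 2) ^ (Finset.univ.image k).card) := by
    intro k
    rw [norm_mul, norm_prod]
    simp_rw [hcn]
    have := norm_integral_prod_fluct_le hM (p := 2 * q) (by omega) k
      (X := fun s => X' s (k s)) (fun s C a ha => (hcmeas s).comp (hmeas (k s) C a ha))
      (fun s C => hX'Lp s (k s) C) hK hψ0 hψ1 (fun s A C hd hA hC hcard => by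
        refine le_trans (le_of_eq ?_) (hb (k s) A C hd hA hC hcard)
        refine integral_congr_ae (Filter.Eventually.of_forall fun ω => ?_)
        simp only [hX', hc]
        split_ifs
        · rfl
        · rw [setDiff_conj]; simp)
    calc _ ≤ (∏ s, ‖t (k s)‖) * (Kc * (ψ ^ 2) ^ (Finset.univ.image k).card) :=
          mul_le_mul_of_nonneg_left this (Finset.prod_nonneg fun _ _ => norm_nonneg _)
      _ = _ := by ring
  refine (norm_sum_le _ _).trans ((Finset.sum_le_sum fun k _ => hterm k).trans ?_)
  rw [← Finset.mul_sum, mul_assoc Kc]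
  refine mul_le_mul_of_nonneg_left ?_ hKc0
  exact sum_prod_mul_pow_card_image_le (fun i => norm_nonneg _) ht ht' (by positivity) (2 * q)

end WeightedSum

/-! ### Measurability of resolvent entries -/

section Measurability

variable {N : ℕ} {Ω : Type*} {m : MeasurableSpace Ω}

theorem measurable_det {B : Ω → Matrix (Fin N) (Fin N) ℂ}
    (hB : ∀ i j, Measurable fun ω => B ω i j) : Measurable fun ω => (B ω).det := by
  simp only [Matrix.det_apply]
  exact Finset.measurable_fun_sum _ fun σ _ =>
    (Finset.measurable_fun_prod _ fun i _ => hB _ _).const_smul _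

/-- Cramer's rule expresses the entries of the inverse through determinants, which are polynomials
in the entries. -/
theorem measurable_inv_apply {B : Ω → Matrix (Fin N) (Fin N) ℂ}
    (hB : ∀ i j, Measurable fun ω => B ω i j) (i j : Fin N) :
    Measurable fun ω => (B ω)⁻¹ i j := by
  simp only [Matrix.inv_def, Matrix.smul_apply, smul_eq_mul, Ring.inverse_eq_inv',
    Matrix.adjugate_apply]
  refine (measurable_det hB).inv.mul (measurable_det fun a b => ?_)
  simp only [Matrix.updateRow_apply]
  split_ifs
  · exact measurable_const
  · exact hB a b

theorem measurable_green {B : Ω → Matrix (Fin N) (Fin N) ℂ}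
    (hB : ∀ i j, Measurable fun ω => B ω i j) (z : ℂ) (i j : Fin N) :
    Measurable fun ω => green (B ω) z i j :=
  measurable_inv_apply (fun a b => (hB a b).sub_const _) i j

theorem measurable_lambda {B : Ω → Matrix (Fin N) (Fin N) ℂ}
    (hB : ∀ i j, Measurable fun ω => B ω i j) (z : ℂ) : Measurable fun ω => lambda (B ω) z := by
  refine Measurable.max ?_ ?_
  · exact Measurable.iSup fun p => (measurable_green hB z _ _).norm
  · exact Measurable.iSup fun p => ((measurable_green hB z _ _).sub_const _).norm

theorem measurable_minorSet_apply {B : Ω → Matrix (Fin N) (Fin N) ℂ}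
    (hB : ∀ i j, Measurable fun ω => B ω i j) (C : Finset (Fin N)) (i j : Fin N) :
    Measurable fun ω => minorSet (B ω) C i j := by
  simp only [minorSet, Matrix.of_apply]
  split_ifs
  · exact measurable_const
  · exact hB i j

theorem measurable_minorAlg_minor (H : Ω → Matrix (Fin N) (Fin N) ℂ) (k i j : Fin N) :
    Measurable[minorAlg H k] fun ω => minor (H ω) k i j :=
  (measurable_pi_apply (i, j)).comp
    (comap_measurable fun (ω : Ω) (p : Fin N × Fin N) => minor (H ω) k p.1 p.2)

theorem measurable_minorAlg_green (H : Ω → Matrix (Fin N) (Fin N) ℂ) (z : ℂ)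
    {C : Finset (Fin N)} {a : Fin N} (ha : a ∈ C) (i j : Fin N) :
    Measurable[minorAlg H a] fun ω => green (minorSet (H ω) C) z i j := by
  refine @measurable_green N Ω (minorAlg H a) _ (fun i j => ?_) z i j
  have h : (fun ω => minorSet (H ω) C i j) = fun ω => minorSet (minor (H ω) a) C i j := by
    funext ω
    rw [minorSet_minor ha]
  rw [h]
  exact @measurable_minorSet_apply N Ω (minorAlg H a) _
    (fun i j => measurable_minorAlg_minor H a i j) C i j

end Measurability

/-! ### Moments of the matrix entries -/

section ModelMoments

variable {N : ℕ} {Ω : Type*} {mΩ : MeasurableSpace Ω} {P : Measure Ω}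
  {H : Ω → Matrix (Fin N) (Fin N) ℂ} {δ : ℝ} {ν : ℕ → ℝ}

theorem variances_nonneg (i j : Fin N) : 0 ≤ variances P H i j :=
  integral_nonneg fun _ => by positivity

theorem variances_le_inv_bigM (i j : Fin N) : variances P H i j ≤ (bigM P H)⁻¹ := by
  rw [bigM, one_div, inv_inv]
  exact le_ciSup (f := fun p : Fin N × Fin N => variances P H p.1 p.2)
    (Set.finite_range _).bddAbove (i, j)

namespace IsRandomMatrixModel

theorem variances_le_one (hM : IsRandomMatrixModel δ ν P H) (i j : Fin N) :
    variances P H i j ≤ 1 := by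
  rw [← hM.stochastic i]
  exact Finset.single_le_sum (f := fun j => variances P H i j)
    (fun j _ => variances_nonneg i j) (Finset.mem_univ j)

theorem variances_symm (hM : IsRandomMatrixModel δ ν P H) (i j : Fin N) :
    variances P H i j = variances P H j i := by
  simp only [variances, Matrix.of_apply]
  refine integral_congr_ae (Filter.Eventually.of_forall fun ω => ?_)
  have : H ω i j = star (H ω j i) := by
    have := congrFun (congrFun (hM.hermitian ω) i) j
    simpa using this.symm
  simp only [this, norm_star]

theorem bigM_pos (hM : IsRandomMatrixModel δ ν P H) (hN : 0 < N) : 0 < bigM P H :=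
  (Real.rpow_pos_of_pos (by exact_mod_cast hN) _).trans_le hM.lower_M

theorem allMemLp_entry (hM : IsRandomMatrixModel δ ν P H) (i j : Fin N) :
    AllMemLp P fun ω => H ω i j := fun q => hM.memLp i j q

/-- As `s_ij ≤ 1`, dividing by `√s_ij` only enlarges the entry. If `s_ij = 0`, the entry vanishes
almost surely and its moments of positive order are zero. -/
theorem integral_norm_entry_pow_le (hM : IsRandomMatrixModel δ ν P H) (i j : Fin N) {n : ℕ}
    (hn : n ≠ 0) : ∫ ω, ‖H ω i j‖ ^ n ∂P ≤ ν n := by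
  refine le_trans ?_ (hM.moments n i j)
  rcases (variances_nonneg (P := P) (H := H) i j).eq_or_lt with h0 | h0
  · have hint : Integrable (fun ω => ‖H ω i j‖ ^ 2) P :=
      (hM.allMemLp_entry i j).integrable_norm_pow two_ne_zero
    have h1 : (fun ω => ‖H ω i j‖ ^ 2) =ᵐ[P] 0 :=
      (integral_eq_zero_iff_of_nonneg (fun ω => by positivity) hint).mp h0.symm
    have h2 : ∫ ω, ‖H ω i j‖ ^ n ∂P = 0 := by
      rw [integral_eq_zero_of_ae]
      filter_upwards [h1] with ω hω
      have : ‖H ω i j‖ = 0 := by simpa using hω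
      simp [this, hn]
    rw [h2]
    exact integral_nonneg fun _ => by positivity
  · have hle := hM.variances_le_one i j
    have hs : 1 ≤ (Real.sqrt (variances P H i j))⁻¹ :=
      (one_le_inv₀ (Real.sqrt_pos.mpr h0)).mpr (Real.sqrt_le_one.mpr hle)
    have hz : AllMemLp P (zeta P H i j) := (hM.allMemLp_entry i j).const_mul _
    refine integral_mono ((hM.allMemLp_entry i j).integrable_norm_pow hn)
      (hz.integrable_norm_pow hn) fun ω => ?_
    refine pow_le_pow_left₀ (norm_nonneg _) ?_ n
    rw [zeta, norm_mul, Complex.norm_real, Real.norm_of_nonneg (zero_le_one.trans hs)]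
    exact le_mul_of_one_le_left (norm_nonneg _) hs

theorem allMemLp_entrySum [IsProbabilityMeasure P] (hM : IsRandomMatrixModel δ ν P H) :
    AllMemLp P fun ω => (entrySum (H ω) : ℂ) := by
  have h : ∀ p : Fin N × Fin N, AllMemLp P fun ω => ((‖H ω p.1 p.2‖ : ℝ) : ℂ) := fun p =>
    (hM.allMemLp_entry p.1 p.2).of_norm_le (Complex.continuous_ofReal.comp_aestronglyMeasurable
      (hM.allMemLp_entry p.1 p.2).integrable.aestronglyMeasurable.norm) fun ω => by simp
  have := (AllMemLp.const (P := P) 1).add (AllMemLp.sum (s := Finset.univ) fun p _ => h p)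
  simpa [entrySum] using this

/-- The power mean inequality over `N²` entries. Polynomial growth in `N` is enough, since the bound
is played off against a probability smaller by a prescribed power. -/
theorem integral_entrySum_pow_le [IsProbabilityMeasure P] (hM : IsRandomMatrixModel δ ν P H)
    (hN : (1 : ℝ) ≤ N) {n : ℕ} (hn : n ≠ 0) :
    ∫ ω, entrySum (H ω) ^ n ∂P ≤ 2 ^ n * (1 + |ν n|) * (N : ℝ) ^ (2 * n) := by
  obtain ⟨n, rfl⟩ := Nat.exists_eq_succ_of_ne_zero hn
  rw [Nat.succ_eq_add_one] at *
  have hint : ∀ p : Fin N × Fin N, Integrable (fun ω => ‖H ω p.1 p.2‖ ^ (n + 1)) P := fun p =>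
    (hM.allMemLp_entry p.1 p.2).integrable_norm_pow hn
  have hsint : Integrable (fun ω => ∑ p : Fin N × Fin N, ‖H ω p.1 p.2‖ ^ (n + 1)) P :=
    integrable_finsetSum _ fun p _ => hint p
  have hcard : ((Finset.univ : Finset (Fin N × Fin N)).card : ℝ) = (N : ℝ) ^ 2 := by
    simp [sq]
  have hN0 : (0 : ℝ) < (N : ℝ) ^ 2 := by positivity
  have hpt : ∀ ω, entrySum (H ω) ^ (n + 1) ≤ 2 ^ n * (1 + ((N : ℝ) ^ 2) ^ n *
      ∑ p : Fin N × Fin N, ‖H ω p.1 p.2‖ ^ (n + 1)) := by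
    intro ω
    have h1 := add_pow_le (zero_le_one (α := ℝ)) (Finset.sum_nonneg
      (s := (Finset.univ : Finset (Fin N × Fin N)))
      (f := fun p => ‖H ω p.1 p.2‖) fun p _ => norm_nonneg _) (n + 1)
    have h2 := pow_sum_div_card_le_sum_pow (s := (Finset.univ : Finset (Fin N × Fin N)))
      (f := fun p => ‖H ω p.1 p.2‖) (fun p _ => norm_nonneg _) n
    rw [hcard, div_le_iff₀ (pow_pos hN0 n)] at h2
    rw [one_pow, Nat.add_sub_cancel] at h1
    refine h1.trans (mul_le_mul_of_nonneg_left ?_ (by positivity))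
    linarith
  calc ∫ ω, entrySum (H ω) ^ (n + 1) ∂P
      ≤ ∫ ω, 2 ^ n * (1 + ((N : ℝ) ^ 2) ^ n *
          ∑ p : Fin N × Fin N, ‖H ω p.1 p.2‖ ^ (n + 1)) ∂P :=
        integral_mono_of_nonneg (Filter.Eventually.of_forall fun ω =>
          pow_nonneg (zero_le_one.trans one_le_entrySum) _)
          (((integrable_const _).add (hsint.const_mul _)).const_mul _)
          (Filter.Eventually.of_forall hpt)
    _ = 2 ^ n * (1 + ((N : ℝ) ^ 2) ^ n *
          ∑ p : Fin N × Fin N, ∫ ω, ‖H ω p.1 p.2‖ ^ (n + 1) ∂P) := by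
        rw [integral_const_mul, integral_add (integrable_const _) (hsint.const_mul _),
          integral_const_mul, integral_finsetSum _ fun p _ => hint p]
        simp
    _ ≤ 2 ^ n * (1 + ((N : ℝ) ^ 2) ^ n * ∑ _p : Fin N × Fin N, |ν (n + 1)|) := by
        have : ∀ p : Fin N × Fin N, ∫ ω, ‖H ω p.1 p.2‖ ^ (n + 1) ∂P ≤ |ν (n + 1)| := fun p =>
          (hM.integral_norm_entry_pow_le p.1 p.2 hn).trans (le_abs_self _)
        gcongr
        exact this _
    _ = 2 ^ n * (1 + |ν (n + 1)| * (N : ℝ) ^ (2 * (n + 1))) := by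
        rw [Finset.sum_const, nsmul_eq_mul, hcard]
        ring
    _ ≤ _ := by
        have h1 : (1 : ℝ) ≤ (N : ℝ) ^ (2 * (n + 1)) := one_le_pow₀ hN
        have h2 := abs_nonneg (ν (n + 1))
        have h3 : 1 + |ν (n + 1)| * (N : ℝ) ^ (2 * (n + 1)) ≤
          (1 + |ν (n + 1)|) * (N : ℝ) ^ (2 * (n + 1)) := by nlinarith
        have h4 : (2 : ℝ) ^ n ≤ 2 ^ (n + 1) := pow_le_pow_right₀ (by norm_num) (by omega)
        rw [mul_assoc]
        gcongr

end IsRandomMatrixModel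

/-- The `p`-th moment of a random variable which is at most `a` with high probability. -/
theorem integral_norm_pow_le_of_good [IsProbabilityMeasure P] {W : Ω → ℂ} (hW : AllMemLp P W)
    {p : ℕ} (hp : p ≠ 0) {bad : Set Ω} (hbad : MeasurableSet bad) {a θ : ℝ} (ha : 0 ≤ a)
    (hθ : 0 < θ) (hgood : ∀ ω ∉ bad, ‖W ω‖ ≤ a) :
    ∫ ω, ‖W ω‖ ^ p ∂P ≤ a ^ p + θ * ∫ ω, ‖W ω‖ ^ (2 * p) ∂P + θ⁻¹ * P.real bad := by
  have hi : Integrable (fun ω => ‖W ω‖ ^ (2 * p)) P := hW.integrable_norm_pow (by omega)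
  have hb : Integrable (bad.indicator fun _ => (1 : ℝ)) P :=
    (integrable_const _).indicator hbad
  have hi' : Integrable (fun ω => a ^ p + θ * ‖W ω‖ ^ (2 * p)) P :=
    (integrable_const _).add (hi.const_mul _)
  calc _ ≤ ∫ ω, (a ^ p + θ * ‖W ω‖ ^ (2 * p) + θ⁻¹ * bad.indicator (fun _ => (1 : ℝ)) ω) ∂P := by
        refine integral_mono (hW.integrable_norm_pow hp) (hi'.add (hb.const_mul _)) fun ω => ?_
        simp only
        have h0 : 0 ≤ θ * ‖W ω‖ ^ (2 * p) := by positivity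
        have h1 : 0 ≤ a ^ p := by positivity
        by_cases hω : ω ∈ bad
        · rw [Set.indicator_of_mem hω, mul_one, pow_mul', sq]
          rw [pow_mul', sq] at h0
          set x := ‖W ω‖ ^ p
          have h2 : θ * θ⁻¹ = 1 := mul_inv_cancel₀ hθ.ne'
          have h3 : 0 < θ⁻¹ := inv_pos.mpr hθ
          -- Young's inequality, from `(θ x - 1)² ≥ 0`; it takes the place of Cauchy–Schwarz on the
          -- bad event and leaves `θ` free.
          have h4 : x ≤ θ * (x * x) + θ⁻¹ := by
            have h5 := mul_nonneg h3.le (sq_nonneg (θ * x - 1))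
            have h6 : θ⁻¹ * (θ * x - 1) ^ 2 = θ * (x * x) - 2 * x + θ⁻¹ := by
              field_simp
              ring
            have hx : 0 ≤ x := by positivity
            linarith
          linarith
        · have := pow_le_pow_left₀ (norm_nonneg _) (hgood ω hω) p
          rw [Set.indicator_of_notMem hω]
          linarith
    _ = _ := by
        rw [integral_add hi' (hb.const_mul _), integral_add (integrable_const _) (hi.const_mul _),
          integral_const_mul, integral_const_mul, integral_indicator hbad]
        simp

end ModelMoments

/-! ### Fluctuation averaging in moments, at fixed matrix size -/

section FixedSize

variable {N : ℕ} {Ω : Type*} {mΩ : MeasurableSpace Ω} {P : Measure Ω}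
  {H : Ω → Matrix (Fin N) (Fin N) ℂ} {δ : ℝ} {ν : ℕ → ℝ}

/-- The constant in the crude bound on the `2p`-th moments of finite differences. -/
noncomputable def crudeConst (ν : ℕ → ℝ) (p : ℕ) : ℝ :=
  (2 ^ p * 43) ^ (2 * p) * (2 ^ (4 * p) * (1 + |ν (4 * p)|))

/-- The constant in the bound on the `p`-th moments of finite differences. -/
noncomputable def diffMomentConst (ν : ℕ → ℝ) (p : ℕ) : ℝ :=
  diffConst (882 * 2 ^ p) (p + 1) + (crudeConst ν p + 1)

theorem one_le_crudeConst_add (ν : ℕ → ℝ) (p : ℕ) : 1 ≤ crudeConst ν p + 1 := by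
  have : 0 ≤ crudeConst ν p := by unfold crudeConst; positivity
  linarith

theorem diffConst_pos (p b : ℕ) : 0 ≤ diffConst (882 * 2 ^ p) b :=
  le_trans (by positivity) (le_diffConst (by positivity) b)

theorem one_le_diffMomentConst (ν : ℕ → ℝ) (p : ℕ) : 1 ≤ diffMomentConst ν p :=
  (one_le_crudeConst_add ν p).trans (le_add_of_nonneg_left (diffConst_pos p _))

/-- Functionals of the minors that fluctuate like the centred diagonal resolvent entries. -/
structure IsDiagonalFamily {Ω : Type*} [MeasurableSpace Ω] (H : Ω → Matrix (Fin N) (Fin N) ℂ) (z : ℂ)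
    (X : Fin N → Finset (Fin N) → Ω → ℂ) : Prop where
  measurable : ∀ k C, Measurable (X k C)
  measurable_minor : ∀ k C, ∀ a ∈ C, Measurable[minorAlg H a] (X k C)
  crude : ∀ k C ω, ‖X k C ω‖ ≤ 43 * N * entrySum (H ω) ^ 2
  diffBound : ∀ (p : ℕ) (ψ : ℝ), 0 ≤ ψ → 2 ^ p * ψ ≤ 1 / 42 → ∀ ω, lambda (H ω) z ≤ ψ →
    ∀ (S : Finset (Fin N)) (k : Fin N), S.card ≤ p → k ∉ S →
      DiffBound ψ (diffConst (882 * 2 ^ p) (p + 1)) S (p + 1) 1 (fun C => X k C ω)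

namespace IsDiagonalFamily

variable {z : ℂ} {X : Fin N → Finset (Fin N) → Ω → ℂ}

theorem allMemLp [IsProbabilityMeasure P] (hX : IsDiagonalFamily H z X)
    (hM : IsRandomMatrixModel δ ν P H) (k : Fin N) (C : Finset (Fin N)) : AllMemLp P (X k C) := by
  refine ((hM.allMemLp_entrySum.mul hM.allMemLp_entrySum).const_mul
    ((43 * N : ℝ) : ℂ)).of_norm_le (hX.measurable k C).aestronglyMeasurable fun ω => ?_
  refine (hX.crude k C ω).trans (le_of_eq ?_)
  rw [norm_mul, norm_mul, Complex.norm_real, Complex.norm_real,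
    Real.norm_of_nonneg (zero_le_one.trans one_le_entrySum), Real.norm_of_nonneg (by positivity)]
  ring

/-- The moments of the finite differences. -/
theorem integral_norm_setDiff_pow_le [IsProbabilityMeasure P] (hX : IsDiagonalFamily H z X)
    (hM : IsRandomMatrixModel δ ν P H) (hN : (1 : ℝ) ≤ N) {p : ℕ} (hp : p ≠ 0) {ψ : ℝ}
    (hψ0 : 0 < ψ) (hψ : 2 ^ p * ψ ≤ 1 / 42) (hψN : 1 ≤ N * ψ ^ 2)
    (hbad : P.real {ω | ψ < lambda (H ω) z} ≤ ((N : ℝ) ^ (10 * p + (1 + p) * p))⁻¹)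
    {k : Fin N} {A C : Finset (Fin N)} (hAC : Disjoint A C) (hA : k ∉ A) (hC : k ∉ C)
    (hcard : A.card + C.card ≤ p) :
    ∫ ω, ‖setDiff A (fun D => X k D ω) C‖ ^ p ∂P ≤
      (diffMomentConst ν p * ψ ^ (1 + A.card)) ^ p := by
  set W : Ω → ℂ := fun ω => setDiff A (fun D => X k D ω) C with hW
  have hWLp : AllMemLp P W := AllMemLp.setDiff (fun C => hX.allMemLp hM k C) A C
  have h2p : (1 : ℝ) ≤ 2 ^ p := one_le_pow₀ (by norm_num)
  have hψ1 : ψ ≤ 1 := by nlinarith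
  have hN0 : (0 : ℝ) < N := by linarith
  have hbm : MeasurableSet {ω | ψ < lambda (H ω) z} :=
    measurableSet_lt measurable_const (measurable_lambda hM.measurable z)
  have hKd := diffConst_pos p (p + 1)
  have hgood : ∀ ω ∉ {ω | ψ < lambda (H ω) z},
      ‖W ω‖ ≤ diffConst (882 * 2 ^ p) (p + 1) * ψ ^ (1 + A.card) := by
    intro ω hω
    refine hX.diffBound p ψ hψ0.le hψ ω (not_lt.mp hω) (A ∪ C) k ?_ ?_ A C
      Finset.subset_union_left Finset.subset_union_right hAC (by omega)
    · rwa [Finset.card_union_of_disjoint hAC]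
    · simp [hA, hC]
  -- The power of `N` cancels the growth of the crude moment bound. The power of `ψ` is the smallest
  -- possible target, reached at `A.card = p`.
  set θ : ℝ := ((N : ℝ) ^ (10 * p))⁻¹ * ψ ^ ((1 + p) * p) with hθ
  have hθ0 : 0 < θ := by positivity
  have hmain := integral_norm_pow_le_of_good hWLp hp hbm (by positivity) hθ0 hgood
  have hcr : ∫ ω, ‖W ω‖ ^ (2 * p) ∂P ≤ crudeConst ν p * (N : ℝ) ^ (10 * p) := by
    have hpt : ∀ ω, ‖W ω‖ ^ (2 * p) ≤
        (2 ^ p * 43) ^ (2 * p) * (N : ℝ) ^ (2 * p) * entrySum (H ω) ^ (4 * p) := by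
      intro ω
      have h1 : ‖W ω‖ ≤ 2 ^ A.card * (43 * N * entrySum (H ω) ^ 2) :=
        norm_setDiff_le fun D _ => hX.crude k _ ω
      have h2 : ‖W ω‖ ≤ 2 ^ p * (43 * N * entrySum (H ω) ^ 2) :=
        h1.trans (mul_le_mul_of_nonneg_right
          (pow_le_pow_right₀ (by norm_num) (by omega)) (by positivity))
      refine (pow_le_pow_left₀ (norm_nonneg _) h2 _).trans (le_of_eq ?_)
      rw [show 4 * p = 2 * (2 * p) by ring, pow_mul (entrySum (H ω)) 2, ← mul_pow, ← mul_pow]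
      ring
    have hRint : Integrable (fun ω => entrySum (H ω) ^ (4 * p)) P := by
      have := hM.allMemLp_entrySum.integrable_norm_pow (q := 4 * p) (by omega)
      refine this.congr (Filter.Eventually.of_forall fun ω => ?_)
      simp only [Complex.norm_real, Real.norm_of_nonneg (zero_le_one.trans one_le_entrySum)]
    calc _ ≤ ∫ ω, (2 ^ p * 43) ^ (2 * p) * (N : ℝ) ^ (2 * p) * entrySum (H ω) ^ (4 * p) ∂P :=
          integral_mono (hWLp.integrable_norm_pow (by omega)) (hRint.const_mul _) hpt
      _ ≤ (2 ^ p * 43) ^ (2 * p) * (N : ℝ) ^ (2 * p) *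
          (2 ^ (4 * p) * (1 + |ν (4 * p)|) * (N : ℝ) ^ (2 * (4 * p))) := by
          rw [integral_const_mul]
          exact mul_le_mul_of_nonneg_left (hM.integral_entrySum_pow_le hN (by omega))
            (by positivity)
      _ = _ := by
          rw [crudeConst, show 10 * p = 2 * p + 2 * (4 * p) by ring, pow_add]
          ring
  have hT : θ * ∫ ω, ‖W ω‖ ^ (2 * p) ∂P ≤ crudeConst ν p * ψ ^ ((1 + p) * p) := by
    refine (mul_le_mul_of_nonneg_left hcr hθ0.le).trans (le_of_eq ?_)
    rw [hθ]
    field_simp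
  have hB : θ⁻¹ * P.real {ω | ψ < lambda (H ω) z} ≤ ψ ^ ((1 + p) * p) := by
    refine (mul_le_mul_of_nonneg_left hbad (by positivity)).trans ?_
    rw [hθ, mul_inv, inv_inv, pow_add, mul_inv]
    -- The lower bound `ψ² ≥ N⁻¹` converts the remaining power of `N` in the probability into powers
    -- of `ψ`.
    have h1 : ((N : ℝ) ^ ((1 + p) * p))⁻¹ ≤ (ψ ^ ((1 + p) * p)) ^ 2 := by
      rw [inv_le_iff_one_le_mul₀' (by positivity), ← pow_mul, mul_comm _ 2, pow_mul ψ, ← mul_pow]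
      exact one_le_pow₀ hψN
    calc _ = (ψ ^ ((1 + p) * p))⁻¹ * ((N : ℝ) ^ ((1 + p) * p))⁻¹ := by field_simp
      _ ≤ (ψ ^ ((1 + p) * p))⁻¹ * (ψ ^ ((1 + p) * p)) ^ 2 := by gcongr
      _ = _ := by field_simp
  have hψpow : ψ ^ ((1 + p) * p) ≤ (ψ ^ (1 + A.card)) ^ p := by
    rw [← pow_mul]
    exact pow_le_pow_of_le_one hψ0.le hψ1 (Nat.mul_le_mul_right _ (by omega))
  have hc1 := one_le_crudeConst_add ν p
  calc _ ≤ (diffConst (882 * 2 ^ p) (p + 1) * ψ ^ (1 + A.card)) ^ p +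
        (crudeConst ν p + 1) * ψ ^ ((1 + p) * p) := by linarith
    _ ≤ (diffConst (882 * 2 ^ p) (p + 1) * ψ ^ (1 + A.card)) ^ p +
        (crudeConst ν p + 1) ^ p * (ψ ^ (1 + A.card)) ^ p := by
        gcongr
        exact le_self_pow₀ hc1 hp
    _ = (diffConst (882 * 2 ^ p) (p + 1) * ψ ^ (1 + A.card)) ^ p +
        ((crudeConst ν p + 1) * ψ ^ (1 + A.card)) ^ p := by rw [mul_pow (crudeConst ν p + 1)]
    _ ≤ (diffConst (882 * 2 ^ p) (p + 1) * ψ ^ (1 + A.card) +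
        (crudeConst ν p + 1) * ψ ^ (1 + A.card)) ^ p :=
        pow_add_pow_le (by positivity) (by positivity) hp
    _ = _ := by rw [diffMomentConst, ← add_mul]

end IsDiagonalFamily

/-- The constant in the moment bound for weighted sums of fluctuations. -/
noncomputable def fluctConst (ν : ℕ → ℝ) (q : ℕ) : ℝ :=
  (2 ^ (2 * q)) ^ (2 * q) * ((2 * q : ℕ) * (2 * diffMomentConst ν (2 * q)) ^ (2 * q)) *
    (2 * q).factorial

/-- Moment form of fluctuation averaging at fixed matrix size. -/
theorem IsDiagonalFamily.integral_norm_sum_fluct_pow_le [IsProbabilityMeasure P] {z : ℂ}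
    {X : Fin N → Finset (Fin N) → Ω → ℂ} (hX : IsDiagonalFamily H z X)
    (hM : IsRandomMatrixModel δ ν P H) (hN : (1 : ℝ) ≤ N) {q : ℕ} (hq : q ≠ 0) {ψ : ℝ}
    (hψ0 : 0 < ψ) (hψ : 2 ^ (2 * q) * ψ ≤ 1 / 42) (hψN : 1 ≤ N * ψ ^ 2)
    (hbad : P.real {ω | ψ < lambda (H ω) z} ≤
      ((N : ℝ) ^ (10 * (2 * q) + (1 + 2 * q) * (2 * q)))⁻¹)
    {t : Fin N → ℂ} (ht : ∀ k, ‖t k‖ ≤ ψ ^ 2) (ht' : ∑ k, ‖t k‖ ≤ 1) :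
    ∫ ω, ‖∑ k, t k * fluct P H k (X k ∅) ω‖ ^ (2 * q) ∂P ≤
      fluctConst ν q * (ψ ^ 2) ^ (2 * q) := by
  have h2p : (1 : ℝ) ≤ 2 ^ (2 * q) := one_le_pow₀ (by norm_num)
  exact FluctAvg.integral_norm_sum_fluct_pow_le hM hq hX.measurable_minor (hX.allMemLp hM)
    (one_le_diffMomentConst ν (2 * q)) hψ0 (by nlinarith)
    (fun k A C hd hA hC hcard => hX.integral_norm_setDiff_pow_le hM hN (by omega) hψ0 hψ hψN hbad
      hd hA hC hcard) ht ht'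

theorem isDiagonalFamily_green (hM : IsRandomMatrixModel δ ν P H) {z : ℂ}
    (hN : (1 : ℝ) ≤ N) (hre : |z.re| ≤ 10) (hz : 0 < z.im) (him : z.im ≤ 10)
    (hzN : z.im⁻¹ ≤ N) :
    IsDiagonalFamily H z (fun k C ω => green (minorSet (H ω) C) z k k - mSC z) where
  measurable k C := (measurable_green (measurable_minorSet_apply hM.measurable C) z k k).sub_const _
  measurable_minor k _ _ ha := (measurable_minorAlg_green H z ha k k).sub_const _
  crude k C ω := (norm_green_diag_crude (hM.hermitian ω) hz (norm_le_of_re_im hre hz him)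
    (le_norm_mSC hre hz him) hN hzN C k).1
  diffBound _ _ hψ0 hψ ω hΛ _ _ hS hk := (diffBound_green (hM.hermitian ω) hz
    (le_norm_mSC hre hz him) hψ hψ0 hΛ hS hk).1

theorem isDiagonalFamily_inv_green (hM : IsRandomMatrixModel δ ν P H) {z : ℂ}
    (hN : (1 : ℝ) ≤ N) (hre : |z.re| ≤ 10) (hz : 0 < z.im) (him : z.im ≤ 10)
    (hzN : z.im⁻¹ ≤ N) :
    IsDiagonalFamily H z
      (fun k C ω => (green (minorSet (H ω) C) z k k)⁻¹ - (mSC z)⁻¹) where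
  measurable k C :=
    (measurable_green (measurable_minorSet_apply hM.measurable C) z k k).inv.sub_const _
  measurable_minor k _ _ ha := (measurable_minorAlg_green H z ha k k).inv.sub_const _
  crude k C ω := (norm_green_diag_crude (hM.hermitian ω) hz (norm_le_of_re_im hre hz him)
    (le_norm_mSC hre hz him) hN hzN C k).2
  diffBound _ _ hψ0 hψ ω hΛ _ _ hS hk := (diffBound_green (hM.hermitian ω) hz
    (le_norm_mSC hre hz him) hψ hψ0 hΛ hS hk).2

/-- Since `Q_k` annihilates constants, the centring at `m` or `m⁻¹`, needed for smallness of the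
moments, can be removed again. -/
theorem fluct_sub_const [IsProbabilityMeasure P] (hM : IsRandomMatrixModel δ ν P H) {f : Ω → ℂ}
    {c : ℂ} (hf : Integrable (fun ω => f ω - c) P) (k : Fin N) :
    fluct P H k (fun ω => f ω - c) =ᵐ[P] fluct P H k f := by
  have hf' : Integrable f P := by
    refine (hf.add (integrable_const c)).congr (Filter.Eventually.of_forall fun ω => ?_)
    simp
  have h := condExp_sub hf' (integrable_const c) (minorAlg H k)
  rw [condExp_const (hM.minorAlg_le k)] at h
  filter_upwards [h] with ω hω
  have hω' : P[fun ω => f ω - c | minorAlg H k] ω = P[f | minorAlg H k] ω - c := hω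
  simp only [fluct, partialExp_def, hω']
  ring

end FixedSize

/-! ### From moments to stochastic domination -/

section Asymptotics

theorem exists_nat_le_rpow {ε : ℝ} (hε : 0 < ε) (C : ℝ) :
    ∃ N₀ : ℕ, ∀ N : ℕ, N₀ ≤ N → C ≤ (N : ℝ) ^ ε := by
  have h := (tendsto_rpow_atTop hε).comp tendsto_natCast_atTop_atTop
  exact Filter.eventually_atTop.mp (h.eventually_ge_atTop C)

/-- The control parameter after multiplication by a small power of `N`. -/
theorem control_bounds {N : ℕ} (hN : 1 ≤ N) {M Ψ δ c ε : ℝ} (hc : 0 < c)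
    (hM1 : (N : ℝ) ^ δ ≤ M) (hM2 : M ≤ N)
    (h1 : M ^ (-(1 / 2) : ℝ) ≤ Ψ) (h2 : Ψ ≤ M ^ (-c)) (hε : 0 ≤ ε) (hεc : ε ≤ c * δ / 2) :
    0 < Ψ ∧ M⁻¹ ≤ Ψ ^ 2 ∧ Ψ ≤ (N : ℝ) ^ ε * Ψ ∧ (N : ℝ) ^ ε * Ψ ≤ (N : ℝ) ^ (-(c * δ / 2)) ∧
      1 ≤ N * ((N : ℝ) ^ ε * Ψ) ^ 2 := by
  have hN0 : (0 : ℝ) < N := by exact_mod_cast hN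
  have hN1 : (1 : ℝ) ≤ N := by exact_mod_cast hN
  have hM0 : 0 < M := (Real.rpow_pos_of_pos hN0 _).trans_le hM1
  have hΨ0 : 0 < Ψ := (Real.rpow_pos_of_pos hM0 _).trans_le h1
  have hMΨ : M⁻¹ ≤ Ψ ^ 2 := by
    have h3 : (M ^ (-(1 / 2) : ℝ)) ^ 2 = M⁻¹ := by
      rw [← Real.rpow_natCast, ← Real.rpow_mul hM0.le, ← Real.rpow_neg_one]
      norm_num
    rw [← h3]
    exact pow_le_pow_left₀ (Real.rpow_nonneg hM0.le _) h1 2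
  have hle : Ψ ≤ (N : ℝ) ^ ε * Ψ :=
    le_mul_of_one_le_left hΨ0.le (Real.one_le_rpow hN1 hε)
  refine ⟨hΨ0, hMΨ, hle, ?_, ?_⟩
  · have h3 : Ψ ≤ (N : ℝ) ^ (-(c * δ)) := by
      refine h2.trans ?_
      rw [Real.rpow_neg hM0.le, Real.rpow_neg hN0.le]
      refine inv_anti₀ (Real.rpow_pos_of_pos hN0 _) ?_
      rw [mul_comm, Real.rpow_mul hN0.le]
      exact Real.rpow_le_rpow (Real.rpow_nonneg hN0.le _) hM1 hc.le
    calc _ ≤ (N : ℝ) ^ ε * (N : ℝ) ^ (-(c * δ)) := by gcongr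
      _ = (N : ℝ) ^ (ε + -(c * δ)) := (Real.rpow_add hN0 _ _).symm
      _ ≤ _ := Real.rpow_le_rpow_of_exponent_le hN1 (by linarith)
  · have h4 : M⁻¹ ≤ ((N : ℝ) ^ ε * Ψ) ^ 2 := hMΨ.trans (pow_le_pow_left₀ hΨ0.le hle 2)
    have h5 : (N : ℝ)⁻¹ ≤ M⁻¹ := inv_anti₀ hM0 hM2
    calc (1 : ℝ) = N * (N : ℝ)⁻¹ := (mul_inv_cancel₀ hN0.ne').symm
      _ ≤ _ := mul_le_mul_of_nonneg_left (h5.trans h4) hN0.le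

variable {δ c : ℝ} {μ : ℕ → ℝ} {A : ℕ → Type*} {Ω : ∀ N, A N → Type*}
  [∀ N a, MeasurableSpace (Ω N a)] {P : ∀ N a, Measure (Ω N a)}
  {H : ∀ N a, Ω N a → Matrix (Fin N) (Fin N) ℂ}
  {Dom : ∀ N, A N → Set ℂ} {Ψ : ∀ N, A N → ℂ → ℝ} {T : ∀ N, A N → Matrix (Fin N) (Fin N) ℂ}

/-- A family of random matrix models on spectral domains, with a control parameter for `Λ`. -/
structure IsControlled (δ c : ℝ) (μ : ℕ → ℝ) (P : ∀ N a, Measure (Ω N a))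
    (H : ∀ N a, Ω N a → Matrix (Fin N) (Fin N) ℂ) (Dom : ∀ N, A N → Set ℂ)
    (Ψ : ∀ N, A N → ℂ → ℝ) : Prop where
  delta_pos : 0 < δ
  c_pos : 0 < c
  model : ∀ N a, IsRandomMatrixModel δ μ (P N a) (H N a)
  domain : ∀ N a, IsSpectralDomain (bigM (P N a) (H N a)) (Dom N a)
  control : ∀ N a, ∀ z ∈ Dom N a, (bigM (P N a) (H N a)) ^ (-(1 / 2) : ℝ) ≤ Ψ N a z ∧
    Ψ N a z ≤ (bigM (P N a) (H N a)) ^ (-c)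
  lambda_dom : StochDom P (U := fun N a => Dom N a)
    (fun N a z ω => lambda (H N a ω) z) (fun N a z _ => Ψ N a z)

/-- Weights that are bounded by `M⁻¹` and absolutely summable to at most one. -/
structure IsWeight (P : ∀ N a, Measure (Ω N a)) (H : ∀ N a, Ω N a → Matrix (Fin N) (Fin N) ℂ)
    (T : ∀ N, A N → Matrix (Fin N) (Fin N) ℂ) : Prop where
  le_inv : ∀ N a i k, ‖T N a i k‖ ≤ (bigM (P N a) (H N a))⁻¹
  sum_le : ∀ N a i, ∑ k, ‖T N a i k‖ ≤ 1

theorem IsControlled.domain_bounds (hC : IsControlled δ c μ P H Dom Ψ) {N : ℕ} (hN : 1 ≤ N)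
    (a : A N) {z : ℂ} (hz : z ∈ Dom N a) :
    |z.re| ≤ 10 ∧ 0 < z.im ∧ z.im ≤ 10 ∧ z.im⁻¹ ≤ N := by
  obtain ⟨h1, h2, h3⟩ := hC.domain N a z hz
  have hM0 := (hC.model N a).bigM_pos (by omega)
  have him : 0 < z.im := (inv_pos.mpr hM0).trans_le h2
  exact ⟨h1, him, h3, (inv_le_of_inv_le₀ hM0 h2).trans (hC.model N a).upper_M⟩

theorem StochDom.congr_ae {U : ∀ N, A N → Type*} {X X' Y : ∀ N a, U N a → Ω N a → ℝ}
    (h : StochDom P X Y) (hXX' : ∀ N a u, 1 ≤ N → X N a u =ᵐ[P N a] X' N a u) :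
    StochDom P X' Y := by
  intro ε hε D hD
  obtain ⟨N₀, hN₀⟩ := h ε hε D hD
  refine ⟨max 1 N₀, fun N hN a u => ?_⟩
  simp only [max_le_iff] at hN
  refine le_trans (le_of_eq ?_) (hN₀ N hN.2 a u)
  refine measureReal_congr ?_
  filter_upwards [hXX' N a u hN.1] with ω hω
  apply propext
  change _ < _ ↔ _ < _
  rw [hω]

variable [∀ N a, IsProbabilityMeasure (P N a)]

/-- Markov's inequality for the `2q`-th moment with `ψ = N^ε' Ψ`. The moment is at most a constant
times `N^(4qε') Ψ^(4q)`, the threshold contributes `N^(2qε) Ψ^(4q)`, and `4ε' ≤ ε` leaves the gain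
`N^(-qε)`. -/
theorem stochDom_sum_fluct (hC : IsControlled δ c μ P H Dom Ψ) (hT : IsWeight P H T)
    {X : ∀ N a, ℂ → Fin N → Finset (Fin N) → Ω N a → ℂ}
    (hX : ∀ N a, 1 ≤ N → ∀ z ∈ Dom N a, IsDiagonalFamily (H N a) z (X N a z)) :
    StochDom P (U := fun N a => Dom N a × Fin N)
      (fun N a u ω => ‖∑ k, T N a u.2 k * fluct (P N a) (H N a) k (X N a u.1 k ∅) ω‖)
      (fun N a u _ => Ψ N a u.1 ^ 2) := by
  intro ε hε D hD
  -- The gain `N^(-qε)` is to beat `N^(-D)` with one power of `N` to spare, which absorbs the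
  -- constant depending on `q`.
  obtain ⟨q, hq⟩ := exists_nat_ge ((D + 1) / ε)
  have hq0 : q ≠ 0 := by
    rintro rfl
    have : 0 < (D + 1) / ε := by positivity
    simp only [Nat.cast_zero] at hq
    linarith
  have hqε : D + 1 ≤ ε * q := by rw [div_le_iff₀ hε] at hq; linarith
  -- The first bound serves Markov's inequality. The second keeps `ψ ≤ N^(-cδ/2)`, so that `ψ` is
  -- small for large `N`.
  set ε' := min (ε / 4) (c * δ / 2) with hε'
  have hδ := hC.delta_pos
  have hc := hC.c_pos
  have hε'0 : 0 < ε' := lt_min (by positivity) (by positivity)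
  have hε'1 : ε' ≤ ε / 4 := min_le_left _ _
  have hε'2 : ε' ≤ c * δ / 2 := min_le_right _ _
  set e : ℕ := 10 * (2 * q) + (1 + 2 * q) * (2 * q) with he
  obtain ⟨N₁, hN₁⟩ := hC.lambda_dom ε' hε'0 e (by
    have : 0 < e := by rw [he]; positivity
    exact_mod_cast this)
  obtain ⟨N₂, hN₂⟩ := exists_nat_le_rpow (ε := c * δ / 2) (by positivity) (2 ^ (2 * q) * 42)
  obtain ⟨N₃, hN₃⟩ := exists_nat_ge (fluctConst μ q)
  refine ⟨max 1 (max N₁ (max N₂ N₃)), fun N hN a u => ?_⟩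
  simp only [max_le_iff] at hN
  obtain ⟨hNone, hNN₁, hNN₂, hNN₃⟩ := hN
  have hN0 : (0 : ℝ) < N := by exact_mod_cast hNone
  have hN1 : (1 : ℝ) ≤ N := by exact_mod_cast hNone
  obtain ⟨⟨z, hz⟩, i⟩ := u
  have hM := hC.model N a
  obtain ⟨hΨ1, hΨ2⟩ := hC.control N a z hz
  obtain ⟨hΨ0, hMΨ, hψle, hψsmall, hψN⟩ :=
    control_bounds hNone hc hM.lower_M hM.upper_M hΨ1 hΨ2 hε'0.le hε'2
  have hbad := hN₁ N hNN₁ a ⟨z, hz⟩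
  simp only at hbad ⊢
  set ψ := (N : ℝ) ^ ε' * Ψ N a z with hψ
  have hψ0 : 0 < ψ := hΨ0.trans_le hψle
  rw [Real.rpow_neg hN0.le, Real.rpow_natCast] at hbad
  have hψ42 : 2 ^ (2 * q) * ψ ≤ 1 / 42 := by
    have h1 := hN₂ N hNN₂
    have h2 : (0 : ℝ) < (N : ℝ) ^ (c * δ / 2) := Real.rpow_pos_of_pos hN0 _
    rw [Real.rpow_neg hN0.le] at hψsmall
    have h3 := mul_le_mul_of_nonneg_left h1 hψ0.le
    have h4 := mul_le_mul_of_nonneg_right hψsmall h2.le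
    rw [inv_mul_cancel₀ h2.ne'] at h4
    linarith
  have hmom := (hX N a hNone z hz).integral_norm_sum_fluct_pow_le hM hN1 hq0 hψ0 hψ42 hψN hbad
    (t := T N a i) (fun k => ((hT.le_inv N a i k).trans hMΨ).trans (pow_le_pow_left₀ hΨ0.le hψle 2))
    (hT.sum_le N a i)
  set w : Ω N a → ℂ := fun ω => ∑ k, T N a i k * fluct (P N a) (H N a) k (X N a z k ∅) ω with hw
  have hwLp : AllMemLp (P N a) w := AllMemLp.sum fun k _ =>
    (((hX N a hNone z hz).allMemLp hM k ∅).fluct k).const_mul _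
  set b := (N : ℝ) ^ ε * Ψ N a z ^ 2 with hb
  have hb0 : 0 < b := by positivity
  have hmarkov := mul_meas_ge_le_integral_of_nonneg (μ := P N a)
    (f := fun ω => ‖w ω‖ ^ (2 * q)) (Filter.Eventually.of_forall fun ω => by positivity)
    (hwLp.integrable_norm_pow (by omega)) (b ^ (2 * q))
  have hsub : (P N a).real {ω | b < ‖w ω‖} ≤ (P N a).real {ω | b ^ (2 * q) ≤ ‖w ω‖ ^ (2 * q)} :=
    measureReal_mono fun ω hω => pow_le_pow_left₀ hb0.le (le_of_lt hω) _
  have hratio : (ψ ^ 2) ^ (2 * q) ≤ (N : ℝ) ^ (-(D + 1)) * b ^ (2 * q) := by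
    have h1 : (ψ ^ 2) ^ (2 * q) = (N : ℝ) ^ (ε' * (4 * q)) * (Ψ N a z ^ 2) ^ (2 * q) := by
      rw [hψ, mul_pow, mul_pow, Real.rpow_mul hN0.le, ← pow_mul _ 2 (2 * q), ← Real.rpow_natCast]
      congr 2
      push_cast
      ring
    have h2 : b ^ (2 * q) = (N : ℝ) ^ (ε * (2 * q)) * (Ψ N a z ^ 2) ^ (2 * q) := by
      rw [hb, mul_pow, Real.rpow_mul hN0.le, ← Real.rpow_natCast]
      congr 2
      push_cast
      ring
    rw [h1, h2, ← mul_assoc (_ ^ (-(D + 1))), ← Real.rpow_add hN0]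
    refine mul_le_mul_of_nonneg_right (Real.rpow_le_rpow_of_exponent_le hN1 ?_) (by positivity)
    have hqnn : (0 : ℝ) ≤ q := Nat.cast_nonneg q
    nlinarith
  have hfc : 0 ≤ fluctConst μ q := by
    have := one_le_diffMomentConst μ (2 * q)
    unfold fluctConst
    positivity
  have hfin : fluctConst μ q * (N : ℝ) ^ (-(D + 1)) ≤ (N : ℝ) ^ (-D) := by
    have h1 : fluctConst μ q ≤ N := hN₃.trans (by exact_mod_cast hNN₃)
    calc _ ≤ (N : ℝ) * (N : ℝ) ^ (-(D + 1)) := by gcongr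
      _ = (N : ℝ) ^ (-D) := by
        rw [← Real.rpow_one_add' hN0.le (by linarith)]
        congr 1
        ring
  have hbp : 0 < b ^ (2 * q) := by positivity
  refine hsub.trans (le_trans ?_ hfin)
  rw [← mul_le_mul_iff_right₀ hbp]
  refine hmarkov.trans (hmom.trans ?_)
  calc _ ≤ fluctConst μ q * ((N : ℝ) ^ (-(D + 1)) * b ^ (2 * q)) := by gcongr
    _ = _ := by ring

theorem stochDom_sum_fluct_inv_green (hC : IsControlled δ c μ P H Dom Ψ) (hT : IsWeight P H T) :
    StochDom P (U := fun N a => Dom N a × Fin N)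
        (fun N a u ω => ‖∑ k, T N a u.2 k *
          fluct (P N a) (H N a) k (fun ω' => 1 / green (H N a ω') u.1 k k) ω‖)
        (fun N a u _ => Ψ N a u.1 ^ 2) := by
  have hX : ∀ N a, 1 ≤ N → ∀ z ∈ Dom N a, IsDiagonalFamily (H N a) z
      (fun k C ω => (green (minorSet (H N a ω) C) z k k)⁻¹ - (mSC z)⁻¹) := by
    intro N a hN z hz
    obtain ⟨h1, h2, h3, h4⟩ := hC.domain_bounds hN a hz
    exact isDiagonalFamily_inv_green (hC.model N a) (by exact_mod_cast hN) h1 h2 h3 h4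
  refine (stochDom_sum_fluct hC hT hX).congr_ae fun N a u hN => ?_
  have hae : ∀ᵐ ω ∂(P N a), ∀ k, fluct (P N a) (H N a) k
      (fun ω => (green (minorSet (H N a ω) ∅) u.1 k k)⁻¹ - (mSC u.1)⁻¹) ω =
      fluct (P N a) (H N a) k (fun ω' => 1 / green (H N a ω') u.1 k k) ω := by
    rw [ae_all_iff]
    intro k
    have := fluct_sub_const (hC.model N a)
      ((hX N a hN u.1 u.1.2).allMemLp (hC.model N a) k ∅).integrable k
    simp only [minorSet_empty, one_div] at this ⊢
    exact this
  filter_upwards [hae] with ω hω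
  simp only [hω]

theorem stochDom_sum_fluct_green (hC : IsControlled δ c μ P H Dom Ψ) (hT : IsWeight P H T) :
    StochDom P (U := fun N a => Dom N a × Fin N)
        (fun N a u ω => ‖∑ k, T N a u.2 k *
          fluct (P N a) (H N a) k (fun ω' => green (H N a ω') u.1 k k) ω‖)
        (fun N a u _ => Ψ N a u.1 ^ 2) := by
  have hX : ∀ N a, 1 ≤ N → ∀ z ∈ Dom N a, IsDiagonalFamily (H N a) z
      (fun k C ω => green (minorSet (H N a ω) C) z k k - mSC z) := by
    intro N a hN z hz
    obtain ⟨h1, h2, h3, h4⟩ := hC.domain_bounds hN a hz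
    exact isDiagonalFamily_green (hC.model N a) (by exact_mod_cast hN) h1 h2 h3 h4
  refine (stochDom_sum_fluct hC hT hX).congr_ae fun N a u hN => ?_
  have hae : ∀ᵐ ω ∂(P N a), ∀ k, fluct (P N a) (H N a) k
      (fun ω => green (minorSet (H N a ω) ∅) u.1 k k - mSC u.1) ω =
      fluct (P N a) (H N a) k (fun ω' => green (H N a ω') u.1 k k) ω := by
    rw [ae_all_iff]
    intro k
    have := fluct_sub_const (hC.model N a)
      ((hX N a hN u.1 u.1.2).allMemLp (hC.model N a) k ∅).integrable k
    simp only [minorSet_empty] at this ⊢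
    exact this
  filter_upwards [hae] with ω hω
  simp only [hω]

end Asymptotics

/-! ### The self-consistent equation -/

section SelfConsistent

variable {N : ℕ} {Ω : Type*} {mΩ : MeasurableSpace Ω} {P : Measure Ω}
  {H : Ω → Matrix (Fin N) (Fin N) ℂ} {δ : ℝ} {ν : ℕ → ℝ}

/-- The σ-algebra generated by the `k`-th row and column. -/
@[reducible]
noncomputable def rowAlg (H : Ω → Matrix (Fin N) (Fin N) ℂ) (k : Fin N) :
    MeasurableSpace Ω :=
  ⨆ p ∈ {p : {p : Fin N × Fin N // p.1 ≤ p.2} | p.1.1 ≠ k ∧ p.1.2 ≠ k}ᶜ, entryAlg H p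

namespace IsRandomMatrixModel

theorem apply_eq_conj (hM : IsRandomMatrixModel δ ν P H) (i j : Fin N) (ω : Ω) :
    H ω i j = starRingEnd ℂ (H ω j i) := by
  have := congrFun (congrFun (hM.hermitian ω) i) j
  simpa using this.symm

theorem measurable_rowAlg (hM : IsRandomMatrixModel δ ν P H) {k i j : Fin N}
    (hij : i = k ∨ j = k) : Measurable[rowAlg H k] fun ω => H ω i j := by
  have key : ∀ i j, i ≤ j → (i = k ∨ j = k) → Measurable[rowAlg H k] fun ω => H ω i j := by
    intro i j hle hij
    have hmem : (⟨(i, j), hle⟩ : {p : Fin N × Fin N // p.1 ≤ p.2}) ∈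
        {p : {p : Fin N × Fin N // p.1 ≤ p.2} | p.1.1 ≠ k ∧ p.1.2 ≠ k}ᶜ := by
      simp only [Set.mem_compl_iff, Set.mem_ofPred_eq]
      tauto
    have hle' : entryAlg H ⟨(i, j), hle⟩ ≤ rowAlg H k :=
      le_iSup₂_of_le (f := fun p _ => entryAlg H p) ⟨(i, j), hle⟩ hmem le_rfl
    exact (comap_measurable fun ω => H ω i j).mono hle' le_rfl
  rcases le_total i j with hle | hle
  · exact key i j hle hij
  · have h2 : (fun ω => H ω i j) = fun ω => starRingEnd ℂ (H ω j i) := by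
      funext ω
      exact hM.apply_eq_conj i j ω
    rw [h2]
    exact Complex.continuous_conj.measurable.comp (key j i hle hij.symm)

theorem rowAlg_le (hM : IsRandomMatrixModel δ ν P H) (k : Fin N) : rowAlg H k ≤ mΩ :=
  iSup₂_le fun p _ => hM.entryAlg_le p

theorem partialExp_of_rowAlg [IsProbabilityMeasure P] (hM : IsRandomMatrixModel δ ν P H)
    {k : Fin N} {f : Ω → ℂ} (hf : Measurable[rowAlg H k] f) :
    partialExp P H k f =ᵐ[P] fun _ => ∫ ω, f ω ∂P := by
  have hind : Indep (rowAlg H k) (minorAlg H k) P := by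
    rw [minorAlg_eq hM.hermitian]
    exact indep_iSup_of_disjoint hM.entryAlg_le hM.iIndep_entryAlg disjoint_compl_left
  exact condExp_indep_eq (hM.rowAlg_le k) (hM.minorAlg_le k) hf.stronglyMeasurable hind

/-- On the diagonal `a = b` the product is `|h_ia|²`. Otherwise `h_bi` is an entry of `H^{(a)}`,
while `h_ia` lies in row or column `a` and is centred, hence equals its own fluctuation `Q_a`. -/
theorem integral_row_mul_col [IsProbabilityMeasure P] (hM : IsRandomMatrixModel δ ν P H)
    {i a b : Fin N} (ha : a ≠ i) :
    ∫ ω, H ω i a * H ω b i ∂P = if a = b then (variances P H i a : ℂ) else 0 := by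
  split_ifs with hab
  · subst hab
    rw [variances, Matrix.of_apply, ← integral_complex_ofReal]
    refine integral_congr_ae (Filter.Eventually.of_forall fun ω => ?_)
    simp only
    rw [hM.apply_eq_conj a i, Complex.mul_conj']
    push_cast
    rfl
  · have hm : Measurable[minorAlg H a] fun ω => H ω b i := by
      have h2 : (fun ω => H ω b i) = fun ω => minor (H ω) a b i := by
        funext ω
        simp [minor, Ne.symm hab, Ne.symm ha]
      rw [h2]
      exact measurable_minorAlg_minor H a b i
    have h0 := integral_fluct_mul_eq_zero (hM.minorAlg_le a) (hM.allMemLp_entry i a)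
      (hM.allMemLp_entry b i) hm.stronglyMeasurable.aestronglyMeasurable
    rw [← h0]
    refine integral_congr_ae ?_
    filter_upwards [hM.partialExp_of_rowAlg (hM.measurable_rowAlg (k := a) (Or.inr rfl))]
      with ω hω
    simp only [fluct]
    rw [hω, hM.mean_zero, sub_zero]

/-- The partial expectation of Schur's formula. -/
theorem inv_green_eq_fluct [IsProbabilityMeasure P] (hM : IsRandomMatrixModel δ ν P H)
    {z : ℂ} (hz : 0 < z.im) (i : Fin N) :
    ∀ᵐ ω ∂P, 1 / green (H ω) z i i =
      fluct P H i (fun ω' => 1 / green (H ω') z i i) ω - z -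
        ∑ a ∈ Finset.univ.erase i, (variances P H i a : ℂ) * green (minor (H ω) i) z a a := by
  have hG : ∀ a b, AllMemLp P fun ω => green (minor (H ω) i) z a b := by
    intro a b
    have hmm : Measurable fun ω => green (minor (H ω) i) z a b := by
      have := measurable_green (measurable_minorSet_apply hM.measurable {i}) z a b
      simpa only [← insert_empty_eq, minorSet_insert, minorSet_empty] using this
    refine (AllMemLp.const ((z.im⁻¹ : ℝ) : ℂ)).of_norm_le hmm.aestronglyMeasurable fun ω => ?_
    rw [Complex.norm_real, Real.norm_of_nonneg (inv_pos.mpr hz).le]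
    exact norm_green_le (minor_isHermitian (hM.hermitian ω) i) hz a b
  have hGm : ∀ a b, Measurable[minorAlg H i] fun ω => green (minor (H ω) i) z a b := fun a b =>
    @measurable_green N Ω (minorAlg H i) _ (fun a b => measurable_minorAlg_minor H i a b) z a b
  have hterm : ∀ a b, AllMemLp P fun ω => H ω i a * green (minor (H ω) i) z a b * H ω b i :=
    fun a b => ((hM.allMemLp_entry i a).mul (hG a b)).mul (hM.allMemLp_entry b i)
  -- The resolvent of the minor is a function of `H^{(i)}` and pulls out; the product of row and
  -- column entries is independent of `H^{(i)}` and is replaced by its mean.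
  have hpull : ∀ a b, a ≠ i → P[fun ω => H ω i a * green (minor (H ω) i) z a b * H ω b i |
      minorAlg H i] =ᵐ[P] fun ω => if a = b then
        (variances P H i a : ℂ) * green (minor (H ω) i) z a b else 0 := by
    intro a b ha
    have hrow : AllMemLp P fun ω => H ω i a * H ω b i :=
      (hM.allMemLp_entry i a).mul (hM.allMemLp_entry b i)
    have h1 := condExp_bilin_of_aestronglyMeasurable_left (ContinuousLinearMap.mul ℝ ℂ)
      (hGm a b).stronglyMeasurable.aestronglyMeasurable ((hG a b).mul hrow).integrable
      hrow.integrable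
    have h2 := hM.partialExp_of_rowAlg (k := i) (f := fun ω => H ω i a * H ω b i)
      ((hM.measurable_rowAlg (Or.inl rfl)).mul (hM.measurable_rowAlg (Or.inr rfl)))
    have h3 : (fun ω => H ω i a * green (minor (H ω) i) z a b * H ω b i) =
        fun ω => ContinuousLinearMap.mul ℝ ℂ (green (minor (H ω) i) z a b)
          (H ω i a * H ω b i) := by
      funext ω
      simp only [ContinuousLinearMap.mul_apply']
      ring
    rw [h3]
    filter_upwards [h1, h2] with ω hω1 hω2
    rw [partialExp_def] at hω2
    rw [hω1, hω2, hM.integral_row_mul_col ha, ContinuousLinearMap.mul_apply']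
    split_ifs <;> ring
  have hdiag : P[fun ω => H ω i i | minorAlg H i] =ᵐ[P] fun _ => 0 := by
    have := hM.partialExp_of_rowAlg (hM.measurable_rowAlg (k := i) (i := i) (j := i) (Or.inl rfl))
    rwa [hM.mean_zero] at this
  have hinner : ∀ a ∈ Finset.univ.erase i, P[fun ω => ∑ b ∈ Finset.univ.erase i,
      H ω i a * green (minor (H ω) i) z a b * H ω b i | minorAlg H i] =ᵐ[P]
      fun ω => (variances P H i a : ℂ) * green (minor (H ω) i) z a a := by
    intro a ha
    have h1 := condExp_finsetSum (s := Finset.univ.erase i)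
      (f := fun b ω => H ω i a * green (minor (H ω) i) z a b * H ω b i)
      (fun b _ => (hterm a b).integrable) (minorAlg H i)
    have h2 : ∀ᵐ ω ∂P, ∀ b, P[fun ω => H ω i a * green (minor (H ω) i) z a b * H ω b i |
      minorAlg H i] ω = if a = b then
        (variances P H i a : ℂ) * green (minor (H ω) i) z a b else 0 :=
      ae_all_iff.mpr fun b => hpull a b (Finset.ne_of_mem_erase ha)
    have e : (∑ b ∈ Finset.univ.erase i, fun ω =>
        H ω i a * green (minor (H ω) i) z a b * H ω b i) = fun ω => ∑ b ∈ Finset.univ.erase i,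
        H ω i a * green (minor (H ω) i) z a b * H ω b i := by funext ω; simp
    rw [e] at h1
    filter_upwards [h1, h2] with ω hω1 hω2
    rw [hω1, Finset.sum_apply]
    simp only [hω2]
    rw [Finset.sum_ite_eq, if_pos ha]
  have hin : ∀ a, AllMemLp P fun ω => ∑ b ∈ Finset.univ.erase i,
      H ω i a * green (minor (H ω) i) z a b * H ω b i := fun a =>
    AllMemLp.sum fun b _ => hterm a b
  have hsum : P[fun ω => ∑ a ∈ Finset.univ.erase i, ∑ b ∈ Finset.univ.erase i,
      H ω i a * green (minor (H ω) i) z a b * H ω b i | minorAlg H i] =ᵐ[P]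
      fun ω => ∑ a ∈ Finset.univ.erase i,
        (variances P H i a : ℂ) * green (minor (H ω) i) z a a := by
    have h1 := condExp_finsetSum (s := Finset.univ.erase i)
      (f := fun a ω => ∑ b ∈ Finset.univ.erase i,
        H ω i a * green (minor (H ω) i) z a b * H ω b i)
      (fun a _ => (hin a).integrable) (minorAlg H i)
    have h2 : ∀ᵐ ω ∂P, ∀ a ∈ Finset.univ.erase i, P[fun ω => ∑ b ∈ Finset.univ.erase i,
      H ω i a * green (minor (H ω) i) z a b * H ω b i | minorAlg H i] ω =
        (variances P H i a : ℂ) * green (minor (H ω) i) z a a :=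
      (Finset.eventually_all (Finset.univ.erase i)).mpr hinner
    have e : (∑ a ∈ Finset.univ.erase i, fun ω => ∑ b ∈ Finset.univ.erase i,
        H ω i a * green (minor (H ω) i) z a b * H ω b i) = fun ω => ∑ a ∈ Finset.univ.erase i,
        ∑ b ∈ Finset.univ.erase i,
        H ω i a * green (minor (H ω) i) z a b * H ω b i := by funext ω; simp
    rw [e] at h1
    filter_upwards [h1, h2] with ω hω1 hω2
    rw [hω1, Finset.sum_apply]
    exact Finset.sum_congr rfl fun a ha => hω2 a ha
  have hschur : (fun ω => 1 / green (H ω) z i i) = fun ω => H ω i i - z -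
      ∑ a ∈ Finset.univ.erase i, ∑ b ∈ Finset.univ.erase i,
        H ω i a * green (minor (H ω) i) z a b * H ω b i := by
    funext ω
    exact one_div_green_diag (hM.hermitian ω) hz i
  have hii := (hM.allMemLp_entry i i).integrable
  have hs := (AllMemLp.sum (s := Finset.univ.erase i) fun a _ => hin a).integrable
  have h1 := condExp_sub (hii.sub (integrable_const z)) hs (minorAlg H i)
  have h2 := condExp_sub hii (integrable_const z) (minorAlg H i)
  rw [condExp_const (hM.minorAlg_le i)] at h2
  have hP : partialExp P H i (fun ω => 1 / green (H ω) z i i) =ᵐ[P] fun ω => -z -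
      ∑ a ∈ Finset.univ.erase i, (variances P H i a : ℂ) * green (minor (H ω) i) z a a := by
    rw [partialExp_def, hschur]
    filter_upwards [h1, h2, hdiag, hsum] with ω e1 e2 e3 e4
    refine e1.trans ?_
    rw [Pi.sub_apply, e4]
    congr 1
    refine e2.trans ?_
    rw [Pi.sub_apply, e3, zero_sub]
  filter_upwards [hP] with ω hω
  rw [fluct, hω]
  ring

end IsRandomMatrixModel

end SelfConsistent

/-! ### Linearization and inversion of `1 - m² S` -/

section Stability

variable {N : ℕ}

/-- The residual `v - m² S v` of the linearized self-consistent equation. -/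
noncomputable def residual (S : Matrix (Fin N) (Fin N) ℝ) (A : Matrix (Fin N) (Fin N) ℂ) (z : ℂ)
    (i : Fin N) : ℂ :=
  diagErr A z i - mSC z ^ 2 * ∑ k, (S i k : ℂ) * diagErr A z k

/-- Up to a quadratic error, the residual is the fluctuation of the inverse diagonal entry. -/
theorem norm_residual_add_le {A : Matrix (Fin N) (Fin N) ℂ} (hA : A.IsHermitian) {z : ℂ}
    (hz : 0 < z.im) (hm : 1 / 21 ≤ ‖mSC z‖) {S : Matrix (Fin N) (Fin N) ℝ}
    (hS0 : ∀ i j, 0 ≤ S i j) (hS1 : ∀ i, ∑ j, S i j = 1) {ψ : ℝ} (hψ : ψ ≤ 1 / 42)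
    (hSψ : ∀ i j, S i j ≤ ψ ^ 2) (hΛ : lambda A z ≤ ψ) (i : Fin N) {Q : ℂ}
    (hQ : 1 / green A z i i = Q - z -
      ∑ a ∈ Finset.univ.erase i, (S i a : ℂ) * green (minor A i) z a a) :
    ‖residual S A z i + mSC z ^ 2 * Q‖ ≤ 86 * ψ ^ 2 := by
  have hG0 := green_diag_ne_zero hA hz i
  have hψ0 : 0 ≤ ψ := (norm_nonneg _).trans (norm_green_sub_le_lambda hΛ i)
  have hm1 := norm_mSC_lt_one hz
  have hm0 := mSC_ne_zero hz
  have hlow : 1 / 42 ≤ ‖green A z i i‖ := by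
    have h1 := norm_green_sub_le_lambda hΛ i
    have h2 := norm_sub_norm_le (mSC z) (mSC z - green A z i i)
    rw [sub_sub_cancel, norm_sub_rev] at h2
    linarith
  have hinv : ‖(green A z i i)⁻¹‖ ≤ 42 := by
    rw [norm_inv]
    exact (inv_anti₀ (by norm_num) hlow).trans (by norm_num)
  have hup : ‖green A z i i‖ ≤ 2 := by
    have h1 := norm_green_sub_le_lambda hΛ i
    have h2 := norm_sub_norm_le (green A z i i) (mSC z)
    linarith
  -- The price of replacing the minor's diagonal entries by those of `G` and of including `a = i` in
  -- the sum. It is quadratic because `S i i ≤ ψ²` and each correction contains two off-diagonal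
  -- entries.
  set B : ℂ := (S i i : ℂ) * green A z i i + ∑ a ∈ Finset.univ.erase i,
    (S i a : ℂ) * (green A z a i * green A z i a / green A z i i) with hB
  have hsplit : ∑ a ∈ Finset.univ.erase i, (S i a : ℂ) * green (minor A i) z a a =
      ∑ a, (S i a : ℂ) * green A z a a - B := by
    rw [hB, ← Finset.add_sum_erase _ _ (Finset.mem_univ i), add_sub_add_left_eq_sub,
      ← Finset.sum_sub_distrib]
    refine Finset.sum_congr rfl fun a ha => ?_
    have hai := Finset.ne_of_mem_erase ha
    rw [green_minor hA hz hai hai]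
    ring
  have hSv : ∑ a, (S i a : ℂ) * green A z a a =
      mSC z + ∑ a, (S i a : ℂ) * diagErr A z a := by
    have h1 : (∑ a, (S i a : ℂ)) = 1 := by exact_mod_cast hS1 i
    simp only [diagErr, mul_sub, Finset.sum_sub_distrib]
    rw [← Finset.sum_mul, h1]
    ring
  -- The terms in `S v` cancel. As `m² (z + m) = -m`, what remains is `G - 2m + m²/G = (G - m)²/G`,
  -- up to `B`.
  have hid : residual S A z i + mSC z ^ 2 * Q =
      diagErr A z i ^ 2 * (green A z i i)⁻¹ - mSC z ^ 2 * B := by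
    rw [hsplit, hSv] at hQ
    have hmz := mSC_eq hz
    have hQ' : Q = 1 / green A z i i + z + (mSC z + ∑ a, (S i a : ℂ) * diagErr A z a - B) := by
      linear_combination -hQ
    rw [residual, hQ', diagErr]
    field_simp
    linear_combination green A z i i * mSC z * hmz
  have hBle : ‖B‖ ≤ 44 * ψ ^ 2 := by
    have h1 : ‖(S i i : ℂ) * green A z i i‖ ≤ ψ ^ 2 * 2 := by
      rw [norm_mul, Complex.norm_real, Real.norm_of_nonneg (hS0 i i)]
      exact mul_le_mul (hSψ i i) hup (norm_nonneg _) (by positivity)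
    have h2 : ‖∑ a ∈ Finset.univ.erase i, (S i a : ℂ) *
        (green A z a i * green A z i a / green A z i i)‖ ≤
        ∑ a ∈ Finset.univ.erase i, S i a * (42 * ψ ^ 2) := by
      refine (norm_sum_le _ _).trans (Finset.sum_le_sum fun a ha => ?_)
      have hai := Finset.ne_of_mem_erase ha
      rw [norm_mul, Complex.norm_real, Real.norm_of_nonneg (hS0 i a), div_eq_mul_inv, norm_mul,
        norm_mul]
      refine mul_le_mul_of_nonneg_left ?_ (hS0 i a)
      have h3 := norm_green_le_lambda hΛ hai
      have h4 := norm_green_le_lambda hΛ hai.symm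
      calc _ ≤ ψ * ψ * 42 := by gcongr
        _ = _ := by ring
    have h3 : ∑ a ∈ Finset.univ.erase i, S i a * (42 * ψ ^ 2) ≤ 42 * ψ ^ 2 := by
      rw [← Finset.sum_mul]
      have : ∑ a ∈ Finset.univ.erase i, S i a ≤ 1 := by
        rw [← hS1 i]
        exact Finset.sum_le_sum_of_subset_of_nonneg (Finset.erase_subset _ _)
          fun _ _ _ => hS0 _ _
      nlinarith [sq_nonneg ψ]
    refine (norm_add_le _ _).trans ?_
    linarith
  rw [hid]
  refine (norm_sub_le _ _).trans ?_
  have h1 : ‖diagErr A z i ^ 2 * (green A z i i)⁻¹‖ ≤ ψ ^ 2 * 42 := by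
    rw [norm_mul, norm_pow]
    have := norm_green_sub_le_lambda hΛ i
    rw [← diagErr] at this
    gcongr
  have h2 : ‖mSC z ^ 2 * B‖ ≤ 44 * ψ ^ 2 := by
    rw [norm_mul, norm_pow]
    have : ‖mSC z‖ ^ 2 ≤ 1 := pow_le_one₀ (norm_nonneg _) hm1.le
    calc _ ≤ 1 * ‖B‖ := by gcongr
      _ ≤ _ := by rwa [one_mul]
  linarith

/-- Strict diagonal dominance: the rows of `m² S` have absolute sum `|m|² < 1`. -/
theorem isUnit_det_one_sub {S : Matrix (Fin N) (Fin N) ℝ} (hS0 : ∀ i j, 0 ≤ S i j)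
    (hS1 : ∀ i, ∑ j, S i j = 1) {m : ℂ} (hm : ‖m‖ < 1) :
    IsUnit (1 - m ^ 2 • toC S).det := by
  rw [isUnit_iff_ne_zero]
  apply det_ne_zero_of_sum_row_lt_diag
  intro k
  have hm2 : ‖m‖ ^ 2 < 1 := pow_lt_one₀ (norm_nonneg _) hm two_ne_zero
  have h1 : ∑ j ∈ Finset.univ.erase k, ‖(1 - m ^ 2 • toC S) k j‖ =
      ‖m‖ ^ 2 * ∑ j ∈ Finset.univ.erase k, S k j := by
    rw [Finset.mul_sum]
    refine Finset.sum_congr rfl fun j hj => ?_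
    have hjk := (Finset.ne_of_mem_erase hj).symm
    simp [toC, Matrix.one_apply_ne hjk, abs_of_nonneg (hS0 k j)]
  have h2 : 1 - ‖m‖ ^ 2 * S k k ≤ ‖(1 - m ^ 2 • toC S) k k‖ := by
    have := norm_sub_norm_le (1 : ℂ) (m ^ 2 * (S k k : ℂ))
    simpa [toC, abs_of_nonneg (hS0 k k)] using this
  have h3 : S k k + ∑ j ∈ Finset.univ.erase k, S k j = 1 := by
    rw [Finset.add_sum_erase _ _ (Finset.mem_univ k), hS1]
  rw [h1]
  nlinarith

theorem eq_stabInv_mulVec {S : Matrix (Fin N) (Fin N) ℝ} (hS0 : ∀ i j, 0 ≤ S i j)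
    (hS1 : ∀ i, ∑ j, S i j = 1) {z : ℂ} (hz : 0 < z.im) {w g : Fin N → ℂ}
    (h : (1 - mSC z ^ 2 • toC S).mulVec w = g) : w = (stabInv S z).mulVec g := by
  rw [← h, Matrix.mulVec_mulVec, stabInv,
    Matrix.nonsing_inv_mul _ (isUnit_det_one_sub hS0 hS1 (norm_mSC_lt_one hz)), Matrix.one_mulVec]

theorem norm_stabInv_mulVec_le (S : Matrix (Fin N) (Fin N) ℝ) (z : ℂ) {g : Fin N → ℂ} {x : ℝ}
    (hx : 0 ≤ x) (hg : ∀ j, ‖g j‖ ≤ x) (i : Fin N) :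
    ‖(stabInv S z).mulVec g i‖ ≤ Gam S z * x := by
  rw [Matrix.mulVec, dotProduct]
  calc _ ≤ ∑ j, ‖stabInv S z i j‖ * x := (norm_sum_le _ _).trans (Finset.sum_le_sum fun j _ => by
        rw [norm_mul]
        exact mul_le_mul_of_nonneg_left (hg j) (norm_nonneg _))
    _ = (∑ j, ‖stabInv S z i j‖) * x := by rw [Finset.sum_mul]
    _ ≤ _ := mul_le_mul_of_nonneg_right (le_ciSup (f := fun i => ∑ j, ‖stabInv S z i j‖)
        (Set.finite_range _).bddAbove i) hx

theorem mem_ePerp {g : Fin N → ℂ} : g ∈ ePerp N ↔ ∑ i, g i = 0 := by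
  simp [ePerp, LinearMap.mem_ker]

theorem norm_stabInv_mulVec_le_of_mem_ePerp (S : Matrix (Fin N) (Fin N) ℝ) (z : ℂ)
    {g : Fin N → ℂ} (hgp : g ∈ ePerp N) {x : ℝ} (hx : 0 ≤ x) (hg : ∀ j, ‖g j‖ ≤ x) (i : Fin N) :
    ‖(stabInv S z).mulVec g i‖ ≤ GamTilde S z * x := by
  refine (norm_le_pi_norm ((stabInv S z).mulVec g) i).trans ?_
  have h := ((LinearMap.toContinuousLinearMap (Matrix.mulVecLin (stabInv S z))).comp
    (ePerp N).subtypeL).le_opNorm ⟨g, hgp⟩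
  have h2 : ‖(⟨g, hgp⟩ : ePerp N)‖ ≤ x := (pi_norm_le_iff_of_nonneg hx).mpr hg
  exact h.trans (mul_le_mul_of_nonneg_left h2 (norm_nonneg _))

/-- Fixed vectors of an irreducible stochastic matrix are constant. -/
theorem eq_of_mulVec_eq_self {S : Matrix (Fin N) (Fin N) ℝ} (hS : S.IsIrreducible)
    (hS1 : ∀ i, ∑ j, S i j = 1) {x : Fin N → ℝ} (hx : S.mulVec x = x) (i j : Fin N) :
    x i = x j := by
  have hpow : ∀ (y : Fin N → ℝ), S.mulVec y = y → ∀ k : ℕ, (S ^ k).mulVec y = y := by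
    intro y hy k
    induction k with
    | zero => simp
    | succ k ih => rw [pow_succ, ← Matrix.mulVec_mulVec, hy, ih]
  have hone : S.mulVec (fun _ => 1) = fun _ => 1 := by
    funext i
    simp [Matrix.mulVec, dotProduct, hS1]
  have : Nonempty (Fin N) := ⟨i⟩
  obtain ⟨l, -, hl⟩ := Finset.exists_max_image Finset.univ x Finset.univ_nonempty
  suffices h : ∀ j, x j = x l by rw [h i, h j]
  intro j
  obtain ⟨k, -, hk⟩ := (Matrix.isIrreducible_iff_exists_pow_pos hS.nonneg).mp hS l j
  have h1 := congrFun (hpow x hx k) l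
  have h2 := congrFun (hpow _ hone k) l
  simp only [Matrix.mulVec, dotProduct, mul_one] at h1 h2
  -- Maximum principle: `x l` is maximal and also the average of `x` under row `l` of `S ^ k`, where
  -- `k` is chosen such that this row charges the given `j`.
  have h3 : ∑ j, (S ^ k) l j * (x l - x j) = 0 := by
    simp only [mul_sub, Finset.sum_sub_distrib]
    rw [← Finset.sum_mul, h1, h2]
    ring
  have h4 := (Finset.sum_eq_zero_iff_of_nonneg fun j hj => mul_nonneg
    (Matrix.pow_apply_nonneg hS.nonneg k l j) (sub_nonneg.mpr (hl j hj))).mp h3 j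
    (Finset.mem_univ j)
  rcases mul_eq_zero.mp h4 with h | h
  · exact absurd h hk.ne'
  · linarith

/-- If a matrix commutes with an irreducible symmetric stochastic matrix and has unit row sums,
then its column sums are one as well. -/
theorem col_sum_eq_one {S : Matrix (Fin N) (Fin N) ℝ} (hS : S.IsIrreducible)
    (hS1 : ∀ i, ∑ j, S i j = 1) (hsymm : ∀ i j, S i j = S j i) {T : Matrix (Fin N) (Fin N) ℂ}
    (hcomm : Commute T (toC S)) (hT : ∀ i, ∑ k, T i k = 1) (k : Fin N) : ∑ i, T i k = 1 := by
  set y : Fin N → ℂ := fun k => ∑ i, T i k with hy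
  have hcol : ∀ k, ∑ i, (S i k : ℂ) = 1 := fun k => by
    simp_rw [fun i => hsymm i k]
    exact_mod_cast hS1 k
  -- Sum `T S = S T` over the row index and use that the columns of `S` sum to one. The vector of
  -- column sums is thus fixed by `S`, hence constant, and counting all entries by rows identifies
  -- the constant.
  have hfix : ∀ j, ∑ k, (S j k : ℂ) * y k = y j := by
    intro j
    have h1 : ∀ i, ∑ k, T i k * (S k j : ℂ) = ∑ k, (S i k : ℂ) * T k j := fun i => by
      have := congrFun (congrFun hcomm.eq i) j
      simpa [Matrix.mul_apply, toC] using this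
    calc ∑ k, (S j k : ℂ) * y k = ∑ k, ∑ i, T i k * (S k j : ℂ) := by
          refine Finset.sum_congr rfl fun k _ => ?_
          rw [hy, Finset.mul_sum]
          refine Finset.sum_congr rfl fun i _ => ?_
          rw [hsymm j k, mul_comm]
      _ = ∑ i, ∑ k, (S i k : ℂ) * T k j := by
          rw [Finset.sum_comm]
          exact Finset.sum_congr rfl fun i _ => h1 i
      _ = ∑ k, (∑ i, (S i k : ℂ)) * T k j := by
          rw [Finset.sum_comm]
          refine Finset.sum_congr rfl fun k _ => ?_
          rw [Finset.sum_mul]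
      _ = y j := by simp [hcol, hy]
  have hre : S.mulVec (fun k => (y k).re) = fun k => (y k).re := by
    funext j
    have := congrArg Complex.re (hfix j)
    simpa [Matrix.mulVec, dotProduct] using this
  have him : S.mulVec (fun k => (y k).im) = fun k => (y k).im := by
    funext j
    have := congrArg Complex.im (hfix j)
    simpa [Matrix.mulVec, dotProduct] using this
  have hconst : ∀ j, y j = y k := fun j => Complex.ext
    (eq_of_mulVec_eq_self hS hS1 hre j k) (eq_of_mulVec_eq_self hS hS1 him j k)
  have hsum : ∑ j, y j = N := by
    rw [hy, Finset.sum_comm]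
    simp [hT]
  simp only [hconst, Finset.sum_const, Finset.card_univ, Fintype.card_fin, nsmul_eq_mul] at hsum
  have hN : (N : ℂ) ≠ 0 := by
    have : 0 < N := k.pos
    exact_mod_cast this.ne'
  have := mul_left_cancel₀ hN (hsum.trans (mul_one _).symm)
  exact this

theorem mulVec_residual {S : Matrix (Fin N) (Fin N) ℝ} {A T : Matrix (Fin N) (Fin N) ℂ} {z : ℂ}
    (hcomm : Commute T (toC S)) :
    (1 - mSC z ^ 2 • toC S).mulVec (T.mulVec (diagErr A z)) = T.mulVec (residual S A z) := by
  have hr : residual S A z = (1 - mSC z ^ 2 • toC S).mulVec (diagErr A z) := by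
    rw [Matrix.sub_mulVec, Matrix.smul_mulVec, Matrix.one_mulVec]
    funext i
    simp [residual, Matrix.mulVec, dotProduct, toC]
  have hc : Commute T (1 - mSC z ^ 2 • toC S) :=
    (Commute.one_right T).sub_right (hcomm.smul_right _)
  rw [hr, Matrix.mulVec_mulVec, Matrix.mulVec_mulVec, hc.eq]

/-- By symmetry the columns of `S` sum to one, so `[S v] = [v]`. -/
theorem avg_residual {S : Matrix (Fin N) (Fin N) ℝ} (hS1 : ∀ i, ∑ j, S i j = 1)
    (hsymm : ∀ i j, S i j = S j i) (A : Matrix (Fin N) (Fin N) ℂ) (z : ℂ) :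
    avg (residual S A z) = (1 - mSC z ^ 2) * avg (diagErr A z) := by
  have hcol : ∀ k, ∑ i, (S i k : ℂ) = 1 := fun k => by
    simp_rw [fun i => hsymm i k]
    exact_mod_cast hS1 k
  have h : ∑ i, ∑ k, (S i k : ℂ) * diagErr A z k = ∑ k, diagErr A z k := by
    rw [Finset.sum_comm]
    refine Finset.sum_congr rfl fun k _ => ?_
    rw [← Finset.sum_mul, hcol, one_mul]
  simp only [avg, residual, Finset.sum_sub_distrib, ← Finset.mul_sum, h]
  ring

/-- Unit row sums of `T` turn the centring of `v` into subtraction of `[v]` from `T v`. Constants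
are eigenvectors of `1 - m² S` with eigenvalue `1 - m²`, which also relates the averages of `v` and
of the residual. -/
theorem mulVec_residual_centred {S : Matrix (Fin N) (Fin N) ℝ} {A T : Matrix (Fin N) (Fin N) ℂ}
    {z : ℂ} (hS1 : ∀ i, ∑ j, S i j = 1) (hsymm : ∀ i j, S i j = S j i)
    (hcomm : Commute T (toC S)) (hT : ∀ i, ∑ k, T i k = 1) :
    (1 - mSC z ^ 2 • toC S).mulVec
      (T.mulVec fun k => diagErr A z k - avg (diagErr A z)) =
      fun i => T.mulVec (residual S A z) i - avg (residual S A z) := by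
  have h1 : (T.mulVec fun k => diagErr A z k - avg (diagErr A z)) =
      T.mulVec (diagErr A z) - fun _ => avg (diagErr A z) := by
    funext i
    simp only [Matrix.mulVec, dotProduct, mul_sub, Finset.sum_sub_distrib, Pi.sub_apply]
    rw [← Finset.sum_mul, hT, one_mul]
  have hS1' : ∀ i, (∑ j, (S i j : ℂ)) = 1 := fun i => by exact_mod_cast hS1 i
  rw [h1, Matrix.mulVec_sub, mulVec_residual hcomm, avg_residual hS1 hsymm]
  funext i
  simp only [Pi.sub_apply, Matrix.sub_mulVec, Matrix.smul_mulVec, Matrix.one_mulVec,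
    Matrix.mulVec, dotProduct, toC, Matrix.map_apply, Pi.smul_apply, smul_eq_mul]
  rw [← Finset.sum_mul, hS1']
  ring

end Stability

/-! ### Averaging of the diagonal errors `v` -/

section Averaging

theorem two_mul_rpow_neg_le {N : ℕ} (hN : 2 ≤ N) (D : ℝ) :
    (N : ℝ) ^ (-(D + 1)) + (N : ℝ) ^ (-(D + 1)) ≤ (N : ℝ) ^ (-D) := by
  have hN2 : (2 : ℝ) ≤ N := by exact_mod_cast hN
  have hN0 : (0 : ℝ) < N := by linarith
  have h : (N : ℝ) ^ (-D) = N * (N : ℝ) ^ (-(D + 1)) := by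
    rw [show -D = 1 + -(D + 1) by ring, Real.rpow_add hN0, Real.rpow_one]
  have := Real.rpow_nonneg hN0.le (-(D + 1))
  rw [h]
  nlinarith

variable {δ c : ℝ} {μ : ℕ → ℝ} {A : ℕ → Type*} {Ω : ∀ N, A N → Type*}
  [∀ N a, MeasurableSpace (Ω N a)] {P : ∀ N a, Measure (Ω N a)}
  {H : ∀ N a, Ω N a → Matrix (Fin N) (Fin N) ℂ}
  {Dom : ∀ N, A N → Set ℂ} {Ψ : ∀ N, A N → ℂ → ℝ} {T : ∀ N, A N → Matrix (Fin N) (Fin N) ℂ}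

/-- A union bound over matrix indices. -/
theorem StochDom.exists_index {X Y : ∀ N a, Dom N a × Fin N → Ω N a → ℝ} (h : StochDom P X Y)
    {ε D : ℝ} (hε : 0 < ε) (hD : 0 < D) :
    ∃ N₀ : ℕ, ∀ N : ℕ, N₀ ≤ N → ∀ (a : A N) (z : Dom N a),
      (P N a).real {ω | ∃ i, (N : ℝ) ^ ε * Y N a (z, i) ω < X N a (z, i) ω} ≤ (N : ℝ) ^ (-D) := by
  obtain ⟨N₀, hN₀⟩ := h ε hε (D + 1) (by linarith)
  refine ⟨max 1 N₀, fun N hN a z => ?_⟩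
  simp only [max_le_iff] at hN
  have hN0 : (0 : ℝ) < N := by exact_mod_cast hN.1
  rw [Set.ofPred_exists]
  refine (measureReal_iUnion_fintype_le _).trans ?_
  calc _ ≤ ∑ _i : Fin N, (N : ℝ) ^ (-(D + 1)) :=
        Finset.sum_le_sum fun i _ => hN₀ N hN.2 a (z, i)
    _ = N * (N : ℝ) ^ (-(D + 1)) := by simp
    _ = (N : ℝ) ^ (-D) := by
        rw [← Real.rpow_one_add' hN0.le (by linarith)]
        congr 1
        ring

/-- The average `[·]` is itself an admissible weighted sum because `M ≤ N`. -/
theorem isWeight_const_inv (hM : ∀ N a, IsRandomMatrixModel δ μ (P N a) (H N a)) :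
    IsWeight P H (fun N _ => Matrix.of fun _ _ => (1 / (N : ℂ))) where
  le_inv N a i _ := by
    have hN : 1 ≤ N := i.pos
    simp only [Matrix.of_apply, one_div, norm_inv, Complex.norm_natCast]
    exact inv_anti₀ ((hM N a).bigM_pos hN) (hM N a).upper_M
  sum_le N a i := by
    have hN : (N : ℝ) ≠ 0 := by exact_mod_cast i.pos.ne'
    simp [hN]

variable [∀ N a, IsProbabilityMeasure (P N a)]

/-- When `Λ ≤ ψ`, the residual is `-m² Q_k(1/G_kk)` up to `86 ψ²`. The weighted main term is small
by fluctuation averaging, and the error survives summation since the absolute weights sum to at most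
one. -/
theorem stochDom_sum_residual (hC : IsControlled δ c μ P H Dom Ψ) (hT : IsWeight P H T) :
    StochDom P (U := fun N a => Dom N a × Fin N)
      (fun N a u ω => ‖∑ k, T N a u.2 k *
        residual (variances (P N a) (H N a)) (H N a ω) u.1 k‖)
      (fun N a u _ => Ψ N a u.1 ^ 2) := by
  intro ε hε D hD
  set ε' := min (ε / 4) (c * δ / 2) with hε'
  have hδ := hC.delta_pos
  have hc := hC.c_pos
  have hε'0 : 0 < ε' := lt_min (by positivity) (by positivity)
  have hε'1 : ε' ≤ ε / 4 := min_le_left _ _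
  have hε'2 : ε' ≤ c * δ / 2 := min_le_right _ _
  obtain ⟨N₁, hN₁⟩ := hC.lambda_dom ε' hε'0 (D + 1) (by linarith)
  obtain ⟨N₂, hN₂⟩ := stochDom_sum_fluct_inv_green hC hT (ε / 2) (by linarith) (D + 1)
    (by linarith)
  obtain ⟨N₃, hN₃⟩ := exists_nat_le_rpow (ε := c * δ / 2) (by positivity) 42
  -- `87 = 86 + 1`: the quadratic error plus the fluctuation sum.
  obtain ⟨N₄, hN₄⟩ := exists_nat_le_rpow (ε := ε / 2) (by positivity) 87
  refine ⟨max 2 (max N₁ (max N₂ (max N₃ N₄))), fun N hN a u => ?_⟩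
  simp only [max_le_iff] at hN
  obtain ⟨hNtwo, hNN₁, hNN₂, hNN₃, hNN₄⟩ := hN
  have hNone : 1 ≤ N := by omega
  have hN0 : (0 : ℝ) < N := by exact_mod_cast hNone
  have hN1 : (1 : ℝ) ≤ N := by exact_mod_cast hNone
  obtain ⟨⟨z, hz⟩, i⟩ := u
  have hM := hC.model N a
  obtain ⟨hzre, hzim, hzim', -⟩ := hC.domain_bounds hNone a hz
  obtain ⟨hΨ1, hΨ2⟩ := hC.control N a z hz
  obtain ⟨hΨ0, hMΨ, hψle, hψsmall, -⟩ :=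
    control_bounds hNone hc hM.lower_M hM.upper_M hΨ1 hΨ2 hε'0.le hε'2
  have hbad₁ := hN₁ N hNN₁ a ⟨z, hz⟩
  have hbad₂ := hN₂ N hNN₂ a (⟨z, hz⟩, i)
  simp only at hbad₁ hbad₂ ⊢
  set ψ := (N : ℝ) ^ ε' * Ψ N a z with hψ
  have hψ0 : 0 < ψ := hΨ0.trans_le hψle
  have hψ42 : ψ ≤ 1 / 42 := by
    refine hψsmall.trans ?_
    rw [Real.rpow_neg hN0.le, one_div]
    exact inv_anti₀ (by norm_num) (hN₃ N hNN₃)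
  have hψsq : ψ ^ 2 ≤ (N : ℝ) ^ (ε / 2) * Ψ N a z ^ 2 := by
    have h1 : ((N : ℝ) ^ ε') ^ 2 ≤ (N : ℝ) ^ (ε / 2) := by
      rw [← Real.rpow_natCast, ← Real.rpow_mul hN0.le]
      refine Real.rpow_le_rpow_of_exponent_le hN1 ?_
      push_cast
      linarith
    rw [hψ, mul_pow]
    exact mul_le_mul_of_nonneg_right h1 (sq_nonneg _)
  have hfinal : 87 * ((N : ℝ) ^ (ε / 2) * Ψ N a z ^ 2) ≤ (N : ℝ) ^ ε * Ψ N a z ^ 2 := by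
    have h1 : (N : ℝ) ^ ε = (N : ℝ) ^ (ε / 2) * (N : ℝ) ^ (ε / 2) := by
      rw [← Real.rpow_add hN0, add_halves]
    rw [h1, ← mul_assoc, mul_assoc ((N : ℝ) ^ (ε / 2))]
    have h2 := hN₄ N hNN₄
    have h3 : 0 ≤ (N : ℝ) ^ (ε / 2) * Ψ N a z ^ 2 := by positivity
    nlinarith
  refine le_trans ?_ ((add_le_add hbad₁ hbad₂).trans (two_mul_rpow_neg_le hNtwo D))
  refine le_trans ?_ (measureReal_union_le _ _)
  have hae : ∀ᵐ ω ∂(P N a), ∀ k, 1 / green (H N a ω) z k k =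
      fluct (P N a) (H N a) k (fun ω' => 1 / green (H N a ω') z k k) ω - z -
        ∑ b ∈ Finset.univ.erase k, (variances (P N a) (H N a) k b : ℂ) *
          green (minor (H N a ω) k) z b b :=
    ae_all_iff.mpr fun k => hM.inv_green_eq_fluct hzim k
  -- The self-consistent equation holds only almost surely, so the inclusion of events is modulo
  -- null sets.
  refine ENNReal.toReal_mono (measure_ne_top _ _) (measure_mono_ae ?_)
  filter_upwards [hae] with ω hω hlt
  by_contra hgood
  change ¬ (_ ∨ _) at hgood
  rw [not_or] at hgood
  obtain ⟨hg₁, hg₂⟩ := hgood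
  have hΛ : lambda (H N a ω) z ≤ ψ := not_lt.mp hg₁
  set ξ := residual (variances (P N a) (H N a)) (H N a ω) z with hξ
  set Q : Fin N → ℂ := fun k =>
    fluct (P N a) (H N a) k (fun ω' => 1 / green (H N a ω') z k k) ω with hQ
  have herr : ∀ k, ‖ξ k + mSC z ^ 2 * Q k‖ ≤ 86 * ψ ^ 2 := fun k =>
    norm_residual_add_le (hM.hermitian ω) hzim (le_norm_mSC hzre hzim hzim') variances_nonneg
      hM.stochastic hψ42 (fun i j => (variances_le_inv_bigM i j).trans
        (hMΨ.trans (pow_le_pow_left₀ hΨ0.le hψle 2))) hΛ k (hω k)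
  have hF : ‖∑ k, T N a i k * Q k‖ ≤ (N : ℝ) ^ (ε / 2) * Ψ N a z ^ 2 := not_lt.mp hg₂
  have hdecomp : ∑ k, T N a i k * ξ k =
      ∑ k, T N a i k * (ξ k + mSC z ^ 2 * Q k) - mSC z ^ 2 * ∑ k, T N a i k * Q k := by
    rw [Finset.mul_sum, ← Finset.sum_sub_distrib]
    exact Finset.sum_congr rfl fun k _ => by ring
  have hsum : ‖∑ k, T N a i k * (ξ k + mSC z ^ 2 * Q k)‖ ≤ 86 * ψ ^ 2 := by
    calc _ ≤ ∑ k, ‖T N a i k‖ * (86 * ψ ^ 2) := (norm_sum_le _ _).trans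
          (Finset.sum_le_sum fun k _ => by
            rw [norm_mul]
            exact mul_le_mul_of_nonneg_left (herr k) (norm_nonneg _))
      _ ≤ 1 * (86 * ψ ^ 2) := by
          rw [← Finset.sum_mul]
          exact mul_le_mul_of_nonneg_right (hT.sum_le N a i) (by positivity)
      _ = _ := one_mul _
  have hm : ‖mSC z ^ 2 * ∑ k, T N a i k * Q k‖ ≤ ‖∑ k, T N a i k * Q k‖ := by
    rw [norm_mul, norm_pow]
    exact mul_le_of_le_one_left (norm_nonneg _)
      (pow_le_one₀ (norm_nonneg _) (norm_mSC_lt_one hzim).le)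
  have hle : ‖∑ k, T N a i k * ξ k‖ ≤ (N : ℝ) ^ ε * Ψ N a z ^ 2 := by
    rw [hdecomp]
    refine (norm_sub_le _ _).trans ?_
    linarith
  exact absurd hlt (not_lt.mpr hle)

/-- One component of `T v` involves all components of `T` applied to the residual through the
inverse of `1 - m² S`. They must therefore be bounded simultaneously, hence the union over indices.
-/
theorem stochDom_sum_diagErr (hC : IsControlled δ c μ P H Dom Ψ) (hT : IsWeight P H T)
    (hcomm : ∀ N a, Commute (T N a) (toC (variances (P N a) (H N a)))) :
    StochDom P (U := fun N a => Dom N a × Fin N)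
      (fun N a u ω => ‖∑ k, T N a u.2 k * diagErr (H N a ω) u.1 k‖)
      (fun N a u _ => Gam (variances (P N a) (H N a)) u.1 * Ψ N a u.1 ^ 2) := by
  intro ε hε D hD
  obtain ⟨N₁, hN₁⟩ := (stochDom_sum_residual hC hT).exists_index hε hD
  refine ⟨max 1 N₁, fun N hN a u => ?_⟩
  simp only [max_le_iff] at hN
  obtain ⟨⟨z, hz⟩, i⟩ := u
  refine le_trans (measureReal_mono fun ω hω => ?_) (hN₁ N hN.2 a ⟨z, hz⟩)
  by_contra hgood
  simp only [Set.mem_ofPred_eq, not_exists, not_lt] at hgood hω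
  obtain ⟨-, hzim, -, -⟩ := hC.domain_bounds hN.1 a hz
  have hw := eq_stabInv_mulVec variances_nonneg (hC.model N a).stochastic hzim
    (mulVec_residual (A := H N a ω) (hcomm N a))
  have hle := norm_stabInv_mulVec_le (variances (P N a) (H N a)) z (by positivity) hgood i
  have h2 : ‖(T N a).mulVec (diagErr (H N a ω) z) i‖ ≤ Gam (variances (P N a) (H N a)) z *
      ((N : ℝ) ^ ε * Ψ N a z ^ 2) := by
    rw [hw]
    exact hle
  rw [mul_left_comm] at h2
  exact absurd hω (not_lt.mpr h2)

/-- The inverse of `1 - m² S` now acts on the residual averaged by `T` minus its mean. Both parts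
are controlled by the residual estimate, the mean through the weights `1/N`. -/
theorem stochDom_sum_diagErr_sub_avg (hC : IsControlled δ c μ P H Dom Ψ) (hT : IsWeight P H T)
    (hcomm : ∀ N a, Commute (T N a) (toC (variances (P N a) (H N a))))
    (hT1 : ∀ N a i, ∑ k, T N a i k = 1) :
    StochDom P (U := fun N a => Dom N a × Fin N)
      (fun N a u ω => ‖∑ k, T N a u.2 k *
        (diagErr (H N a ω) u.1 k - avg (diagErr (H N a ω) u.1))‖)
      (fun N a u _ => GamTilde (variances (P N a) (H N a)) u.1 * Ψ N a u.1 ^ 2) := by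
  intro ε hε D hD
  obtain ⟨N₁, hN₁⟩ := (stochDom_sum_residual hC hT).exists_index (ε := ε / 2) (D := D + 1)
    (by linarith) (by linarith)
  obtain ⟨N₂, hN₂⟩ := stochDom_sum_residual hC (isWeight_const_inv hC.model) (ε / 2)
    (by linarith) (D + 1) (by linarith)
  obtain ⟨N₃, hN₃⟩ := exists_nat_le_rpow (ε := ε / 2) (by positivity) 2
  refine ⟨max 2 (max N₁ (max N₂ N₃)), fun N hN a u => ?_⟩
  simp only [max_le_iff] at hN
  obtain ⟨hNtwo, hNN₁, hNN₂, hNN₃⟩ := hN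
  have hN0 : (0 : ℝ) < N := by exact_mod_cast (by omega : 0 < N)
  obtain ⟨⟨z, hz⟩, i⟩ := u
  have hM := hC.model N a
  refine le_trans ?_ ((add_le_add (hN₁ N hNN₁ a ⟨z, hz⟩) (hN₂ N hNN₂ a (⟨z, hz⟩, i))).trans
    (two_mul_rpow_neg_le hNtwo D))
  refine le_trans (measureReal_mono fun ω hω => ?_) (measureReal_union_le _ _)
  by_contra hgood
  simp only [Set.mem_union, Set.mem_ofPred_eq, not_or, not_exists, not_lt, Matrix.of_apply]
    at hgood hω
  obtain ⟨hg₁, hg₂⟩ := hgood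
  rw [← Finset.mul_sum] at hg₂
  obtain ⟨-, hzim, -, -⟩ := hC.domain_bounds (by omega) a hz
  have hsq : 0 ≤ Ψ N a z ^ 2 := sq_nonneg _
  have hfinal : 2 * ((N : ℝ) ^ (ε / 2) * Ψ N a z ^ 2) ≤ (N : ℝ) ^ ε * Ψ N a z ^ 2 := by
    have h1 : (N : ℝ) ^ ε = (N : ℝ) ^ (ε / 2) * (N : ℝ) ^ (ε / 2) := by
      rw [← Real.rpow_add hN0, add_halves]
    rw [h1, ← mul_assoc, mul_assoc ((N : ℝ) ^ (ε / 2))]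
    have h2 := hN₃ N hNN₃
    have h3 : 0 ≤ (N : ℝ) ^ (ε / 2) * Ψ N a z ^ 2 := by positivity
    nlinarith
  set S := variances (P N a) (H N a) with hS
  set g : Fin N → ℂ := fun j =>
    (T N a).mulVec (residual S (H N a ω) z) j - avg (residual S (H N a ω) z) with hg
  have hgle : ∀ j, ‖g j‖ ≤ (N : ℝ) ^ ε * Ψ N a z ^ 2 := fun j => by
    refine (norm_sub_le _ _).trans ?_
    have h1 : ‖(T N a).mulVec (residual S (H N a ω) z) j‖ ≤ _ := hg₁ j
    have h2 : ‖avg (residual S (H N a ω) z)‖ ≤ _ := hg₂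
    linarith
  -- Unit column sums of `T` make the total of `T` applied to the residual equal to that of the
  -- residual, which the subtracted mean cancels.
  have hgp : g ∈ ePerp N := by
    have hNC : (N : ℂ) ≠ 0 := by exact_mod_cast hN0.ne'
    rw [mem_ePerp, hg, Finset.sum_sub_distrib]
    simp only [Matrix.mulVec, dotProduct]
    rw [Finset.sum_comm]
    simp only [← Finset.sum_mul,
      col_sum_eq_one hM.irreducible hM.stochastic hM.variances_symm (hcomm N a) (hT1 N a)]
    simp only [avg, one_mul, Finset.sum_const, Finset.card_univ, Fintype.card_fin, nsmul_eq_mul]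
    field_simp
    ring
  have hw := eq_stabInv_mulVec variances_nonneg hM.stochastic hzim
    (mulVec_residual_centred (A := H N a ω) hM.stochastic hM.variances_symm (hcomm N a) (hT1 N a))
  have hle := norm_stabInv_mulVec_le_of_mem_ePerp S z hgp (by positivity) hgle i
  have h2 : ‖(T N a).mulVec (fun k => diagErr (H N a ω) z k - avg (diagErr (H N a ω) z)) i‖ ≤
      GamTilde S z * ((N : ℝ) ^ ε * Ψ N a z ^ 2) := by
    rw [hw]
    exact hle
  rw [mul_left_comm] at h2
  exact absurd hω (not_lt.mpr h2)

end Averaging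

end FluctAvg

theorem theorem4p6
    (δ c : ℝ) (hδ : 0 < δ) (hc : 0 < c) (μ : ℕ → ℝ)
    {A : ℕ → Type*} {Ω : ∀ N, A N → Type*} [∀ N a, MeasurableSpace (Ω N a)]
    (P : ∀ N a, Measure (Ω N a)) [∀ N a, IsProbabilityMeasure (P N a)]
    (H : ∀ N a, Ω N a → Matrix (Fin N) (Fin N) ℂ)
    (hH : ∀ N a, FluctAvg.IsRandomMatrixModel δ μ (P N a) (H N a))
    (Dom : ∀ N, A N → Set ℂ)
    (hDom : ∀ N a, FluctAvg.IsSpectralDomain (FluctAvg.bigM (P N a) (H N a)) (Dom N a))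
    (Ψ : ∀ N, A N → ℂ → ℝ)
    (hΨ : ∀ N a, ∀ z ∈ Dom N a,
      (FluctAvg.bigM (P N a) (H N a)) ^ (-(1 / 2) : ℝ) ≤ Ψ N a z ∧
        Ψ N a z ≤ (FluctAvg.bigM (P N a) (H N a)) ^ (-c))
    (hΛ : FluctAvg.StochDom P (U := fun N a => Dom N a)
      (fun N a z ω => FluctAvg.lambda (H N a ω) z) (fun N a z _ => Ψ N a z))
    (T : ∀ N, A N → Matrix (Fin N) (Fin N) ℂ)
    (hT : ∀ N a i k, ‖T N a i k‖ ≤ (FluctAvg.bigM (P N a) (H N a))⁻¹)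
    (hT' : ∀ N a i, ∑ k, ‖T N a i k‖ ≤ 1) :
    FluctAvg.StochDom P (U := fun N a => Dom N a × Fin N)
        (fun N a u ω => ‖∑ k, T N a u.2 k *
          FluctAvg.fluct (P N a) (H N a) k (fun ω' => 1 / FluctAvg.green (H N a ω') u.1 k k) ω‖)
        (fun N a u _ => Ψ N a u.1 ^ 2) ∧
    FluctAvg.StochDom P (U := fun N a => Dom N a × Fin N)
        (fun N a u ω => ‖∑ k, T N a u.2 k *
          FluctAvg.fluct (P N a) (H N a) k (fun ω' => FluctAvg.green (H N a ω') u.1 k k) ω‖)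
        (fun N a u _ => Ψ N a u.1 ^ 2) ∧
    ((∀ N a, Commute (T N a) (FluctAvg.toC (FluctAvg.variances (P N a) (H N a)))) →
      FluctAvg.StochDom P (U := fun N a => Dom N a × Fin N)
        (fun N a u ω => ‖∑ k, T N a u.2 k * FluctAvg.diagErr (H N a ω) u.1 k‖)
        (fun N a u _ =>
          FluctAvg.Gam (FluctAvg.variances (P N a) (H N a)) u.1 * Ψ N a u.1 ^ 2)) ∧
    ((∀ N a, Commute (T N a) (FluctAvg.toC (FluctAvg.variances (P N a) (H N a)))) →
      (∀ N a i, ∑ k, T N a i k = 1) →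
      FluctAvg.StochDom P (U := fun N a => Dom N a × Fin N)
        (fun N a u ω => ‖∑ k, T N a u.2 k * (FluctAvg.diagErr (H N a ω) u.1 k -
          FluctAvg.avg (FluctAvg.diagErr (H N a ω) u.1))‖)
        (fun N a u _ =>
          FluctAvg.GamTilde (FluctAvg.variances (P N a) (H N a)) u.1 * Ψ N a u.1 ^ 2)) := by
  have hC : FluctAvg.IsControlled δ c μ P H Dom Ψ := ⟨hδ, hc, hH, hDom, hΨ, hΛ⟩
  have hW : FluctAvg.IsWeight P H T := ⟨hT, hT'⟩
  exact ⟨FluctAvg.stochDom_sum_fluct_inv_green hC hW, FluctAvg.stochDom_sum_fluct_green hC hW,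
    FluctAvg.stochDom_sum_diagErr hC hW, FluctAvg.stochDom_sum_diagErr_sub_avg hC hW⟩
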